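/- All graphs are finite and simple, and connected unless they arise by deleting vertices or edges. A vertex $u$ of a cubic graph $G$ is *nice* if $G-N_G[u]$ (the graph obtained by deleting $u$ and its three neighbours) has a perfect matching (the empty graph has one); $\Upsilon(G)$ is the number of nice vertices of $G$. Equality of graphs means isomorphism. *Splicing.* For vertices $u$ of $G_1$ and $v$ of $G_2$ of equal degree and a bijection $\phi:\partial_{G_1}(u)\to\partial_{G_2}(v)$ between the edges at $u$ and those at $v$, the splicing $(G_1\odot G_2)_{u,v,\phi}$ is obtained from the disjoint union of $G_1-u$ and $G_2-v$ by joining, for each edge $e$ at $u$, the end of $e$ in $G_1-u$ to the end of $\phi(e)$ in $G_2-v$. Put $K_{3,3}^\triangle=K_{3,3}\odot K_4$ (a vertex of $K_{3,3}$ is expanded to a triangle), and let $\widehat{\mathcal H}$ be the class of 3-connected cubic bipartite graphs. Let $\mathcal G_1$ be the set of all splicings $(K_{3,3}^\triangle\odot H)_{u,v,\phi}$ with $u$ not nice in $K_{3,3}^\triangle$, $H\in\widehat{\mathcal H}$, $v\in V(H)$, and let $\mathcal G_2$ be the set of all $((K_{3,3}^\triangle\odot H_1)_{u_1,v_1,\phi_1}\odot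 H_2)_{u_2,v_2,\phi_2}$ with $u_1\ne u_2$ both not nice in $K_{3,3}^\triangle$ and $H_i\in\widehat{\mathcal H}$, $v_i\in V(H_i)$ for $i=1,2$. *Edge splicing.* For edges $e_1=x_1x_2$ of $G_1$ and $e_2=y_1y_2$ of $G_2$, the edge splicing $(G_1\oplus G_2)_{e_1,e_2}$ is obtained from the disjoint union of $G_1-e_1$ and $G_2-e_2$ by identifying $x_i$ with $y_i$ for $i=1,2$ (either labelling of the ends is allowed). A *22-edge* is an edge both of whose ends have degree 2. Let $L_n$ ($n\ge1$) be the linear chain of $n$ quadrangles, i.e. the ladder $P_{n+1}\,\square\,K_2$, and let $\mathcal H^\diamond$ be the set of all $(L_n\oplus H)_{e,f}$ with $n\ge1$, $e$ a 22-edge of $L_n$, $H$ a cubic bipartite graph and $f\in E(H)$; every graph in $\mathcal H^\diamond$ has exactly one 22-edge. To replace an edge $e$ of $K_4$ by $D\in\mathcal H^\diamond$ means to edge splice at $e$ with $D$ at its 22-edge. For $1\le i\le 6$, let $\mathcal F_i$ be the set of graphs obtained from $K_4$ by replacing $i$ distinct edges of $K_4$ by $i$ (not necessarily distinct) graphs in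 $\mathcal H^\diamond$. **Theorem 3.1.** Let $G$ be a 2-connected non-bipartite cubic graph. Then (i) $\Upsilon(G)\ge 4$. Moreover, $\Upsilon(G)=4$ if and only if $G\in\{K_4\}\cup\bigcup_{i=1}^6\mathcal F_i$. (ii) If $G$ is 3-connected and $G\ne K_4$, then $\Upsilon(G)\ge 6$. Moreover, $\Upsilon(G)=6$ if and only if $G\in\{\overline{C_6},K_{3,3}^\triangle\}\cup\mathcal G_1\cup\mathcal G_2$, where $\overline{C_6}$, the complement of the 6-cycle, is the triangular prism. -/

import Mathlib

universe u v w

namespace NiceCubic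

/-- The degree of a vertex: the number of its neighbours. -/
noncomputable def deg {V : Type u} (G : SimpleGraph V) (x : V) : ℕ := (G.neighborSet x).ncard

/-- A graph is cubic if every vertex has degree `3`. -/
def IsCubic {V : Type u} (G : SimpleGraph V) : Prop := ∀ x, deg G x = 3

/-- `G` is `k`-connected: it has more than `k` vertices, and deleting fewer than `k` vertices
always leaves a connected graph. -/
def IsKConnected {V : Type u} (k : ℕ) (G : SimpleGraph V) : Prop :=
  k < Nat.card V ∧ ∀ S : Set V, S.Finite → S.ncard < k → (G.induce Sᶜ).Connected

/-- `G` is (isomorphic to) the complete graph `K₄`. -/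
def IsK4 {V : Type u} (G : SimpleGraph V) : Prop := Nonempty (G ≃g (⊤ : SimpleGraph (Fin 4)))

/-! ### Nice vertices -/

/-- A subgraph `H` of `G` is nice if `G - V(H)` has a perfect matching. -/
def IsNiceSubgraph {V : Type u} (G : SimpleGraph V) (H : G.Subgraph) : Prop :=
  ∃ M : (G.induce H.vertsᶜ).Subgraph, M.IsPerfectMatching

/-- A vertex `x` is nice if `x` together with its neighbours induces a nice subgraph. -/
def IsNice {V : Type u} (G : SimpleGraph V) (x : V) : Prop :=
  IsNiceSubgraph G ((⊤ : G.Subgraph).induce (insert x (G.neighborSet x)))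

/-- The number of nice vertices. -/
noncomputable def niceCount {V : Type u} (G : SimpleGraph V) : ℕ := {x : V | IsNice G x}.ncard

/-! ### Splicing -/

/-- The splicing of `G₁` at `x` and `G₂` at `y`: take the disjoint union of `G₁ - x` and `G₂ - y`
and join the ends of corresponding edges. As the graphs are simple, the bijection between the edges
at `x` and the edges at `y` is given as a bijection between the neighbours of `x` and those of
`y`. -/
def splice {V : Type u} {W : Type v} (G₁ : SimpleGraph V) (G₂ : SimpleGraph W) (x : V) (y : W)
    (φ : G₁.neighborSet x ≃ G₂.neighborSet y) :
    SimpleGraph ({a : V // a ≠ x} ⊕ {b : W // b ≠ y}) where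
  Adj
    | .inl a, .inl a' => G₁.Adj a a'
    | .inr b, .inr b' => G₂.Adj b b'
    | .inl a, .inr b => ∃ h : G₁.Adj x a, (φ ⟨a, h⟩ : W) = b
    | .inr b, .inl a => ∃ h : G₁.Adj x a, (φ ⟨a, h⟩ : W) = b
  symm := ⟨by
    rintro (a | b) (a' | b') h
    · exact G₁.adj_symm h
    · exact h
    · exact h
    · exact G₂.adj_symm h⟩
  loopless := ⟨by
    rintro (a | b) h
    · exact G₁.irrefl h
    · exact G₂.irrefl h⟩

/-- The obvious bijection between the neighbours of a vertex of `K₃,₃` and the neighbours of a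
vertex of `K₄`. -/
def k33k4Equiv :
    (completeBipartiteGraph (Fin 3) (Fin 3)).neighborSet (Sum.inl 0) ≃
      (⊤ : SimpleGraph (Fin 4)).neighborSet 0 where
  toFun
    | ⟨.inr j, _⟩ => ⟨j.succ, (Fin.succ_ne_zero j).symm⟩
    | ⟨.inl i, h⟩ => absurd h (by simp)
  invFun b := ⟨.inr (b.1.pred (Ne.symm b.2)), by simp⟩
  left_inv := by
    rintro ⟨i | j, h⟩
    · simp at h
    · simp
  right_inv := by
    rintro ⟨b, h⟩
    simp

/-- The vertex set of `K₃,₃^△`. -/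
abbrev K33TriangleVertex : Type :=
  {a : Fin 3 ⊕ Fin 3 // a ≠ Sum.inl 0} ⊕ {b : Fin 4 // b ≠ 0}

/-- The graph `K₃,₃^△`, the splicing of `K₃,₃` and `K₄`: a vertex of `K₃,₃` is expanded to a
triangle. -/
def K33Triangle : SimpleGraph K33TriangleVertex :=
  splice (completeBipartiteGraph (Fin 3) (Fin 3)) (⊤ : SimpleGraph (Fin 4)) (Sum.inl 0) 0 k33k4Equiv

/-- Finite `3`-connected cubic bipartite graphs. -/
def InHHat {W : Type u} (H : SimpleGraph W) : Prop :=
  Finite W ∧ IsCubic H ∧ IsKConnected 3 H ∧ H.IsBipartite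

/-- The family `𝒢₁`: splicings of `K₃,₃^△`, at a vertex which is not nice in it, with a
`3`-connected cubic bipartite graph. -/
def InG1 {V : Type u} (G : SimpleGraph V) : Prop :=
  ∃ (W : Type u) (H : SimpleGraph W) (x : K33TriangleVertex) (y : W)
    (φ : K33Triangle.neighborSet x ≃ H.neighborSet y),
    InHHat H ∧ ¬ IsNice K33Triangle x ∧ Nonempty (G ≃g splice K33Triangle H x y φ)

/-- The family `𝒢₂`: as `𝒢₁`, but splicing `3`-connected cubic bipartite graphs at two vertices
`x₁`, `x₂` which are not nice in `K₃,₃^△`. (As `x₁` disappears in the first splicing, `x₂ ≠ x₁`.) -/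
def InG2 {V : Type u} (G : SimpleGraph V) : Prop :=
  ∃ (W₁ W₂ : Type u) (H₁ : SimpleGraph W₁) (H₂ : SimpleGraph W₂) (x₁ x₂ : K33TriangleVertex)
    (hx : x₂ ≠ x₁) (y₁ : W₁) (y₂ : W₂)
    (φ₁ : K33Triangle.neighborSet x₁ ≃ H₁.neighborSet y₁)
    (φ₂ : (splice K33Triangle H₁ x₁ y₁ φ₁).neighborSet (Sum.inl ⟨x₂, hx⟩) ≃ H₂.neighborSet y₂),
    InHHat H₁ ∧ InHHat H₂ ∧ ¬ IsNice K33Triangle x₁ ∧ ¬ IsNice K33Triangle x₂ ∧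
      Nonempty (G ≃g
        splice (splice K33Triangle H₁ x₁ y₁ φ₁) H₂ (Sum.inl ⟨x₂, hx⟩) y₂ φ₂)

/-! ### Edge splicing -/

/-- The edge splicing of `G₁` at the edge `x₁x₂` and `G₂` at the edge `y₁y₂`: the union of
`G₁ - x₁x₂` and `G₂ - y₁y₂` with `yᵢ` identified with `xᵢ` for `i = 1, 2`; the identified vertices
are represented by `x₁` and `x₂`. -/
def edgeSplice {V : Type u} {W : Type v} (G₁ : SimpleGraph V) (G₂ : SimpleGraph W)
    (x₁ x₂ : V) (y₁ y₂ : W) : SimpleGraph (V ⊕ {b : W // b ≠ y₁ ∧ b ≠ y₂}) where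
  Adj
    | .inl a, .inl a' => G₁.Adj a a' ∧ s(a, a') ≠ s(x₁, x₂)
    | .inr b, .inr b' => G₂.Adj b b'
    | .inl a, .inr b => (a = x₁ ∧ G₂.Adj y₁ b) ∨ (a = x₂ ∧ G₂.Adj y₂ b)
    | .inr b, .inl a => (a = x₁ ∧ G₂.Adj y₁ b) ∨ (a = x₂ ∧ G₂.Adj y₂ b)
  symm := ⟨by
    rintro (a | b) (a' | b') h
    · exact ⟨G₁.adj_symm h.1, fun e => h.2 (Sym2.eq_swap.trans e)⟩
    · exact h
    · exact h
    · exact G₂.adj_symm h⟩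
  loopless := ⟨by
    rintro (a | b) h
    · exact G₁.irrefl h.1
    · exact G₂.irrefl h⟩

/-- The linear quadrangular chain with `n` quadrangles: the ladder with `n + 1` rungs. -/
def ladder (n : ℕ) : SimpleGraph (Fin (n + 1) × Fin 2) :=
  (SimpleGraph.pathGraph (n + 1)).boxProd (SimpleGraph.pathGraph 2)

/-- `ab` is a `22`-edge: an edge whose two ends have degree `2`. -/
def Is22Edge {V : Type u} (G : SimpleGraph V) (a b : V) : Prop :=
  G.Adj a b ∧ deg G a = 2 ∧ deg G b = 2

/-- Finite connected cubic bipartite graphs. -/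
def InH {W : Type u} (H : SimpleGraph W) : Prop :=
  Finite W ∧ IsCubic H ∧ H.Connected ∧ H.IsBipartite

/-- The family `ℋ^◇` of edge splicings of a linear quadrangular chain, at a `22`-edge `ab`, with a
cubic bipartite graph, at an arbitrary edge `cd`. -/
def InHDiamond {W : Type u} (D : SimpleGraph W) : Prop :=
  ∃ (n : ℕ) (U : Type u) (H : SimpleGraph U) (a b : Fin (n + 1) × Fin 2) (c d : U),
    1 ≤ n ∧ InH H ∧ Is22Edge (ladder n) a b ∧ H.Adj c d ∧
      Nonempty (D ≃g edgeSplice (ladder n) H a b c d)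

/-- `Replaced G k S`: the graph `G` is obtained from `K₄` by replacing the edges in `S`, one after
the other, by graphs in `ℋ^◇`, that is, by edge splicing the current graph at the edge of `K₄` and
the graph in `ℋ^◇` at its `22`-edge. Here `k` gives the positions in `G` of the four vertices of
`K₄`. -/
inductive Replaced : ∀ {V : Type u}, SimpleGraph V → (Fin 4 → V) → Finset (Sym2 (Fin 4)) → Prop
  | base {V : Type u} (G : SimpleGraph V) (k : (⊤ : SimpleGraph (Fin 4)) ≃g G) :
      Replaced G k ∅
  | step {V W : Type u} (G : SimpleGraph V) (k : Fin 4 → V) (S : Finset (Sym2 (Fin 4)))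
      (D : SimpleGraph W) (i j : Fin 4) (a b : W) :
      Replaced G k S → i ≠ j → s(i, j) ∉ S → InHDiamond D → Is22Edge D a b →
      Replaced (edgeSplice G D (k i) (k j) a b) (fun t => Sum.inl (k t)) (insert s(i, j) S)

/-- The family `ℱᵢ` of graphs obtained from `K₄` by replacing exactly `i` of its edges by graphs in
`ℋ^◇`. -/
def InF {V : Type u} (i : ℕ) (G : SimpleGraph V) : Prop :=
  ∃ (W : Type u) (R : SimpleGraph W) (k : Fin 4 → W) (S : Finset (Sym2 (Fin 4))),
    Replaced R k S ∧ S.card = i ∧ Nonempty (G ≃g R)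

end NiceCubic

set_option linter.unusedSectionVars false

/-! The proof takes place among loopless cubic multigraphs without bridges, a class closed under
contracting a side of a 3-edge cut. There a vertex `u` is nice when some submultigraph has degree 3
at `u` and degree 1 elsewhere.

Lower bounds, by induction on the number of vertices. If `u` is not nice, Tutte's theorem yields a
barrier containing the neighbours of `u`, and a tight edge count makes this barrier independent and
every component behind it the shore of a 3-edge cut (`exists_barrier_of_not_nice`). Hence a
non-bipartite multigraph with a vertex that is not nice has a non-trivial 3-edge cut
(`exists_cut_of_not_nice`), and one of its two contractions, say K, is non-bipartite; let H be the
other. Nice vertices of K or H other than the contraction vertex are nice in the whole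
(`Nice.of_contract`), which suffices if H is non-bipartite too, or if the contraction vertex of K is
not nice. Otherwise H is bipartite and the lost contraction vertex is made up for by vertices b of H
such that H has a factor of degree 3 at both b and its contraction vertex (`Nice.of_twoNice`). By
augmenting paths, b in the opposite colour class fails only if it lies in a `Bad` set. Bad sets
uncross, the maximal ones are disjoint with cuts of size 2 or 3, and `exists_max_bad` counts the
surviving b: one plus the number of maximal bad sets with cut 3. This is at least one, and at least
three if there is no 2-edge cut. The outcome is `four_le_niceNum` and `six_le_niceNum`.

Equality in (i). A hidden vertex, one in a bipartite set with a 2-edge cut, is never nice, and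
exactly four nice vertices force all others to be hidden. `exists_replaced` cuts out a largest
hidden set, joins its two outer neighbours by an edge and recurses down to `K₄`; the removed set is
a ladder ending in a cubic bipartite graph.

Equality in (ii). The induction shows that either there are six vertices, which gives the prism, or
contracting two disjoint bipartite sets (possibly single vertices) gives `K₃,₃^△` with the two sets
contracted to its non-nice vertices (`IsShape`). Such a structure never has more than six nice
vertices, and undoing the contractions is splicing (`exists_splice_iso`). -/

namespace NiceCubic

/-! ### Edge counts between vertex sets. -/

open scoped Classical in
/-- The total weight of the pairs in `X ×ˢ Y`. -/
noncomputable def wsum {V : Type*} [Fintype V] (w : V → V → ℕ) (X Y : Set V) : ℕ :=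
  ∑ x, ∑ y, if x ∈ X ∧ y ∈ Y then w x y else 0

section wsum
variable {V : Type*} [Fintype V] {w w' : V → V → ℕ}

lemma wsum_comm (h : ∀ x y, w x y = w y x) (X Y : Set V) : wsum w X Y = wsum w Y X := by
  unfold wsum
  rw [Finset.sum_comm]
  refine Finset.sum_congr rfl fun x _ => Finset.sum_congr rfl fun y _ => ?_
  split_ifs <;> grind

lemma wsum_union_left {X X' : Set V} (h : Disjoint X X') (Y : Set V) :
    wsum w (X ∪ X') Y = wsum w X Y + wsum w X' Y := by
  unfold wsum
  simp only [← Finset.sum_add_distrib]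
  refine Finset.sum_congr rfl fun x _ => Finset.sum_congr rfl fun y _ => ?_
  have : ¬ (x ∈ X ∧ x ∈ X') := fun hh => Set.disjoint_left.1 h hh.1 hh.2
  split_ifs <;> grind

lemma wsum_union_right {Y Y' : Set V} (h : Disjoint Y Y') (X : Set V) :
    wsum w X (Y ∪ Y') = wsum w X Y + wsum w X Y' := by
  unfold wsum
  simp only [← Finset.sum_add_distrib]
  refine Finset.sum_congr rfl fun x _ => Finset.sum_congr rfl fun y _ => ?_
  have : ¬ (y ∈ Y ∧ y ∈ Y') := fun hh => Set.disjoint_left.1 h hh.1 hh.2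
  split_ifs <;> grind

lemma wsum_iUnion_left {ι : Type*} [Fintype ι] {C : ι → Set V}
    (h : Pairwise (Function.onFun Disjoint C)) (Y : Set V) :
    wsum w (⋃ i, C i) Y = ∑ i, wsum w (C i) Y := by
  unfold wsum
  rw [Finset.sum_comm (s := (Finset.univ : Finset ι))]
  refine Finset.sum_congr rfl fun x _ => ?_
  rw [Finset.sum_comm (s := (Finset.univ : Finset ι))]
  refine Finset.sum_congr rfl fun y _ => ?_
  by_cases hx : ∃ i, x ∈ C i
  · obtain ⟨i, hi⟩ := hx
    rw [Finset.sum_eq_single i]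
    · have : x ∈ ⋃ i, C i := Set.mem_iUnion.2 ⟨i, hi⟩
      split_ifs <;> grind
    · intro j _ hj
      have : x ∉ C j := fun hh => Set.disjoint_left.1 (h hj) hh hi
      exact if_neg fun hh => this hh.1
    · simp
  · have : x ∉ ⋃ i, C i := fun hh => hx (Set.mem_iUnion.1 hh)
    rw [if_neg fun hh => this hh.1]
    exact (Finset.sum_eq_zero fun i _ => if_neg fun hh => hx ⟨i, hh.1⟩).symm

lemma wsum_mono (h : ∀ x y, w x y ≤ w' x y) {X X' Y Y' : Set V} (hX : X ⊆ X') (hY : Y ⊆ Y') :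
    wsum w X Y ≤ wsum w' X' Y' := by
  unfold wsum
  refine Finset.sum_le_sum fun x _ => Finset.sum_le_sum fun y _ => ?_
  split_ifs with h1 h2
  · exact h x y
  · exact absurd ⟨hX h1.1, hY h1.2⟩ h2
  · exact Nat.zero_le _
  · exact le_rfl

lemma wsum_eq_zero {X Y : Set V} : wsum w X Y = 0 ↔ ∀ x ∈ X, ∀ y ∈ Y, w x y = 0 := by
  unfold wsum
  simp only [Finset.sum_eq_zero_iff, Finset.mem_univ, true_implies, ite_eq_right_iff]
  grind

lemma wsum_pos {X Y : Set V} : 0 < wsum w X Y ↔ ∃ x ∈ X, ∃ y ∈ Y, 0 < w x y := by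
  rw [Nat.pos_iff_ne_zero, Ne, wsum_eq_zero]
  push Not
  simp only [Nat.pos_iff_ne_zero]

@[simp] lemma wsum_empty_left (Y : Set V) : wsum w ∅ Y = 0 := by simp [wsum]
@[simp] lemma wsum_empty_right (Y : Set V) : wsum w Y ∅ = 0 := by simp [wsum]

lemma wsum_singleton_left (x : V) (Y : Set V) [DecidablePred (· ∈ Y)] :
    wsum w {x} Y = ∑ y, if y ∈ Y then w x y else 0 := by
  unfold wsum
  rw [Finset.sum_eq_single x]
  · refine Finset.sum_congr rfl fun y _ => ?_
    by_cases h : y ∈ Y <;> simp [h]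
  · intro b _ hb; simp [hb]
  · simp

@[simp] lemma wsum_singleton_univ (x : V) : wsum w {x} Set.univ = ∑ y, w x y := by
  classical
  simp [wsum_singleton_left]

@[simp] lemma wsum_singleton (x y : V) : wsum w {x} {y} = w x y := by
  classical
  simp [wsum_singleton_left]

lemma wsum_add_compl (X Y : Set V) : wsum w X Y + wsum w X Yᶜ = wsum w X Set.univ := by
  rw [← wsum_union_right disjoint_compl_right, Set.union_compl_self]

lemma wsum_insert_left {x : V} {X : Set V} (hx : x ∉ X) (Y : Set V) :
    wsum w (insert x X) Y = wsum w {x} Y + wsum w X Y := by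
  rw [Set.insert_eq, wsum_union_left (by simpa using hx)]

lemma wsum_insert_right {x : V} {X : Set V} (hx : x ∉ X) (Y : Set V) :
    wsum w Y (insert x X) = wsum w Y {x} + wsum w Y X := by
  rw [Set.insert_eq, wsum_union_right (by simpa using hx)]

lemma wsum_univ_right_of_deg {X : Set V} {k : ℕ} (h : ∀ x ∈ X, ∑ y, w x y = k) :
    wsum w X Set.univ = k * X.ncard := by
  classical
  have : wsum w X Set.univ = ∑ x, if x ∈ X then k else 0 := by
    refine Finset.sum_congr rfl fun x _ => ?_
    by_cases hx : x ∈ X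
    · simp [hx, h x hx]
    · simp [hx]
  rw [this, ← Finset.sum_filter, Finset.sum_const, smul_eq_mul,
    mul_comm, Set.ncard_eq_toFinset_card']
  congr 2
  ext; simp

lemma even_wsum_self (hs : ∀ x y, w x y = w y x) (h0 : ∀ x, w x x = 0) (X : Set V) :
    Even (wsum w X X) := by
  induction X, X.toFinite using Set.Finite.induction_on with
  | empty => simp
  | @insert a s ha _ ih =>
    rw [wsum_insert_left ha, wsum_insert_right ha, wsum_insert_right ha, wsum_singleton, h0,
      wsum_comm hs s {a}]
    obtain ⟨k, hk⟩ := ih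
    exact ⟨wsum w {a} s + k, by omega⟩

end wsum

/-! ### Cubic multigraphs, edge cuts, factors and coloured sets. -/

/-- Loopless multigraphs, given by the multiplicities of the edges. -/
structure MG (V : Type u) where
  m : V → V → ℕ
  symm : ∀ x y, m x y = m y x
  loopless : ∀ x, m x x = 0

namespace MG
variable {V : Type u} [Fintype V] (M : MG V)

/-- The number of edges between `X` and `Y`. -/
noncomputable abbrev e (X Y : Set V) : ℕ := wsum M.m X Y

/-- The size of the edge cut of `X`. -/
noncomputable abbrev cut (X : Set V) : ℕ := wsum M.m X Xᶜ

lemma e_comm (X Y : Set V) : M.e X Y = M.e Y X := wsum_comm M.symm X Y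

lemma cut_compl (X : Set V) : M.cut Xᶜ = M.cut X := by
  rw [cut, compl_compl, wsum_comm M.symm]

/-- All vertices have degree `3`. -/
def Cubic : Prop := ∀ x, ∑ y, M.m x y = 3

/-- Every edge cut has at least `k` edges. -/
def EC (k : ℕ) : Prop := ∀ X : Set V, X.Nonempty → Xᶜ.Nonempty → k ≤ M.cut X

/-- The sub-multigraph `F` has degrees `δ`. -/
structure IsFactor (δ : V → ℕ) (F : V → V → ℕ) : Prop where
  symm : ∀ x y, F x y = F y x
  le : ∀ x y, F x y ≤ M.m x y
  deg : ∀ x, ∑ y, F x y = δ x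

open scoped Classical in
/-- A vertex is nice if there is a factor with degree `3` at it and degree `1` elsewhere. -/
def Nice (u : V) : Prop := ∃ F, M.IsFactor (fun v => if v = u then 3 else 1) F

/-- `A` is a colour class of a proper `2`-colouring of the subgraph induced by `X`. -/
def ColOn (X A : Set V) : Prop := ∀ x ∈ X, ∀ y ∈ X, M.m x y ≠ 0 → (x ∈ A ↔ y ∉ A)

/-- The multigraph is bipartite. -/
def Bip : Prop := ∃ A, M.ColOn Set.univ A

/-- The vertex lies in a set with a bipartite induced subgraph and an edge cut of size `2`. -/
def Hidden (v : V) : Prop := ∃ X A, v ∈ X ∧ M.cut X = 2 ∧ M.ColOn X A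

/-- The number of nice vertices. -/
noncomputable def niceNum : ℕ := {v | M.Nice v}.ncard

variable {M}

lemma EC.mono {k l : ℕ} (h : M.EC k) (hl : l ≤ k) : M.EC l := fun X h1 h2 => hl.trans (h X h1 h2)

lemma Cubic.e_univ (h : M.Cubic) (X : Set V) : M.e X Set.univ = 3 * X.ncard :=
  wsum_univ_right_of_deg fun x _ => h x

lemma Cubic.e_add_cut (h : M.Cubic) (X : Set V) : M.e X X + M.cut X = 3 * X.ncard := by
  rw [← h.e_univ, wsum_add_compl]

lemma Cubic.cut_parity (h : M.Cubic) (X : Set V) : M.cut X % 2 = X.ncard % 2 := by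
  have h1 := h.e_add_cut X
  obtain ⟨k, hk⟩ := even_wsum_self M.symm M.loopless X
  rw [e] at h1
  omega

lemma Cubic.cut_singleton (h : M.Cubic) (x : V) : M.cut {x} = 3 := by
  have := h.e_add_cut {x}
  simpa [e, M.loopless] using this

lemma Cubic.even_card (h : M.Cubic) : Even (Fintype.card V) := by
  have := h.cut_parity Set.univ
  simp [cut, Set.ncard_univ] at this
  rw [Nat.even_iff]; omega

lemma ColOn.mono {X Y A : Set V} (h : M.ColOn Y A) (hXY : X ⊆ Y) : M.ColOn X A :=
  fun x hx y hy => h x (hXY hx) y (hXY hy)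

lemma ColOn.compl {X A : Set V} (h : M.ColOn X A) : M.ColOn X Aᶜ := by
  intro x hx y hy hm
  have := h x hx y hy hm
  simp only [Set.mem_compl_iff]; tauto

/-- In a coloured set, all edges join the two colour classes. -/
lemma ColOn.wsum_left {X A : Set V} (h : M.ColOn X A) {F : V → V → ℕ} (hF : ∀ x y, F x y ≤ M.m x y) :
    wsum F (X ∩ A) Set.univ = wsum F (X ∩ A) (X \ A) + wsum F (X ∩ A) Xᶜ := by
  have : (Set.univ : Set V) = ((X ∩ A) ∪ (X \ A)) ∪ Xᶜ := by
    ext; simp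
  rw [this, wsum_union_right, wsum_union_right, (wsum_eq_zero (X := X ∩ A) (Y := X ∩ A)).2, zero_add]
  · intro x hx y hy
    by_contra h0
    have := h x hx.1 y hy.1 (by have := hF x y; omega)
    exact (this.1 hx.2) hy.2
  · exact Set.disjoint_left.2 fun x hx hy => hy.2 hx.2
  · rw [Set.inter_union_sdiff]; exact disjoint_compl_right

lemma ColOn.wsum_right {X A : Set V} (h : M.ColOn X A) {F : V → V → ℕ} (hF : ∀ x y, F x y ≤ M.m x y)
    (hs : ∀ x y, F x y = F y x) :
    wsum F (X \ A) Set.univ = wsum F (X ∩ A) (X \ A) + wsum F (X \ A) Xᶜ := by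
  have := h.compl.wsum_left hF
  rw [← Set.sdiff_eq_compl_inter.trans (Set.inter_comm _ _), Set.sdiff_compl] at this
  rw [this, wsum_comm hs (X \ A) (X ∩ A)]

/-- Every edge inside `X` joins the two classes, so the two degree sums differ only in the edges
that leave `X`. Most counts for bipartite sets below rest on this identity. -/
lemma Cubic.colOn_card (hc : M.Cubic) {X A : Set V} (h : M.ColOn X A) :
    3 * (X ∩ A).ncard + M.e (X \ A) Xᶜ = 3 * (X \ A).ncard + M.e (X ∩ A) Xᶜ := by
  have h1 := h.wsum_left (F := M.m) fun _ _ => le_rfl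
  have h2 := h.wsum_right (F := M.m) (fun _ _ => le_rfl) M.symm
  have h3 := hc.e_univ (X ∩ A)
  have h4 := hc.e_univ (X \ A)
  simp only [e] at *
  omega

lemma cut_split (X A : Set V) : M.cut X = M.e (X ∩ A) Xᶜ + M.e (X \ A) Xᶜ := by
  rw [cut, ← wsum_union_left, Set.inter_union_sdiff]
  exact Set.disjoint_left.2 fun x hx hy => hy.2 hx.2

end MG
end NiceCubic

/-! ### Tutte's theorem, perfect matchings and barriers. -/

namespace NiceCubic
namespace MG
variable {V : Type u} [Fintype V] {M : MG V}

/-- This is Tutte's theorem after deleting `W`. The last clause records that the number of odd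
components has the parity of the number of remaining vertices; it improves the strict inequality to
a surplus of two in the applications. -/
lemma exists_matching_or_barrier (M : MG V) (W : Set V) :
    (∃ F : V → V → ℕ, (∀ x y, F x y = F y x) ∧ (∀ x y, F x y ≤ M.m x y) ∧
      (∀ x ∈ W, ∀ y, F x y = 0) ∧ ∀ x ∉ W, ∑ y, F x y = 1) ∨
    ∃ (S : Set V) (ι : Type u) (_ : Fintype ι) (C : ι → Set V), Disjoint W S ∧
      Pairwise (Function.onFun Disjoint C) ∧ (∀ i, Odd (C i).ncard) ∧ (∀ i, C i ⊆ (W ∪ S)ᶜ) ∧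
      (∀ i, M.e (C i) ((W ∪ S)ᶜ \ C i) = 0) ∧ S.ncard < Fintype.card ι ∧
      (Fintype.card ι + W.ncard + S.ncard + Fintype.card V) % 2 = 0 := by
  classical
  let G : SimpleGraph {v : V // v ∉ W} :=
    { Adj := fun x y => M.m x y ≠ 0
      symm := ⟨fun x y h => by rw [M.symm]; exact h⟩
      loopless := ⟨fun x h => h (M.loopless x)⟩ }
  by_cases hG : ∃ N : G.Subgraph, N.IsPerfectMatching
  · left
    obtain ⟨N, hN⟩ := hG
    refine ⟨fun x y => if ∃ (hx : x ∉ W) (hy : y ∉ W), N.Adj ⟨x, hx⟩ ⟨y, hy⟩ then 1 else 0,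
      ?_, ?_, ?_, ?_⟩
    · intro x y
      have : (∃ (hx : x ∉ W) (hy : y ∉ W), N.Adj ⟨x, hx⟩ ⟨y, hy⟩) ↔
          ∃ (hy : y ∉ W) (hx : x ∉ W), N.Adj ⟨y, hy⟩ ⟨x, hx⟩ :=
        ⟨fun ⟨h1, h2, h3⟩ => ⟨h2, h1, h3.symm⟩, fun ⟨h1, h2, h3⟩ => ⟨h2, h1, h3.symm⟩⟩
      simp only [this]
    · intro x y
      show (if _ then 1 else 0) ≤ _
      split_ifs with h
      · obtain ⟨h1, h2, h3⟩ := h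
        exact Nat.one_le_iff_ne_zero.2 h3.adj_sub
      · exact Nat.zero_le _
    · intro x hx y
      exact if_neg fun ⟨h, _⟩ => h hx
    · intro x hx
      obtain ⟨⟨y, hy⟩, hxy, huniq⟩ := hN.1 (hN.2 ⟨x, hx⟩)
      rw [Finset.sum_eq_single y]
      · exact if_pos ⟨hx, hy, hxy⟩
      · intro z _ hz
        refine if_neg ?_
        rintro ⟨_, h2, h3⟩
        exact hz (congrArg Subtype.val (huniq ⟨z, h2⟩ h3))
      · simp
  · right
    rw [SimpleGraph.tutte] at hG
    push Not at hG
    obtain ⟨u, hu⟩ := hG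
    unfold SimpleGraph.IsTutteViolator at hu
    set H := ((⊤ : G.Subgraph).deleteVerts u).coe with hH
    let val : ((⊤ : G.Subgraph).deleteVerts u).verts → V := fun z => z.1.1
    have hval : Function.Injective val := fun a b h => Subtype.ext (Subtype.ext h)
    have hadj : ∀ a b, M.m (val a) (val b) ≠ 0 → H.Adj a b := by
      intro a b hab
      simp only [hH, SimpleGraph.Subgraph.coe_adj, SimpleGraph.Subgraph.deleteVerts_adj]
      exact ⟨trivial, a.2.2, trivial, b.2.2, hab⟩
    have hrange : Set.range val = (W ∪ (Subtype.val '' u))ᶜ := by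
      ext x
      constructor
      · rintro ⟨a, rfl⟩ (h | ⟨z, hz, h⟩)
        · exact a.1.2 h
        · have : z = a.1 := Subtype.ext h
          exact a.2.2 (this ▸ hz)
      · intro hx
        have h1 : x ∉ W := fun h => hx (Or.inl h)
        refine ⟨⟨⟨x, h1⟩, ⟨trivial, fun h => hx (Or.inr ⟨_, h, rfl⟩)⟩⟩, rfl⟩
    have hdisj : Disjoint W (Subtype.val '' u) := by
      rw [Set.disjoint_left]
      rintro x hx ⟨z, _, rfl⟩
      exact z.2 hx
    have hfin : Finite (ULift.{u} H.oddComponents) := inferInstance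
    obtain ⟨inst⟩ := nonempty_fintype (ULift.{u} H.oddComponents)
    refine ⟨Subtype.val '' u, ULift.{u} H.oddComponents, inst,
      fun i => val '' i.down.1.supp, hdisj, ?_, ?_, ?_, ?_, ?_, ?_⟩
    · intro i j hij
      rw [Function.onFun, Set.disjoint_image_iff hval]
      refine SimpleGraph.pairwise_disjoint_supp_connectedComponent _ ?_
      exact fun h => hij (ULift.ext _ _ (Subtype.ext h))
    · intro i
      rw [Set.ncard_image_of_injective _ hval]
      exact i.down.2
    · intro i
      rw [← hrange]
      exact Set.image_subset_range _ _
    · intro i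
      rw [e, wsum_eq_zero]
      rintro _ ⟨a, ha, rfl⟩ y ⟨hy1, hy2⟩
      rw [← hrange] at hy1
      obtain ⟨b, rfl⟩ := hy1
      by_contra hne
      exact hy2 ⟨b, SimpleGraph.ConnectedComponent.mem_supp_of_adj_mem_supp _ ha (hadj _ _ hne), rfl⟩
    · rw [Set.ncard_image_of_injective _ Subtype.val_injective, ← Nat.card_eq_fintype_card,
        Nat.card_ulift, Nat.card_coe_set_eq]
      exact hu
    · rw [← Nat.card_eq_fintype_card (α := ULift _), Nat.card_ulift, Nat.card_coe_set_eq]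
      have h1 := SimpleGraph.odd_ncard_oddComponents (G := H)
      have h2 : Nat.card ((⊤ : G.Subgraph).deleteVerts u).verts = (W ∪ (Subtype.val '' u))ᶜ.ncard := by
        rw [← hrange, ← Set.image_univ, Set.ncard_image_of_injective _ hval, Set.ncard_univ]
      have h3 := Set.ncard_add_ncard_compl (W ∪ (Subtype.val '' u))
      rw [Set.ncard_union_eq hdisj, Nat.card_eq_fintype_card] at h3
      rw [h2, Nat.odd_iff, Nat.odd_iff] at h1
      omega

/-- Every edge of a cubic bridgeless multigraph lies in a perfect matching. -/
lemma exists_factor_one (hc : M.Cubic) (he : M.EC 2) {x y : V} (hxy : M.m x y ≠ 0) :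
    ∃ F, M.IsFactor (fun _ => 1) F ∧ F x y = 1 := by
  classical
  have hne : x ≠ y := by rintro rfl; exact hxy (M.loopless x)
  rcases M.exists_matching_or_barrier {x, y} with ⟨F, hs, hle, h0, h1⟩ |
    ⟨S, ι, _, C, hd, hC, hodd, hsub, hcl, hlt, hpar⟩
  · have h0' : ∀ a, ∀ b, b = x ∨ b = y → F a b = 0 := fun a b hb => by
      rw [hs]; exact h0 b (by simpa using hb) a
    have hx0 : ∀ b, F x b = 0 := h0 x (by simp)
    have hy0 : ∀ b, F y b = 0 := h0 y (by simp)
    refine ⟨fun a b => F a b + if (a = x ∧ b = y) ∨ (a = y ∧ b = x) then 1 else 0,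
      ⟨?_, ?_, ?_⟩, ?_⟩
    · intro a b
      have : ((a = x ∧ b = y) ∨ (a = y ∧ b = x)) ↔ ((b = x ∧ a = y) ∨ (b = y ∧ a = x)) := by tauto
      simp only [hs a b, this]
    · intro a b
      split_ifs with h
      · rcases h with ⟨h1, h2⟩ | ⟨h1, h2⟩
        · rw [h1, h2, hx0]; omega
        · rw [h1, h2, hy0, M.symm]; omega
      · simpa using hle a b
    · intro a
      rw [Finset.sum_add_distrib]
      by_cases ha : a = x
      · rw [ha]
        simp [hx0, hne]
      by_cases hb : a = y
      · rw [hb]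
        simp [hy0, hne.symm]
      · rw [h1 a (by simp [ha, hb])]
        simp [ha, hb]
    · simp [hx0]
  · exfalso
    set B := ({x, y} : Set V) ∪ S with hB
    have hcut : ∀ i, M.cut (C i) = M.e (C i) B := by
      intro i
      have : (C i)ᶜ = B ∪ (Bᶜ \ C i) := by
        ext z
        have := @hsub i z
        simp only [Set.mem_compl_iff, Set.mem_union, Set.mem_sdiff]
        tauto
      rw [cut, this, wsum_union_right]
      · have := hcl i
        rw [e] at this
        rw [this, add_zero]
      · exact Set.disjoint_left.2 fun z h1 h2 => h2.1 h1
    -- An odd set has an odd cut, so the bound 2 improves to 3.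
    have h3 : ∀ i, 3 ≤ M.cut (C i) := by
      intro i
      have h1 := hc.cut_parity (C i)
      have h2 := he (C i) (by
        rw [← Set.ncard_pos]; exact (hodd i).pos) ⟨x, fun h => hsub i h (by simp [hB])⟩
      have := hodd i
      rw [Nat.odd_iff] at this
      omega
    have hsum : 3 * Fintype.card ι ≤ M.e (⋃ i, C i) B := by
      rw [e, wsum_iUnion_left hC, mul_comm, ← smul_eq_mul, ← Finset.card_univ]
      exact Finset.card_nsmul_le_sum _ _ _ fun i _ => (h3 i).trans (hcut i).le
    have hle : M.e (⋃ i, C i) B ≤ M.cut B := by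
      rw [cut, wsum_comm M.symm B]
      exact wsum_mono (fun _ _ => le_rfl) (Set.iUnion_subset hsub) le_rfl
    have hxyE : 2 ≤ M.e B B := by
      calc 2 ≤ M.e {x, y} {x, y} := by
            rw [e, wsum_insert_left (by simpa using hne), wsum_insert_right (by simpa using hne),
              wsum_insert_right (by simpa using hne)]
            simp only [wsum_singleton, M.loopless, M.symm y x]; omega
        _ ≤ _ := wsum_mono (fun _ _ => le_rfl) Set.subset_union_left Set.subset_union_left
    have h5 := hc.e_add_cut B
    have h6 : B.ncard = 2 + S.ncard := by
      rw [hB, Set.ncard_union_eq hd, Set.ncard_pair hne]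
    have h7 := hc.even_card
    rw [Nat.even_iff] at h7
    -- By parity there are at least `|S| + 2 = |B|` odd components, which need `3|B|` edges into
    -- `B`; the edge `xy` inside `B` leaves at most `3|B| - 2`.
    rw [Set.ncard_pair hne] at hpar
    omega

lemma ncard_nbrs (hc : M.Cubic) {u : V} (hu : ∀ v, M.m u v ≤ 1) :
    {v | M.m u v ≠ 0}.ncard = 3 := by
  classical
  have := hc u
  rw [Set.ncard_eq_toFinset_card', ← this, Finset.card_eq_sum_ones, Set.toFinset_ofPred, Finset.sum_filter]
  refine Finset.sum_congr rfl fun v _ => ?_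
  have := hu v
  split_ifs <;> omega

/-- A vertex which is not nice is a trivial component left by a barrier. -/
lemma exists_barrier_of_not_nice (hc : M.Cubic) (he : M.EC 2) {u : V} (hu : ∀ v, M.m u v ≤ 1)
    (hn : ¬ M.Nice u) : ∃ (B : Set V) (ι : Type u) (_ : Fintype ι) (C : ι → Set V), u ∉ B ∧
      (∀ v, M.m u v ≠ 0 → v ∈ B) ∧
      Pairwise (Function.onFun Disjoint C) ∧ (⋃ i, C i) = (insert u B)ᶜ ∧
      (∀ i, M.cut (C i) = 3) ∧ (∀ i, M.e (C i) B = 3) ∧ M.e B B = 0 := by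
  classical
  set N : Set V := {v | M.m u v ≠ 0} with hN
  have huN : u ∉ N := by simp [hN, M.loopless]
  have hN3 : N.ncard = 3 := ncard_nbrs hc hu
  rcases M.exists_matching_or_barrier (insert u N) with ⟨F, hs, hle, h0, h1⟩ |
    ⟨S, ι, _, C, hd, hC, hodd, hsub, hcl, hlt, hpar⟩
  · refine absurd ?_ hn
    have hu0 : ∀ b, F u b = 0 := h0 u (by simp)
    refine ⟨fun a b => F a b + if a = u ∨ b = u then M.m a b else 0, ?_, ?_, ?_⟩
    · intro a b
      simp only [hs a b, or_comm, M.symm a b]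
    · intro a b
      split_ifs with h
      · rcases h with rfl | rfl
        · rw [hu0]; omega
        · rw [hs, hu0]; omega
      · simpa using hle a b
    · intro a
      rw [Finset.sum_add_distrib]
      by_cases ha : a = u
      · subst ha
        simp [hu0, hc a]
      · simp only [ha, false_or, Finset.sum_ite_eq', Finset.mem_univ, if_true, if_false]
        by_cases hb : a ∈ N
        · have h2 := hu a
          have h3 : M.m u a ≠ 0 := hb
          rw [Finset.sum_eq_zero fun b _ => h0 a (by simp [hb]) b, M.symm]
          omega
        · have h3 : ¬ (M.m u a ≠ 0) := hb
          rw [h1 a (by simp [ha, hb]), M.symm]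
          omega
  · have huS : u ∉ S := fun h => Set.disjoint_left.1 hd (Set.mem_insert _ _) h
    set B : Set V := N ∪ S with hB
    have huB : u ∉ B := by simp [hB, huN, huS]
    have hWB : insert u N ∪ S = insert u B := by rw [hB, Set.insert_union]
    rw [hWB] at hsub hcl
    have hNB : ∀ v, M.m u v ≠ 0 → v ∈ B := fun v hv => Or.inl hv
    have heu : ∀ X : Set V, Disjoint X B → M.e X {u} = 0 := by
      intro X hX
      rw [e, wsum_eq_zero]
      rintro x hx y rfl
      by_contra h
      exact Set.disjoint_left.1 hX hx (hNB x (by rwa [M.symm]))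
    have hsubB : ∀ i, Disjoint (C i) B := fun i =>
      Set.disjoint_left.2 fun x h1 h2 => hsub i h1 (Or.inr h2)
    have hcut : ∀ i, M.cut (C i) = M.e (C i) B := by
      intro i
      have : (C i)ᶜ = insert u B ∪ ((insert u B)ᶜ \ C i) := by
        ext z
        have := @hsub i z
        simp only [Set.mem_compl_iff, Set.mem_union, Set.mem_sdiff] at this ⊢
        tauto
      rw [cut, this, wsum_union_right, wsum_insert_right huB]
      · have := hcl i
        have h2 := heu _ (hsubB i)
        rw [e] at this h2
        rw [this, h2, add_zero, zero_add]
      · exact Set.disjoint_left.2 fun z h1 h2 => h2.1 h1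
    have h3 : ∀ i, 3 ≤ M.cut (C i) := by
      intro i
      have h1 := hc.cut_parity (C i)
      have h2 := he (C i) (by
        rw [← Set.ncard_pos]; exact (hodd i).pos) ⟨u, fun h => hsub i h (by simp)⟩
      have := hodd i
      rw [Nat.odd_iff] at this
      omega
    set U : Set V := ⋃ i, C i with hU
    set R : Set V := (insert u B)ᶜ \ U with hR
    have hUsub : U ⊆ (insert u B)ᶜ := Set.iUnion_subset hsub
    have hsumE : M.e U B = ∑ i, M.cut (C i) := by
      rw [hU, e, wsum_iUnion_left hC]
      exact Finset.sum_congr rfl fun i _ => (hcut i).symm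
    have hsum : 3 * Fintype.card ι ≤ M.e U B := by
      rw [hsumE, mul_comm, ← smul_eq_mul, ← Finset.card_univ]
      exact Finset.card_nsmul_le_sum _ _ _ fun i _ => h3 i
    have hBcut : M.cut B = M.e B {u} + M.e U B + M.e R B := by
      have : Bᶜ = insert u (U ∪ R) := by
        ext z
        have := @hUsub z
        simp only [Set.mem_compl_iff, Set.mem_insert_iff, Set.mem_union, hR, Set.mem_sdiff] at this ⊢
        by_cases hz : z = u
        · subst hz; simp [huB]
        · tauto
      rw [cut, this, wsum_insert_right, wsum_union_right, wsum_comm M.symm B U,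
        wsum_comm M.symm B R, add_assoc]
      · exact Set.disjoint_left.2 fun z h1 h2 => h2.2 h1
      · rintro (h | h)
        · exact hUsub h (by simp)
        · exact h.1 (by simp)
    have hBu : M.e B {u} = 3 := by
      have h1 := hc.e_univ {u}
      have h2 := wsum_add_compl (w := M.m) {u} B
      have h3 := heu Bᶜ disjoint_compl_left
      rw [Set.ncard_singleton] at h1
      rw [e, wsum_comm M.symm] at h3 ⊢
      rw [e] at h1
      omega
    have h5 := hc.e_add_cut B
    have hNS : Disjoint N S := hd.mono_left (Set.subset_insert _ _)
    have h6 : B.ncard = 3 + S.ncard := by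
      rw [hB, Set.ncard_union_eq hNS, hN3]
    have h7 := hc.even_card
    rw [Nat.even_iff] at h7
    rw [Set.ncard_insert_of_notMem huN, hN3] at hpar
    -- Parity gives at least `|S| + 2` odd components. With the three edges at `u` they need at
    -- least `3(|S| + 3) = 3|B|` edges of `B`, which is all that `B` has. So every estimate is an
    -- equality: no edge inside `B`, none from `B` to the even components `R`, and exactly three
    -- from each odd component.
    have hRB : M.e R B = 0 := by omega
    have hBB : M.e B B = 0 := by omega
    have hι : Fintype.card ι = S.ncard + 2 := by omega
    have hUB : M.e U B = 3 * Fintype.card ι := by omega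
    -- `R` has no edge to anything else, so it would have an empty cut.
    have hRempty : R = ∅ := by
      by_contra hne
      have h1 := he R (Set.nonempty_iff_ne_empty.2 hne) ⟨u, fun h => h.1 (by simp)⟩
      have h2 : M.e R U = 0 := by
        rw [e_comm, hU, e, wsum_iUnion_left hC]
        refine Finset.sum_eq_zero fun i _ => ?_
        have := hcl i
        rw [e, wsum_eq_zero] at this
        rw [wsum_eq_zero]
        intro x hx y hy
        exact this x hx y ⟨hy.1, fun h => hy.2 (Set.mem_iUnion.2 ⟨i, h⟩)⟩
      have h3 := heu R (Set.disjoint_left.2 fun x h1 h2 => h1.1 (Or.inr h2))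
      have : Rᶜ = insert u B ∪ U := by
        ext z
        have := @hUsub z
        simp only [Set.mem_compl_iff, hR, Set.mem_sdiff, Set.mem_union] at this ⊢
        tauto
      rw [cut, this, wsum_union_right, wsum_insert_right huB] at h1
      · simp only [e] at *
        omega
      · exact Set.disjoint_left.2 fun z h1 h2 => hUsub h2 h1
    have hcut3 : ∀ i, M.cut (C i) = 3 := by
      have h8 : ∑ i, M.cut (C i) = ∑ i : ι, 3 := by
        rw [← hsumE, hUB]; simp [mul_comm]
      intro i
      exact ((Finset.sum_eq_sum_iff_of_le fun i _ => h3 i).1 h8.symm i (Finset.mem_univ _)).symm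
    refine ⟨B, ι, inferInstance, C, huB, hNB, hC, ?_, hcut3, fun i => (hcut i).symm.trans (hcut3 i), hBB⟩
    refine Set.Subset.antisymm hUsub fun z hz => ?_
    by_contra h
    have : z ∈ R := ⟨hz, h⟩
    simp [hRempty] at this

/-- If some vertex of a non-bipartite multigraph is not nice, then there is a non-trivial
`3`-edge cut. -/
lemma exists_cut_of_not_nice (hc : M.Cubic) (he : M.EC 2) (hb : ¬ M.Bip) {u : V}
    (hn : ¬ M.Nice u) : ∃ C : Set V, M.cut C = 3 ∧ 2 ≤ C.ncard ∧ 2 ≤ Cᶜ.ncard := by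
  classical
  by_contra hno
  push Not at hno
  have hsing : ∀ C : Set V, M.cut C = 3 → 2 ≤ Cᶜ.ncard → ∃ z, C = {z} := by
    intro C hC h2
    rw [← Set.ncard_eq_one]
    have h1 := hc.cut_parity C
    have h3 := hno C hC
    omega
  by_cases hu : ∀ v, M.m u v ≤ 1
  · obtain ⟨B, ι, _, C, huB, hNB, hC, hU, hcut, heB, hBB⟩ := exists_barrier_of_not_nice hc he hu hn
    -- When all 3-edge cuts are trivial the components behind the barrier are single vertices, and
    -- `B` is one class of a bipartition.
    refine hb ⟨B, ?_⟩
    intro x _ y _ hxy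
    rw [e, wsum_eq_zero] at hBB
    have hkey : ∀ x y, M.m x y ≠ 0 → x ∉ B → y ∈ B := by
      intro x y hxy hx
      by_cases hxu : x = u
      · subst hxu; exact hNB y hxy
      have hx' : x ∈ ⋃ i, C i := by rw [hU]; simp [hx, hxu]
      obtain ⟨i, hi⟩ := Set.mem_iUnion.1 hx'
      have hiC : C i ⊆ (insert u B)ᶜ := by rw [← hU]; exact Set.subset_iUnion _ _
      have hBne : B.Nonempty := by
        by_contra hne
        rw [Set.not_nonempty_iff_eq_empty] at hne
        have := heB i
        simp [e, hne] at this
      obtain ⟨b, hbB⟩ := hBne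
      obtain ⟨z, hz⟩ := hsing (C i) (hcut i) (by
        have hsub : ({u, b} : Set V) ⊆ (C i)ᶜ := by
          rintro w (rfl | rfl) hw
          · exact hiC hw (by simp)
          · exact hiC hw (Or.inr hbB)
        have h2 := Set.ncard_le_ncard hsub
        rwa [Set.ncard_pair (by rintro rfl; exact huB hbB)] at h2)
      rw [hz] at hi
      have h4 := heB i
      have h5 := hcut i
      rw [hz, hc.cut_singleton] at h5
      have h6 := wsum_add_compl (w := M.m) {x} B
      rw [hz, ← (Set.mem_singleton_iff.1 hi)] at h4
      rw [wsum_singleton_univ, hc x] at h6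
      have h7 : wsum M.m {x} Bᶜ = 0 := by rw [e] at h4; omega
      by_contra hy
      rw [wsum_eq_zero] at h7
      exact hxy (h7 x rfl y hy)
    constructor
    · intro hx hy
      exact hxy (hBB x hx y hy)
    · intro hy
      by_contra hx
      exact hy (hkey x y hxy hx)
  -- Here `u` has a multiple edge to `v`. If there are other vertices the edge is double; with the
  -- third neighbour `w` of `u`, the set `{w, u, v}` has a 3-edge cut, so just one vertex `z` lies
  -- outside and `{v, w}`, `{u, z}` is a bipartition.
  · push Not at hu
    obtain ⟨v, hv⟩ := hu
    have huv : u ≠ v := by rintro rfl; simp [M.loopless] at hv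
    have hpair : ∀ a b : V, a ≠ b → M.e {a, b} {a, b} = 2 * M.m a b := by
      intro a b hab
      rw [e, wsum_insert_left (by simpa using hab), wsum_insert_right (by simpa using hab),
        wsum_insert_right (by simpa using hab)]
      simp only [wsum_singleton, M.loopless, M.symm b a]; omega
    have h1 := hc.e_add_cut {u, v}
    rw [hpair u v huv, Set.ncard_pair huv] at h1
    by_cases hall : ({u, v} : Set V)ᶜ.Nonempty
    · have h2 := he _ (by simp) hall
      have hm2 : M.m u v = 2 := by omega
      have hex : ∃ w, w ≠ v ∧ M.m u w ≠ 0 := by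
        by_contra hno
        push Not at hno
        have := hc u
        rw [Finset.sum_eq_single v (fun b _ hb => hno b hb) (by simp)] at this
        omega
      obtain ⟨w, hwv, huw⟩ := hex
      have hwu : w ≠ u := by rintro rfl; exact huw (M.loopless _)
      have huw1 : M.m u w = 1 := by
        have := hc u
        have h4 : ∑ y ∈ {v, w}, M.m u y ≤ ∑ y, M.m u y :=
          Finset.sum_le_sum_of_subset (Finset.subset_univ _)
        rw [Finset.sum_pair hwv.symm] at h4
        omega
      have h5 := hc.e_add_cut {w, u, v}
      have hw' : w ∉ ({u, v} : Set V) := by simp [hwu, hwv]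
      have h6 : M.e {w, u, v} {w, u, v} = 6 + 2 * M.m v w := by
        rw [e, wsum_insert_left hw', wsum_insert_right hw', wsum_insert_right hw',
          wsum_comm M.symm {u, v} {w}, wsum_insert_right (by simpa using huv)]
        have := hpair u v huv
        rw [e] at this
        rw [this]
        simp only [wsum_singleton, M.loopless, M.symm w u, M.symm w v]; omega
      rw [h6, Set.ncard_insert_of_notMem hw', Set.ncard_pair huv] at h5
      have h7 : ({w, u, v} : Set V)ᶜ.Nonempty := by
        by_contra hne
        rw [Set.not_nonempty_iff_eq_empty] at hne
        rw [cut, hne, wsum_empty_right] at h5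
        omega
      have h8 := he _ (by simp) h7
      have hvw : M.m v w = 0 := by omega
      have h9 : M.cut {w, u, v} = 3 := by omega
      rw [← M.cut_compl] at h9
      obtain ⟨z, hz⟩ := hsing _ h9 (by
        rw [compl_compl, Set.ncard_insert_of_notMem hw', Set.ncard_pair huv]; omega)
      have hz4 : ∀ a, a ≠ w → a ≠ u → a ≠ v → a = z := by
        intro a h1 h2 h3
        have : a ∈ ({w, u, v} : Set V)ᶜ := by simp [h1, h2, h3]
        rw [hz] at this; exact this
      have huz : M.m u z = 0 := by
        have hzw : z ∉ ({w, u, v} : Set V) := by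
          have : z ∈ ({w, u, v} : Set V)ᶜ := by rw [hz]; rfl
          exact this
        simp at hzw
        have := hc u
        have h4 : ∑ y ∈ {v, w, z}, M.m u y ≤ ∑ y, M.m u y :=
          Finset.sum_le_sum_of_subset (Finset.subset_univ _)
        rw [Finset.sum_insert (by simp [hwv.symm, Ne.symm hzw.2.2]), Finset.sum_pair (Ne.symm hzw.1)] at h4
        omega
      refine hb ⟨{v, w}, ?_⟩
      intro x _ y _ hxy
      have hB : ∀ x ∈ ({v, w} : Set V), ∀ y ∈ ({v, w} : Set V), M.m x y = 0 := by
        rintro x (rfl | rfl) y (rfl | rfl)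
        · exact M.loopless _
        · exact hvw
        · rw [M.symm]; exact hvw
        · exact M.loopless _
      have hA : ∀ x ∉ ({v, w} : Set V), ∀ y ∉ ({v, w} : Set V), M.m x y = 0 := by
        have : ∀ x ∉ ({v, w} : Set V), x = u ∨ x = z := by
          intro x hx
          simp at hx
          by_cases h : x = u
          · exact Or.inl h
          · exact Or.inr (hz4 x hx.2 h hx.1)
        intro x hx y hy
        rcases this x hx with rfl | rfl <;> rcases this y hy with rfl | rfl
        · exact M.loopless _
        · exact huz
        · rw [M.symm]; exact huz
        · exact M.loopless _
      constructor
      · intro hx hy; exact hxy (hB x hx y hy)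
      · intro hy; by_contra hx; exact hxy (hA x hx y hy)
    · rw [Set.not_nonempty_iff_eq_empty] at hall
      have hall' : ∀ a, a = u ∨ a = v := by
        intro a
        by_contra h
        have : a ∈ ({u, v} : Set V)ᶜ := by simpa using h
        simp [hall] at this
      refine hb ⟨{u}, ?_⟩
      intro x _ y _ hxy
      rcases hall' x with rfl | rfl <;> rcases hall' y with rfl | rfl
      · exact absurd (M.loopless _) hxy
      · simp [huv.symm]
      · simp [huv.symm]
      · exact absurd (M.loopless _) hxy

end MG
end NiceCubic

/-! ### Contractions of 3-edge cuts and gluing of factors. -/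

namespace NiceCubic
namespace MG
variable {V : Type u} [Fintype V] {M : MG V}

open scoped Classical in
/-- The quotient of a multigraph by a map: fibres are contracted to vertices. -/
noncomputable def quot {P : Type v} (M : MG V) (f : V → P) : MG P where
  m p q := if p = q then 0 else M.e (f ⁻¹' {p}) (f ⁻¹' {q})
  symm p q := by
    by_cases h : p = q
    · simp [h]
    · rw [if_neg h, if_neg (Ne.symm h), e_comm]
  loopless p := by simp

noncomputable instance fintypeOptionCoe (C : Set V) : Fintype (Option C) := Fintype.ofFinite _

lemma quot_m {P : Type v} (f : V → P) {p q : P} (h : p ≠ q) :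
    (M.quot f).m p q = M.e (f ⁻¹' {p}) (f ⁻¹' {q}) := if_neg h

lemma quot_e {P : Type v} [Fintype P] (f : V → P) {Y Z : Set P} (h : Disjoint Y Z) :
    (M.quot f).e Y Z = M.e (f ⁻¹' Y) (f ⁻¹' Z) := by
  classical
  have h1 : ∀ p q : P, (if p ∈ Y ∧ q ∈ Z then (M.quot f).m p q else 0) =
      ∑ x, ∑ y, if (p ∈ Y ∧ q ∈ Z) ∧ f x = p ∧ f y = q then M.m x y else 0 := by
    intro p q
    split_ifs with hpq
    · rw [quot_m f (by rintro rfl; exact Set.disjoint_left.1 h hpq.1 hpq.2)]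
      refine Finset.sum_congr rfl fun x _ => Finset.sum_congr rfl fun y _ => ?_
      split_ifs <;> simp_all
    · symm
      exact Finset.sum_eq_zero fun x _ => Finset.sum_eq_zero fun y _ => if_neg fun h => hpq h.1
  have h0 : (M.quot f).e Y Z = ∑ p, ∑ q, if p ∈ Y ∧ q ∈ Z then (M.quot f).m p q else 0 := by
    refine Finset.sum_congr rfl fun x _ => Finset.sum_congr rfl fun y _ => ?_
    split_ifs <;> rfl
  rw [h0]
  simp_rw [h1]
  have h2 : ∀ p : P, (∑ q, ∑ x, ∑ y, if (p ∈ Y ∧ q ∈ Z) ∧ f x = p ∧ f y = q then M.m x y else 0) =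
      ∑ x, ∑ y, if f y ∈ Z ∧ p ∈ Y ∧ f x = p then M.m x y else 0 := by
    intro p
    rw [Finset.sum_comm]
    refine Finset.sum_congr rfl fun x _ => ?_
    rw [Finset.sum_comm]
    refine Finset.sum_congr rfl fun y _ => ?_
    rw [Finset.sum_eq_single (f y)]
    · split_ifs <;> simp_all
    · intro b _ hb
      exact if_neg fun h => hb h.2.2.symm
    · simp
  rw [Finset.sum_congr rfl fun p _ => h2 p, Finset.sum_comm]
  refine Finset.sum_congr rfl fun x _ => ?_
  rw [Finset.sum_comm]
  refine Finset.sum_congr rfl fun y _ => ?_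
  rw [Finset.sum_eq_single (f x)]
  · simp only [Set.mem_preimage]
    split_ifs <;> simp_all
  · intro b _ hb
    exact if_neg fun h => hb h.2.2.symm
  · simp

lemma quot_cut {P : Type v} [Fintype P] (f : V → P) (Y : Set P) :
    (M.quot f).cut Y = M.cut (f ⁻¹' Y) := by
  have := quot_e (M := M) f (disjoint_compl_right (a := Y))
  rwa [Set.preimage_compl] at this

lemma quot_cubic {P : Type v} [Fintype P] (f : V → P) (h : ∀ p, M.cut (f ⁻¹' {p}) = 3) :
    (M.quot f).Cubic := by
  intro p
  rw [← wsum_singleton_univ, ← wsum_add_compl {p} {p}, wsum_singleton, (M.quot f).loopless, zero_add]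
  exact (quot_cut f {p}).trans (h p)

lemma quot_EC {P : Type v} [Fintype P] {f : V → P} (hf : Function.Surjective f) {k : ℕ}
    (h : M.EC k) : (M.quot f).EC k := by
  intro Y h1 h2
  rw [quot_cut]
  exact h _ (h1.preimage hf) (by rw [← Set.preimage_compl]; exact h2.preimage hf)

open scoped Classical in
/-- The projection which contracts the complement of `C`. -/
noncomputable def pr (C : Set V) (v : V) : Option C := if h : v ∈ C then some ⟨v, h⟩ else none

lemma pr_of_mem {C : Set V} {v : V} (h : v ∈ C) : pr C v = some ⟨v, h⟩ := dif_pos h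
lemma pr_of_notMem {C : Set V} {v : V} (h : v ∉ C) : pr C v = none := dif_neg h
@[simp] lemma pr_coe {C : Set V} (v : C) : pr C (v : V) = some v := pr_of_mem v.2
lemma pr_eq_none {C : Set V} {v : V} : pr C v = none ↔ v ∉ C := by
  by_cases h : v ∈ C
  · simp [pr_of_mem h, h]
  · simp [pr_of_notMem h, h]

lemma pr_preimage_none (C : Set V) : pr C ⁻¹' {none} = Cᶜ := by
  ext v; simp [pr_eq_none]

lemma pr_preimage_some {C : Set V} (a : C) : pr C ⁻¹' {some a} = {(a : V)} := by
  ext v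
  simp only [Set.mem_preimage, Set.mem_singleton_iff]
  by_cases h : v ∈ C
  · simp [pr_of_mem h, Subtype.ext_iff]
  · rw [pr_of_notMem h]
    simp only [reduceCtorEq, false_iff]
    rintro rfl; exact h a.2

lemma pr_surjective {C : Set V} (h : Cᶜ.Nonempty) : Function.Surjective (pr C) := by
  rintro (_ | a)
  · obtain ⟨v, hv⟩ := h
    exact ⟨v, pr_of_notMem hv⟩
  · exact ⟨a, pr_coe a⟩

/-- The contraction of the complement of `C`. -/
noncomputable abbrev contract (M : MG V) (C : Set V) : MG (Option C) := M.quot (pr C)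

lemma contract_m {C : Set V} {x y : V} (hx : x ∈ C) (hy : y ∈ C) :
    (M.contract C).m (pr C x) (pr C y) = M.m x y := by
  by_cases h : x = y
  · subst h; rw [MG.loopless, MG.loopless]
  · rw [pr_of_mem hx, pr_of_mem hy, quot_m _ (by simpa using h), pr_preimage_some, pr_preimage_some]
    simp

lemma contract_none {C : Set V} {x : V} (hx : x ∈ C) :
    (M.contract C).m (pr C x) none = M.e {x} Cᶜ := by
  rw [pr_of_mem hx, quot_m _ (by simp), pr_preimage_some, pr_preimage_none]

lemma contract_none_left {C : Set V} {x : V} (hx : x ∈ C) :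
    (M.contract C).m none (pr C x) = M.e {x} Cᶜ := by
  rw [MG.symm, contract_none hx]

lemma contract_ne_zero {C : Set V} {x y : V} (hx : x ∈ C) (hy : y ∉ C) (h : M.m x y ≠ 0) :
    (M.contract C).m (pr C x) none ≠ 0 := by
  rw [contract_none hx, ← Nat.pos_iff_ne_zero, wsum_pos]
  exact ⟨x, rfl, y, hy, Nat.pos_of_ne_zero h⟩

lemma contract_cubic (hc : M.Cubic) {C : Set V} (hC : M.cut C = 3) : (M.contract C).Cubic := by
  refine quot_cubic _ ?_
  rintro (_ | a)
  · rw [pr_preimage_none, cut_compl, hC]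
  · rw [pr_preimage_some, hc.cut_singleton]

lemma contract_EC {k : ℕ} (he : M.EC k) {C : Set V} (hC : Cᶜ.Nonempty) : (M.contract C).EC k :=
  quot_EC (pr_surjective hC) he

lemma card_option_coe (C : Set V) : Fintype.card (Option C) = C.ncard + 1 := by
  rw [← Nat.card_eq_fintype_card, Finite.card_option, Nat.card_coe_set_eq]

lemma card_contract_lt {C : Set V} (h : 2 ≤ Cᶜ.ncard) :
    Fintype.card (Option C) < Fintype.card V := by
  have := Set.ncard_add_ncard_compl C
  rw [card_option_coe, ← Nat.card_eq_fintype_card]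
  omega

lemma sum_option_pr {C : Set V} [DecidablePred (· ∈ C)] (g : Option C → ℕ) :
    ∑ p, g p = (∑ y, if y ∈ C then g (pr C y) else 0) + g none := by
  have h1 : ∑ p, g p = g none + ∑ a : C, g (some a) := by
    rw [← Fintype.sum_option]
    refine Finset.sum_congr ?_ fun _ _ => rfl
    ext; simp
  rw [h1, add_comm, ← Finset.sum_filter,
    Finset.sum_subtype (Finset.univ.filter (· ∈ C)) (p := (· ∈ C)) (by simp)]
  congr 1
  exact Finset.sum_congr rfl fun a _ => by rw [pr_coe]

lemma IsFactor.eq_m {δ : V → ℕ} {F : V → V → ℕ} (h : M.IsFactor δ F) (hc : M.Cubic) {p : V}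
    (hp : δ p = 3) (q : V) : F p q = M.m p q :=
  (Finset.sum_eq_sum_iff_of_le fun i _ => h.le p i).1 ((h.deg p).trans (hp.trans (hc p).symm)) q
    (Finset.mem_univ q)

open scoped Classical in
lemma IsFactor.eq_ite {δ : V → ℕ} {F : V → V → ℕ} (h : M.IsFactor δ F) {p a : V}
    (hp : δ p = 1) (ha : F p a ≠ 0) (q : V) : F p q = if q = a then 1 else 0 := by
  have h1 := h.deg p
  rw [hp, ← Finset.add_sum_erase _ _ (Finset.mem_univ a)] at h1
  split_ifs with hq
  · subst hq; omega
  · have : F p q ≤ ∑ x ∈ Finset.univ.erase a, F p x :=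
      Finset.single_le_sum (f := F p) (fun _ _ => Nat.zero_le _) (by simp [hq])
    omega

open scoped Classical in
/-- Factors of the two contractions which agree on the cut are glued to a factor. -/
lemma IsFactor.glue {C : Set V} {δ₁ : Option C → ℕ} {δ₂ : Option (Cᶜ : Set V) → ℕ}
    {F₁ : Option C → Option C → ℕ} {F₂ : Option (Cᶜ : Set V) → Option (Cᶜ : Set V) → ℕ}
    (h₁ : (M.contract C).IsFactor δ₁ F₁) (h₂ : (M.contract Cᶜ).IsFactor δ₂ F₂)
    {φ : V → V → ℕ} (hφ : ∀ x ∈ C, ∀ y ∉ C, φ x y ≤ M.m x y)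
    (hφ₁ : ∀ x ∈ C, (∑ y, if y ∈ C then 0 else φ x y) = F₁ (pr C x) none)
    (hφ₂ : ∀ y ∉ C, (∑ x, if x ∈ C then φ x y else 0) = F₂ (pr Cᶜ y) none) :
    ∃ F, M.IsFactor (fun v => if v ∈ C then δ₁ (pr C v) else δ₂ (pr Cᶜ v)) F := by
  refine ⟨fun x y => if x ∈ C then (if y ∈ C then F₁ (pr C x) (pr C y) else φ x y) else
    (if y ∈ C then φ y x else F₂ (pr Cᶜ x) (pr Cᶜ y)), ?_, ?_, ?_⟩
  · intro x y
    by_cases hx : x ∈ C <;> by_cases hy : y ∈ C <;> simp only [hx, hy, if_true, if_false]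
    · exact h₁.symm _ _
    · exact h₂.symm _ _
  · intro x y
    by_cases hx : x ∈ C <;> by_cases hy : y ∈ C <;> simp only [hx, hy, if_true, if_false]
    · exact (h₁.le _ _).trans (contract_m hx hy).le
    · exact hφ x hx y hy
    · rw [M.symm]; exact hφ y hy x hx
    · exact (h₂.le _ _).trans (contract_m (C := Cᶜ) hx hy).le
  · intro x
    by_cases hx : x ∈ C <;> simp only [hx, if_true, if_false]
    · rw [← h₁.deg, sum_option_pr, ← hφ₁ x hx, ← Finset.sum_add_distrib]
      refine Finset.sum_congr rfl fun y _ => ?_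
      split_ifs <;> simp
    · rw [← h₂.deg, sum_option_pr, ← hφ₂ x hx, ← Finset.sum_add_distrib]
      refine Finset.sum_congr rfl fun y _ => ?_
      by_cases hy : y ∈ C <;> simp [hy]

/-- `u` and `v` can simultaneously have degree `3` in a factor with degree `1` elsewhere. -/
def TwoNice (M : MG V) (u v : V) : Prop :=
  ∃ (δ : V → ℕ) (F : V → V → ℕ), M.IsFactor δ F ∧ δ u = 3 ∧ δ v = 3 ∧ ∀ x, x ≠ u → x ≠ v → δ x = 1

lemma IsFactor.congr {δ δ' : V → ℕ} {F : V → V → ℕ} (h : M.IsFactor δ F) (hδ : ∀ x, δ x = δ' x) :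
    M.IsFactor δ' F := by
  obtain rfl : δ = δ' := funext hδ
  exact h

/-- Nice vertices of a contraction are nice. -/
lemma Nice.of_contract (hc : M.Cubic) (he : M.EC 2) {C : Set V} (hC : M.cut C = 3) (hne : C.Nonempty)
    {u : V} (hu : u ∈ C) (h : (M.contract C).Nice (pr C u)) : M.Nice u := by
  classical
  obtain ⟨F₁, hF₁⟩ := h
  have hnu : none ≠ pr C u := fun h => pr_eq_none.1 h.symm hu
  have hdeg := hF₁.deg none
  simp only [hnu, if_false] at hdeg
  obtain ⟨p, hp⟩ : ∃ p, F₁ none p ≠ 0 := by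
    by_contra hno
    push Not at hno
    simp [hno] at hdeg
  have hp0 : (M.contract C).m none p ≠ 0 := by
    have := hF₁.le none p; omega
  obtain ⟨a, rfl⟩ : ∃ a, p = some a := by
    rcases p with _ | a
    · exact absurd (MG.loopless _ _) hp0
    · exact ⟨a, rfl⟩
  rw [← pr_coe, contract_none_left a.2, ← Nat.pos_iff_ne_zero, wsum_pos] at hp0
  obtain ⟨_, rfl, w, hw, haw⟩ := hp0
  have hC2 : M.cut Cᶜ = 3 := by rw [cut_compl, hC]
  -- The factor on the side of `C` uses exactly one edge at the contraction vertex; `aw` is an edge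
  -- of `M` that realises it. On the other side a perfect matching through the same edge is chosen,
  -- so that the two can be glued.
  obtain ⟨F₂, hF₂, hone⟩ := exists_factor_one (contract_cubic hc hC2)
    (contract_EC he (C := Cᶜ) (by rwa [compl_compl])) (x := pr Cᶜ w) (y := none)
    (contract_ne_zero hw (y := a) (by simp) (by rw [M.symm]; omega))
  have h1 : ∀ q, F₁ none q = _ := hF₁.eq_ite (by simp [hnu]) hp
  have h2 : ∀ q, F₂ none q = _ := hF₂.eq_ite rfl (a := pr Cᶜ w) (by rw [hF₂.symm, hone]; simp)
  refine Exists.elim (hF₁.glue hF₂ (φ := fun x y => if x = a ∧ y = w then 1 else 0) ?_ ?_ ?_) ?_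
  rotate_right
  · intro F hF
    refine ⟨F, hF.congr fun x => ?_⟩
    by_cases hx : x ∈ C
    · simp [hx, pr_of_mem hx, pr_of_mem hu]
    · have : x ≠ u := by rintro rfl; exact hx hu
      simp [hx, this]
  · intro x _ y _
    split_ifs with h
    · rw [h.1, h.2]; exact haw
    · exact Nat.zero_le _
  · intro x hx
    rw [hF₁.symm, h1, pr_of_mem hx]
    rw [Finset.sum_eq_single w]
    · rw [if_neg hw]
      simp [Subtype.ext_iff]
    · intro b _ hb; simp [hb]
    · simp
  · intro y hy
    rw [hF₂.symm, h2, pr_of_mem (C := Cᶜ) hy, pr_of_mem hw]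
    rw [Finset.sum_eq_single (a : V)]
    · rw [if_pos a.2]
      simp
    · intro b _ hb; simp [hb]
    · simp

/-- Both factors have degree 3 at the contraction vertex, hence contain all three cut edges, and
they agree there automatically. -/
lemma Nice.of_twoNice (hc : M.Cubic) {C : Set V} (hC : M.cut C = 3)
    {u : V} (hu : u ∉ C) (h1 : (M.contract C).Nice none)
    (h2 : (M.contract Cᶜ).TwoNice none (pr Cᶜ u)) : M.Nice u := by
  classical
  obtain ⟨F₁, hF₁⟩ := h1
  obtain ⟨δ, F₂, hF₂, hd1, hd2, hd3⟩ := h2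
  have hC2 : M.cut Cᶜ = 3 := by rw [cut_compl, hC]
  refine Exists.elim (hF₁.glue hF₂ (φ := M.m) (fun _ _ _ _ => le_rfl) ?_ ?_) ?_
  rotate_right
  · intro F hF
    refine ⟨F, hF.congr fun x => ?_⟩
    by_cases hx : x ∈ C
    · have : x ≠ u := by rintro rfl; exact hu hx
      simp [hx, pr_of_mem hx, this]
    · by_cases hxu : x = u
      · subst hxu; simp [hx, hd2]
      · simp only [hx, hxu, if_false]
        refine hd3 _ ?_ ?_
        · rw [Ne, pr_eq_none]; simpa using hx
        · rw [pr_of_mem (C := Cᶜ) hx, pr_of_mem (C := Cᶜ) hu]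
          simpa using hxu
  · intro x hx
    rw [hF₁.symm, hF₁.eq_m (contract_cubic hc hC) (by simp), contract_none_left hx, e,
      wsum_singleton_left]
    refine Finset.sum_congr rfl fun y _ => ?_
    by_cases hy : y ∈ C <;> simp [hy]
  · intro y hy
    rw [hF₂.symm, hF₂.eq_m (contract_cubic hc hC2) hd1, contract_none_left (C := Cᶜ) hy, e,
      wsum_singleton_left]
    refine Finset.sum_congr rfl fun x _ => ?_
    by_cases hx : x ∈ C <;> simp [hx, M.symm x y]

/-- Colour classes are pulled back along a contraction of a set with bipartite quotient. -/
lemma exists_pull_colour {C : Set V} (hH : (M.contract Cᶜ).Bip) (A : Set (Option C)) :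
    ∃ A' : Set V, (∀ v ∈ C, v ∈ A' ↔ pr C v ∈ A) ∧
      (∀ x ∉ C, ∀ y ∉ C, M.m x y ≠ 0 → (x ∈ A' ↔ y ∉ A')) ∧
      (∀ x ∉ C, ∀ y ∈ C, M.m x y ≠ 0 → (x ∈ A' ↔ none ∈ A)) := by
  obtain ⟨A₂, hA₂⟩ := hH
  -- The colours on the bipartite side are exchanged if necessary, so that the outer ends of the cut
  -- edges receive the colour that `none` has in `A`.
  refine ⟨{v | (v ∈ C ∧ pr C v ∈ A) ∨
    (v ∉ C ∧ (pr Cᶜ v ∈ A₂ ↔ (none ∉ A₂ ↔ none ∈ A)))}, ?_, ?_, ?_⟩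
  · intro v hv; simp [hv]
  · intro x hx y hy hxy
    have := hA₂ (pr Cᶜ x) trivial (pr Cᶜ y) trivial (by rwa [contract_m (C := Cᶜ) hx hy])
    simp only [Set.mem_ofPred_eq, hx, hy, false_and, false_or, not_false_eq_true, true_and]
    tauto
  · intro x hx y hy hxy
    have := hA₂ (pr Cᶜ x) trivial none trivial (contract_ne_zero (C := Cᶜ) hx (by simpa using hy) hxy)
    simp only [Set.mem_ofPred_eq, hx, false_and, false_or, not_false_eq_true, true_and]
    tauto

lemma ColOn.pull {C : Set V} {X A : Set (Option C)} (h : (M.contract C).ColOn X A) {A' : Set V}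
    (h1 : ∀ v ∈ C, v ∈ A' ↔ pr C v ∈ A)
    (h2 : ∀ x ∉ C, ∀ y ∉ C, M.m x y ≠ 0 → (x ∈ A' ↔ y ∉ A'))
    (h3 : ∀ x ∉ C, ∀ y ∈ C, M.m x y ≠ 0 → (x ∈ A' ↔ none ∈ A)) : M.ColOn (pr C ⁻¹' X) A' := by
  intro x hx y hy hxy
  by_cases hxC : x ∈ C <;> by_cases hyC : y ∈ C
  · rw [h1 x hxC, h1 y hyC]
    exact h _ hx _ hy (by rwa [contract_m hxC hyC])
  · have h4 := h3 y hyC x hxC (by rwa [M.symm])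
    have h5 : pr C y ∈ X := hy
    rw [pr_of_notMem hyC] at h5
    have h6 := h _ hx _ h5 (contract_ne_zero hxC hyC hxy)
    rw [h1 x hxC, h4]; exact h6
  · have h4 := h3 x hxC y hyC hxy
    have h5 : pr C x ∈ X := hx
    rw [pr_of_notMem hxC] at h5
    have h6 := h _ hy _ h5 (contract_ne_zero hyC hxC (by rwa [M.symm]))
    rw [h1 y hyC, h4]; tauto
  · exact h2 x hxC y hyC hxy

lemma Bip.of_contract {C : Set V} (hK : (M.contract C).Bip) (hH : (M.contract Cᶜ).Bip) : M.Bip := by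
  obtain ⟨A, hA⟩ := hK
  obtain ⟨A', h1, h2, h3⟩ := exists_pull_colour hH A
  exact ⟨A', by simpa using hA.pull h1 h2 h3⟩

/-- If the hidden set contains the contraction vertex, its preimage contains all of `Cᶜ`; it stays
bipartite because the other contraction is. -/
lemma Hidden.of_contract {C : Set V} (hH : (M.contract Cᶜ).Bip) {v : V}
    (hv : (M.contract C).Hidden (pr C v)) : M.Hidden v := by
  obtain ⟨X, A, hvX, hcut, hcol⟩ := hv
  obtain ⟨A', h1, h2, h3⟩ := exists_pull_colour hH A
  exact ⟨pr C ⁻¹' X, A', hvX, by rw [← quot_cut, hcut], hcol.pull h1 h2 h3⟩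

/-- Coloured sets which avoid the contracted vertex are coloured in the multigraph. -/
lemma ColOn.of_contract {C : Set V} {X A : Set (Option C)} (h : (M.contract C).ColOn X A)
    (hX : none ∉ X) : M.ColOn (pr C ⁻¹' X) (pr C ⁻¹' A) := by
  have hC : ∀ x, pr C x ∈ X → x ∈ C := by
    intro x hx
    by_contra hxC
    rw [pr_of_notMem hxC] at hx
    exact hX hx
  intro x hx y hy hxy
  exact h _ hx _ hy (by rwa [contract_m (hC x hx) (hC y hy)])

end MG
end NiceCubic

/-! ### Augmenting paths in bipartite multigraphs and uncrossing of bad sets. -/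

namespace NiceCubic
namespace MG
variable {V : Type u} [Fintype V] {M : MG V}

/-- One more unit of flow can be pushed from `x` to `y`. -/
def Residual (M : MG V) (A : Set V) (F : V → V → ℕ) (x y : V) : Prop :=
  (x ∈ A ∧ F x y < M.m x y) ∨ (x ∉ A ∧ 0 < F x y)

/-- The residual relation outside the set `T`. -/
def ResidualOff (M : MG V) (A : Set V) (F : V → V → ℕ) (T : Set V) (x y : V) : Prop :=
  M.Residual A F x y ∧ x ∉ T ∧ y ∉ T

lemma exists_first_step {A : Set V} {F : V → V → ℕ} {T : Set V} {x b : V}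
    (hxb : x ≠ b) (h : Relation.ReflTransGen (M.ResidualOff A F T) x b) :
    ∃ y, M.ResidualOff A F T x y ∧ y ≠ x ∧
      Relation.ReflTransGen (M.ResidualOff A F (insert x T)) y b := by
  suffices H : ∀ z, Relation.ReflTransGen (M.ResidualOff A F T) z b →
      (z ≠ x ∧ Relation.ReflTransGen (M.ResidualOff A F (insert x T)) z b) ∨
      ∃ y, M.ResidualOff A F T x y ∧ y ≠ x ∧
        Relation.ReflTransGen (M.ResidualOff A F (insert x T)) y b by
    rcases H x h with h1 | h1
    · exact absurd rfl h1.1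
    · exact h1
  intro z hz
  induction hz using Relation.ReflTransGen.head_induction_on with
  | refl => exact Or.inl ⟨hxb.symm, .refl⟩
  | @head z w hzw _ ih =>
    rcases ih with ⟨hwx, hw⟩ | h
    · by_cases hzx : z = x
      · subst hzx
        exact Or.inr ⟨w, hzw, hwx, hw⟩
      · refine Or.inl ⟨hzx, .head ⟨hzw.1, ?_, ?_⟩ hw⟩
        · simp [hzx, hzw.2.1]
        · simp [hwx, hzw.2.2]
    · exact Or.inr h

lemma sum_pair_indicator [DecidableEq V] {x y : V} (hxy : x ≠ y) (u : V) :
    (∑ v, if (u = x ∧ v = y) ∨ (u = y ∧ v = x) then 1 else 0) =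
      (if u = x then 1 else 0) + (if u = y then 1 else 0) := by
  by_cases h1 : u = x
  · rw [h1]; simp [hxy]
  · by_cases h2 : u = y
    · rw [h2]; simp [hxy.symm]
    · simp [h1, h2]

open scoped Classical in
/-- Pushing a unit of flow along a residual path. -/
lemma exists_augment_aux {A : Set V} (hA : M.ColOn Set.univ A) {b : V} (hb : b ∉ A) (n : ℕ) :
    ∀ (T : Set V) (x : V) (δ : V → ℕ) (F : V → V → ℕ), Tᶜ.ncard = n → x ∉ T → M.IsFactor δ F →
      Relation.ReflTransGen (M.ResidualOff A F T) x b →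
      ∃ δ' F', M.IsFactor δ' F' ∧ ∀ y, δ' y + (if y = x ∧ x ∉ A then 1 else 0) =
        δ y + (if y = x ∧ x ∈ A then 1 else 0) + (if y = b then 1 else 0) := by
  -- `T` consists of vertices which the rest of the path avoids, and the induction is on the number
  -- of vertices outside `T`. A path starting in `A` raises the degree at `x`, one starting outside
  -- `A` lowers it; the latter change stands on the left of the equation to avoid truncated
  -- subtraction.
  induction n with
  | zero =>
    intro T x _ _ hT hx
    rw [Set.ncard_eq_zero] at hT
    exact absurd hx (by rw [← Set.mem_compl_iff, hT]; simp)
  | succ n ih =>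
    intro T x δ F hT hx hF hr
    by_cases hxb : x = b
    · subst hxb
      exact ⟨δ, F, hF, fun y => by simp [hb]⟩
    obtain ⟨y, ⟨hres, _, hyT⟩, hyx, hy⟩ := exists_first_step hxb hr
    have hT' : (insert x T)ᶜ.ncard = n := by
      have h1 := Set.ncard_add_ncard_compl T
      have h2 := Set.ncard_add_ncard_compl (insert x T)
      rw [Set.ncard_insert_of_notMem hx] at h2
      omega
    have hyT' : y ∉ insert x T := by simp [hyx, hyT]
    have hmxy : M.m x y ≠ 0 := by
      rcases hres with h | h
      · omega
      · have := hF.le x y; omega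
    have hxyA := hA x trivial y trivial hmxy
    rcases hres with ⟨hxA, hlt⟩ | ⟨hxA, hpos⟩
    · have hyA : y ∉ A := hxyA.1 hxA
      set F₁ : V → V → ℕ := fun u v => F u v + if (u = x ∧ v = y) ∨ (u = y ∧ v = x) then 1 else 0
        with hF₁
      have hfac : M.IsFactor (fun u => δ u + ((if u = x then 1 else 0) + if u = y then 1 else 0)) F₁ := by
        refine ⟨?_, ?_, ?_⟩
        · intro u v
          have : ((u = x ∧ v = y) ∨ (u = y ∧ v = x)) ↔ ((v = x ∧ u = y) ∨ (v = y ∧ u = x)) := by tauto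
          simp only [hF₁, hF.symm u v, this]
        · intro u v
          simp only [hF₁]
          split_ifs with h
          · rcases h with ⟨rfl, rfl⟩ | ⟨rfl, rfl⟩
            · exact hlt
            · rw [hF.symm, M.symm]; exact hlt
          · exact hF.le u v
        · intro u
          simp only [hF₁, Finset.sum_add_distrib, hF.deg, sum_pair_indicator hyx.symm]
      -- The push along `xy` changes only entries involving `x`, and the remaining path avoids `x`.
      have hmono : ∀ {z}, Relation.ReflTransGen (M.ResidualOff A F (insert x T)) z b →
          Relation.ReflTransGen (M.ResidualOff A F₁ (insert x T)) z b := by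
        intro z hz
        refine Relation.ReflTransGen.mono (p := M.ResidualOff A F₁ (insert x T)) ?_ _ _ hz
        rintro u v ⟨h, hu, hv⟩
        refine ⟨?_, hu, hv⟩
        have hux : u ≠ x := by rintro rfl; exact hu (by simp)
        have hvx : v ≠ x := by rintro rfl; exact hv (by simp)
        simpa [Residual, hF₁, hux, hvx] using h
      obtain ⟨δ', F', hF', hδ'⟩ := ih _ y _ F₁ hT' hyT' hfac (hmono hy)
      · refine ⟨δ', F', hF', fun z => ?_⟩
        have := hδ' z
        simp only [hyA, hxA, not_true_eq_false, and_false, and_true, not_false_eq_true, if_false] at this ⊢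
        omega
    · have hyA : y ∈ A := by by_contra h; exact hxA (hxyA.2 h)
      set F₁ : V → V → ℕ := fun u v => F u v - if (u = x ∧ v = y) ∨ (u = y ∧ v = x) then 1 else 0
        with hF₁
      have hpos' : ∀ u v, (if (u = x ∧ v = y) ∨ (u = y ∧ v = x) then 1 else 0) ≤ F u v := by
        intro u v
        split_ifs with h
        · rcases h with ⟨rfl, rfl⟩ | ⟨rfl, rfl⟩
          · exact hpos
          · rw [hF.symm]; exact hpos
        · exact Nat.zero_le _
      have hfac : M.IsFactor (fun u => δ u - ((if u = x then 1 else 0) + if u = y then 1 else 0)) F₁ := by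
        refine ⟨?_, ?_, ?_⟩
        · intro u v
          have : ((u = x ∧ v = y) ∨ (u = y ∧ v = x)) ↔ ((v = x ∧ u = y) ∨ (v = y ∧ u = x)) := by tauto
          simp only [hF₁, hF.symm u v, this]
        · intro u v
          exact (Nat.sub_le _ _).trans (hF.le u v)
        · intro u
          simp only [hF₁]
          rw [Finset.sum_tsub_distrib _ fun v _ => hpos' u v, hF.deg, sum_pair_indicator hyx.symm]
      have hmono : ∀ {z}, Relation.ReflTransGen (M.ResidualOff A F (insert x T)) z b →
          Relation.ReflTransGen (M.ResidualOff A F₁ (insert x T)) z b := by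
        intro z hz
        refine Relation.ReflTransGen.mono (p := M.ResidualOff A F₁ (insert x T)) ?_ _ _ hz
        rintro u v ⟨h, hu, hv⟩
        refine ⟨?_, hu, hv⟩
        have hux : u ≠ x := by rintro rfl; exact hu (by simp)
        have hvx : v ≠ x := by rintro rfl; exact hv (by simp)
        simpa [Residual, hF₁, hux, hvx] using h
      obtain ⟨δ', F', hF', hδ'⟩ := ih _ y _ F₁ hT' hyT' hfac (hmono hy)
      · refine ⟨δ', F', hF', fun z => ?_⟩
        have := hδ' z
        have h2 : (if z = x then 1 else 0) + (if z = y then 1 else 0) ≤ δ z := by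
          rw [← sum_pair_indicator hyx.symm, ← hF.deg]
          exact Finset.sum_le_sum fun v _ => hpos' z v
        simp only [hyA, hxA, not_true_eq_false, and_false, and_true, not_false_eq_true, if_false] at this ⊢
        omega

lemma Cubic.card_colour (hc : M.Cubic) {A : Set V} (hA : M.ColOn Set.univ A) :
    A.ncard = Aᶜ.ncard := by
  have := hc.colOn_card hA
  simp only [Set.univ_inter, Set.compl_univ, wsum_empty_right, e, ← Set.compl_eq_univ_sdiff] at this
  omega

open scoped Classical in
/-- Either the degrees at `c` and `b` can be increased, or a tight set separates `b` from `c`. -/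
lemma exists_augment_or_tight (hc : M.Cubic) {A : Set V} (hA : M.ColOn Set.univ A) {b c : V} (hb : b ∉ A)
    (hcA : c ∈ A) {δ : V → ℕ} {F : V → V → ℕ} (hF : M.IsFactor δ F) {t : ℕ} (hδc : δ c = 1 + t)
    (hδ : ∀ y, y ≠ c → y ≠ b → δ y = 1) :
    (∃ δ' F', M.IsFactor δ' F' ∧
      ∀ y, δ' y = δ y + (if y = c then 1 else 0) + (if y = b then 1 else 0)) ∨
    ∃ X : Set V, b ∈ X ∧ c ∉ X ∧ M.e (X \ A) Xᶜ + (X ∩ A).ncard = (X \ A).ncard + t := by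
  by_cases hr : Relation.ReflTransGen (M.ResidualOff A F ∅) c b
  · left
    obtain ⟨δ', F', h1, h2⟩ := exists_augment_aux hA hb _ ∅ c δ F rfl (by simp) hF hr
    exact ⟨δ', F', h1, fun y => by simpa [hcA] using h2 y⟩
  · right
    -- As for maximal flows and minimal cuts: no residual step leaves the reachable set, so `F` uses
    -- every edge out of `Y ∩ A` and none out of `Y \ A`. The degree sums of `F` on `Y`, together
    -- with `|A| = |Aᶜ|`, give the equation for the complement.
    set Y : Set V := {v | Relation.ReflTransGen (M.ResidualOff A F ∅) c v} with hY
    have hcY : c ∈ Y := .refl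
    have hbY : b ∉ Y := hr
    refine ⟨Yᶜ, hbY, by simpa using hcY, ?_⟩
    have hstep : ∀ u ∈ Y, ∀ v ∉ Y, ¬ M.Residual A F u v := fun u hu v hv h =>
      hv (Relation.ReflTransGen.tail hu ⟨h, by simp, by simp⟩)
    have h1 := (hA.mono (Set.subset_univ Y)).wsum_left hF.le
    have h2 := (hA.mono (Set.subset_univ Y)).wsum_right hF.le hF.symm
    have h3 : wsum F (Y \ A) Yᶜ = 0 := by
      rw [wsum_eq_zero]
      intro x hx y hy
      by_contra h
      exact hstep x hx.1 y hy (Or.inr ⟨hx.2, Nat.pos_of_ne_zero h⟩)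
    have h4 : wsum F (Y ∩ A) Yᶜ = M.e (Y ∩ A) Yᶜ := by
      unfold e wsum
      refine Finset.sum_congr rfl fun x _ => Finset.sum_congr rfl fun y _ => ?_
      split_ifs with h
      · refine le_antisymm (hF.le x y) ?_
        by_contra hlt
        exact hstep x h.1.1 y h.2 (Or.inl ⟨h.1.2, not_le.1 hlt⟩)
      · rfl
    have h5 : M.e (Y ∩ A) Yᶜ = M.e (Yᶜ \ A) Yᶜᶜ := by
      rw [compl_compl, e_comm]
      unfold e wsum
      refine Finset.sum_congr rfl fun x _ => Finset.sum_congr rfl fun y _ => ?_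
      by_cases hxy : M.m x y = 0
      · simp [hxy]
      · have := hA x trivial y trivial hxy
        split_ifs <;> simp_all
    have h6 : wsum F (Y \ A) Set.univ = 1 * (Y \ A).ncard := by
      refine wsum_univ_right_of_deg fun x hx => ?_
      rw [hF.deg, hδ x (by rintro rfl; exact hx.2 hcA) (by rintro rfl; exact hbY hx.1)]
    have h7 : wsum F (Y ∩ A) Set.univ = (Y ∩ A).ncard + t := by
      have h8 : Y ∩ A = insert c ((Y ∩ A) \ {c}) := by
        rw [Set.insert_sdiff_singleton, Set.insert_eq_of_mem (show c ∈ Y ∩ A from ⟨hcY, hcA⟩)]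
      rw [h8, wsum_insert_left (by simp), wsum_singleton_univ, hF.deg, hδc,
        Set.ncard_insert_of_notMem (by simp), wsum_univ_right_of_deg (k := 1)]
      · omega
      · intro x hx
        rw [hF.deg, hδ x hx.2 (by rintro rfl; exact hbY hx.1.1)]
    have h9 := hc.card_colour hA
    have h10 : A.ncard = (Y ∩ A).ncard + (Yᶜ ∩ A).ncard := by
      rw [Set.inter_comm, ← Set.ncard_inter_add_ncard_sdiff_eq_ncard A Y, Set.inter_comm Yᶜ,
        Set.sdiff_eq]
    have h11 : Aᶜ.ncard = (Y \ A).ncard + (Yᶜ \ A).ncard := by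
      rw [← Set.ncard_inter_add_ncard_sdiff_eq_ncard Aᶜ Y, Set.inter_comm Aᶜ, ← Set.sdiff_eq, Set.sdiff_eq Aᶜ,
        Set.inter_comm Aᶜ, ← Set.sdiff_eq]
    omega

/-- The sets which separate vertices from `c` in factors with degree `3` at `c`. -/
def Bad (M : MG V) (A : Set V) (c : V) (X : Set V) : Prop :=
  X.Nonempty ∧ c ∉ X ∧ M.e (X \ A) Xᶜ + (X ∩ A).ncard = (X \ A).ncard + 1

/-- Let p and q be the numbers of edges leaving `X ∩ A` and `X \ A`. By `colOn_card`, three times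
the difference of the two sides before adding 1 is `p + 2q ≥ p + q ≥ 2`; integrality gives the
bound. -/
lemma tight_lower (hc : M.Cubic) (he : M.EC 2) {X A : Set V} (hA : M.ColOn X A) (h1 : X.Nonempty)
    (h2 : Xᶜ.Nonempty) : (X \ A).ncard + 1 ≤ M.e (X \ A) Xᶜ + (X ∩ A).ncard := by
  have h3 := hc.colOn_card hA
  have h4 := M.cut_split X A
  have h5 := he X h1 h2
  omega

lemma twoNice_or_bad (hc : M.Cubic) (he : M.EC 2) {A : Set V} (hA : M.ColOn Set.univ A) {b c : V}
    (hb : b ∉ A) (hcA : c ∈ A) : M.TwoNice c b ∨ ∃ X, M.Bad A c X ∧ b ∈ X := by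
  have hbc : b ≠ c := by rintro rfl; exact hb hcA
  obtain ⟨y, hy⟩ : ∃ y, M.m c y ≠ 0 := by
    by_contra h
    push Not at h
    simpa [h] using hc c
  obtain ⟨F, hF, -⟩ := exists_factor_one hc he hy
  -- Two units have to be added at `c` and `b` to a perfect matching. The first can always be added,
  -- since a tight set for `t = 0` violates `tight_lower`; obstructions to the second, `t = 1`, are
  -- exactly of the form `Bad`.
  rcases exists_augment_or_tight hc hA hb hcA hF (t := 0) rfl (fun _ _ _ => rfl) with
    ⟨δ₁, F₁, hF₁, hδ₁⟩ | ⟨X, hbX, hcX, hX⟩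
  · rcases exists_augment_or_tight hc hA hb hcA hF₁ (t := 1) (by simp [hδ₁, hbc.symm])
      (fun y h1 h2 => by simp [hδ₁, h1, h2]) with ⟨δ₂, F₂, hF₂, hδ₂⟩ | ⟨X, hbX, hcX, hX⟩
    · refine Or.inl ⟨δ₂, F₂, hF₂, ?_, ?_, ?_⟩
      · simp [hδ₂, hδ₁, hbc.symm]
      · simp [hδ₂, hδ₁, hbc]
      · intro x h1 h2; simp [hδ₂, hδ₁, h1, h2]
    · exact Or.inr ⟨X, ⟨⟨b, hbX⟩, hcX, hX⟩, hbX⟩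
  · have := tight_lower hc he (hA.mono (Set.subset_univ X)) ⟨b, hbX⟩ ⟨c, hcX⟩
    omega

/-- Tightness means `p + 2q = 3` for the numbers p and q of edges leaving the two colour classes, so
`(p, q)` is `(1, 1)` or `(3, 0)`. -/
lemma Bad.cases (hc : M.Cubic) {A : Set V} (hA : M.ColOn Set.univ A) {c : V} {X : Set V}
    (h : M.Bad A c X) : (M.cut X = 2 ∧ (X ∩ A).ncard = (X \ A).ncard) ∨
      (M.cut X = 3 ∧ (X ∩ A).ncard = (X \ A).ncard + 1 ∧ M.e (X \ A) Xᶜ = 0) := by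
  have h3 := hc.colOn_card (hA.mono (Set.subset_univ X))
  have h4 := M.cut_split X A
  have h5 := h.2.2
  omega

lemma bad_singleton {A : Set V} {a c : V} (ha : a ∈ A) (hac : a ≠ c) : M.Bad A c {a} := by
  refine ⟨by simp, by simpa using hac.symm, ?_⟩
  have h1 : ({a} : Set V) \ A = ∅ := Set.sdiff_eq_empty.2 (by simpa using ha)
  have h2 : ({a} : Set V) ∩ A = {a} := by simpa using ha
  simp [h1, h2]

lemma submodular (A X Y : Set V) : M.e ((X ∪ Y) \ A) (X ∪ Y)ᶜ + M.e ((X ∩ Y) \ A) (X ∩ Y)ᶜ ≤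
    M.e (X \ A) Xᶜ + M.e (Y \ A) Yᶜ := by
  unfold e wsum
  simp only [← Finset.sum_add_distrib]
  refine Finset.sum_le_sum fun x _ => Finset.sum_le_sum fun y _ => ?_
  by_cases h1 : x ∈ A <;> by_cases h2 : x ∈ X <;> by_cases h3 : x ∈ Y <;> by_cases h4 : y ∈ X <;>
    by_cases h5 : y ∈ Y <;> simp [h1, h2, h3, h4, h5]

/-- Bad sets attain the lower bound `tight_lower` of a submodular function, so the union and the
intersection, if non-empty, attain it as well. -/
lemma Bad.union (hc : M.Cubic) (he : M.EC 2) {A : Set V} (hA : M.ColOn Set.univ A) {c : V}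
    {X Y : Set V} (hX : M.Bad A c X) (hY : M.Bad A c Y) (hXY : (X ∩ Y).Nonempty) :
    M.Bad A c (X ∪ Y) := by
  have hcU : c ∉ X ∪ Y := by simp [hX.2.1, hY.2.1]
  refine ⟨hX.1.mono Set.subset_union_left, hcU, ?_⟩
  have h1 := tight_lower hc he (hA.mono (Set.subset_univ (X ∪ Y))) (hX.1.mono Set.subset_union_left)
    ⟨c, hcU⟩
  have h2 := tight_lower hc he (hA.mono (Set.subset_univ (X ∩ Y))) hXY ⟨c, fun h => hX.2.1 h.1⟩
  have h3 := M.submodular A X Y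
  have h4 := Set.ncard_union_add_ncard_inter (X ∩ A) (Y ∩ A)
  have h5 := Set.ncard_union_add_ncard_inter (X \ A) (Y \ A)
  rw [← Set.union_inter_distrib_right, ← Set.inter_inter_distrib_right] at h4
  rw [← Set.union_sdiff_distrib, show X \ A ∩ (Y \ A) = (X ∩ Y) \ A by ext; simp; tauto] at h5
  have h6 := hX.2.2
  have h7 := hY.2.2
  omega

lemma ncard_iUnion_inter {ι : Type*} [Fintype ι] {X : ι → Set V}
    (h : Pairwise (Function.onFun Disjoint X)) : (⋃ i, X i).ncard = ∑ i, (X i).ncard := by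
  rw [Set.ncard_iUnion_of_finite (fun _ => Set.toFinite _) h, finsum_eq_sum_of_fintype]

/-- The maximal bad sets and the number of vertices which avoid all bad sets. -/
lemma exists_max_bad (hc : M.Cubic) (he : M.EC 2) {A : Set V} (hA : M.ColOn Set.univ A) {c : V}
    (hcA : c ∈ A) : ∃ (ι : Type u) (_ : Fintype ι) (X : ι → Set V), (∀ i, M.Bad A c (X i)) ∧
      Pairwise (Function.onFun Disjoint X) ∧ (∀ Y, M.Bad A c Y → ∃ i, Y ⊆ X i) ∧
      {b | b ∉ A ∧ ∀ Y, M.Bad A c Y → b ∉ Y}.ncard + 2 * Fintype.card ι = 1 + ∑ i, M.cut (X i) := by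
  classical
  obtain ⟨inst⟩ := nonempty_fintype {X : Set V // Maximal (M.Bad A c) X}
  have hdisj : Pairwise (Function.onFun Disjoint
      (fun X : {X : Set V // Maximal (M.Bad A c) X} => X.1)) := by
    rintro ⟨X, hX⟩ ⟨Y, hY⟩ hXY
    by_contra hne
    rw [Function.onFun, Set.not_disjoint_iff_nonempty_inter] at hne
    have hU := hX.1.union hc he hA hY.1 hne
    have h1 := hX.eq_of_subset hU Set.subset_union_left
    have h2 := hY.eq_of_subset hU Set.subset_union_right
    exact hXY (Subtype.ext (h1.trans h2.symm))
  have hcov : ∀ Y, M.Bad A c Y → ∃ i : {X : Set V // Maximal (M.Bad A c) X}, Y ⊆ i.1 := by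
    intro Y hY
    obtain ⟨X, h1, h2⟩ := (Set.toFinite {X | M.Bad A c X}).exists_le_maximal hY
    exact ⟨⟨X, h2⟩, h1⟩
  refine ⟨{X : Set V // Maximal (M.Bad A c) X}, inst, Subtype.val, fun i => i.2.1, hdisj, hcov, ?_⟩
  set S : Set V := {b | b ∉ A ∧ ∀ Y, M.Bad A c Y → b ∉ Y} with hS
  -- Every vertex of `A` except `c` is a bad singleton, so the maximal bad sets partition the rest
  -- of `A`.
  have h1 : A = insert c (⋃ i : {X : Set V // Maximal (M.Bad A c) X}, i.1 ∩ A) := by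
    ext a
    simp only [Set.mem_insert_iff, Set.mem_iUnion, Set.mem_inter_iff]
    constructor
    · intro ha
      by_cases hac : a = c
      · exact Or.inl hac
      · obtain ⟨i, hi⟩ := hcov _ (bad_singleton ha hac)
        exact Or.inr ⟨i, hi rfl, ha⟩
    · rintro (rfl | ⟨_, _, h⟩)
      · exact hcA
      · exact h
  have h2 : Aᶜ = S ∪ ⋃ i : {X : Set V // Maximal (M.Bad A c) X}, i.1 \ A := by
    ext a
    simp only [Set.mem_union, Set.mem_iUnion, Set.mem_sdiff, Set.mem_compl_iff]
    constructor
    · intro ha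
      by_cases haS : a ∈ S
      · exact Or.inl haS
      · simp only [hS, Set.mem_ofPred_eq, not_and, not_forall, not_not] at haS
        obtain ⟨Y, hY, haY⟩ := haS ha
        obtain ⟨i, hi⟩ := hcov Y hY
        exact Or.inr ⟨i, hi haY, ha⟩
    · rintro (h | ⟨_, _, h⟩)
      · exact h.1
      · exact h
  have h3 : A.ncard = 1 + ∑ i : {X : Set V // Maximal (M.Bad A c) X}, (i.1 ∩ A).ncard := by
    rw [← ncard_iUnion_inter fun i j hij => (hdisj hij).mono Set.inter_subset_left Set.inter_subset_left]
    conv_lhs => rw [h1]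
    rw [Set.ncard_insert_of_notMem, add_comm]
    simp only [Set.mem_iUnion, not_exists]
    exact fun i hi => i.2.1.2.1 hi.1
  have h4 : Aᶜ.ncard = S.ncard + ∑ i : {X : Set V // Maximal (M.Bad A c) X}, (i.1 \ A).ncard := by
    rw [← ncard_iUnion_inter fun i j hij => (hdisj hij).mono Set.sdiff_subset Set.sdiff_subset]
    conv_lhs => rw [h2]
    rw [Set.ncard_union_eq]
    rw [Set.disjoint_left]
    intro x hx hx2
    obtain ⟨i, hi⟩ := Set.mem_iUnion.1 hx2
    exact hx.2 _ i.2.1 hi.1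
  -- The surplus of the class `A` in a bad set is its cut size minus 2, in both cases of
  -- `Bad.cases`. Comparing `|A|` with `|Aᶜ|` then gives the count.
  have h5 : ∑ i : {X : Set V // Maximal (M.Bad A c) X}, ((i.1 ∩ A).ncard + 2) = ∑ i : {X : Set V // Maximal (M.Bad A c) X}, ((i.1 \ A).ncard + M.cut i.1) := by
    refine Finset.sum_congr rfl fun i _ => ?_
    rcases i.2.1.cases hc hA with h | h <;> omega
  rw [Finset.sum_add_distrib, Finset.sum_add_distrib, Finset.sum_const, Finset.card_univ, smul_eq_mul] at h5
  have h6 := hc.card_colour hA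
  omega

end MG
end NiceCubic

/-! ### At least four nice vertices, and hidden vertices in the case of equality. -/

namespace NiceCubic
namespace MG
variable {V : Type u} [Fintype V] {M : MG V}

open scoped Classical in
lemma IsFactor.sum_at {u : V} {F : V → V → ℕ} (hF : M.IsFactor (fun v => if v = u then 3 else 1) F)
    (X : Set V) : wsum F X Set.univ = X.ncard + if u ∈ X then 2 else 0 := by
  split_ifs with hu
  · have h8 : X = insert u (X \ {u}) := by
      rw [Set.insert_sdiff_singleton, Set.insert_eq_of_mem hu]
    rw [h8, wsum_insert_left (by simp), wsum_singleton_univ, hF.deg,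
      Set.ncard_insert_of_notMem (by simp), wsum_univ_right_of_deg (k := 1)]
    · simp only [if_true]; omega
    · intro x hx
      rw [hF.deg, if_neg (by simpa using hx.2)]
  · rw [wsum_univ_right_of_deg (k := 1), one_mul, add_zero]
    intro x hx
    rw [hF.deg, if_neg (by rintro rfl; exact hu hx)]

/-- In a coloured set with a 2-edge cut the classes have equal size and each sends out one edge.
Degree 3 at `v` makes the degree sums of a factor on the two classes differ by 2, while the edges
leaving the set can account for at most 1. -/
lemma not_nice_of_hidden (hc : M.Cubic) {v : V} (hv : M.Hidden v) : ¬ M.Nice v := by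
  classical
  rintro ⟨F, hF⟩
  obtain ⟨X, A, hvX, hcut, hA⟩ := hv
  have h1 := hc.colOn_card hA
  have h2 := M.cut_split X A
  have h3 := hA.wsum_left hF.le
  have h4 := hA.wsum_right hF.le hF.symm
  rw [hF.sum_at] at h3 h4
  have h5 : wsum F (X ∩ A) Xᶜ ≤ M.e (X ∩ A) Xᶜ := wsum_mono hF.le le_rfl le_rfl
  have h6 : wsum F (X \ A) Xᶜ ≤ M.e (X \ A) Xᶜ := wsum_mono hF.le le_rfl le_rfl
  by_cases hvA : v ∈ A <;> simp only [Set.mem_inter_iff, Set.mem_sdiff, hvX, hvA, true_and,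
    if_true, if_false, not_true_eq_false, not_false_eq_true] at h3 h4 <;> omega

lemma four_le_card (hc : M.Cubic) (hb : ¬ M.Bip) : 4 ≤ Fintype.card V := by
  by_contra h
  have h2 := hc.even_card
  rw [Nat.even_iff] at h2
  apply hb
  rcases isEmpty_or_nonempty V with hV | ⟨⟨x⟩⟩
  · exact ⟨∅, fun x => (hV.false x).elim⟩
  · refine ⟨{x}, fun y _ z _ hyz => ?_⟩
    have hne : y ≠ z := by rintro rfl; exact hyz (M.loopless _)
    simp only [Set.mem_singleton_iff]
    constructor
    · rintro rfl; exact hne.symm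
    · intro hzx
      by_contra hyx
      have : 2 < Fintype.card V := Fintype.two_lt_card_iff.2 ⟨x, y, z, Ne.symm hyx, Ne.symm hzx, hne⟩
      omega

lemma niceNum_split (C : Set V) :
    M.niceNum = ({v | M.Nice v} ∩ C).ncard + ({v | M.Nice v} ∩ Cᶜ).ncard := by
  rw [niceNum, ← Set.ncard_inter_add_ncard_sdiff_eq_ncard _ C, Set.sdiff_eq]

lemma ncard_nice_inter (hc : M.Cubic) (he : M.EC 2) {C : Set V} (hC : M.cut C = 3) (hne : C.Nonempty) :
    ({q | (M.contract C).Nice q} \ {none}).ncard ≤ ({v | M.Nice v} ∩ C).ncard := by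
  refine (Set.ncard_le_ncard ?_ (Set.toFinite _)).trans
    (Set.ncard_image_le (f := pr C) (Set.toFinite ({v | M.Nice v} ∩ C)))
  rintro (_ | a) ⟨h1, h2⟩
  · exact absurd rfl h2
  · refine ⟨a, ⟨Nice.of_contract hc he hC hne a.2 ?_, a.2⟩, pr_coe a⟩
    rw [pr_coe]; exact h1

lemma niceNum_le_inter_add_one (hc : M.Cubic) (he : M.EC 2) {C : Set V} (hC : M.cut C = 3)
    (hne : C.Nonempty) :
    (M.contract C).niceNum ≤ ({v | M.Nice v} ∩ C).ncard + 1 := by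
  have h1 := ncard_nice_inter hc he hC hne
  have h2 := Set.ncard_le_ncard_sdiff_add_ncard {q | (M.contract C).Nice q} {none}
  rw [Set.ncard_singleton] at h2
  rw [niceNum]
  omega

lemma niceNum_le_inter (hc : M.Cubic) (he : M.EC 2) {C : Set V} (hC : M.cut C = 3)
    (hne : C.Nonempty) (hn : ¬ (M.contract C).Nice none) :
    (M.contract C).niceNum ≤ ({v | M.Nice v} ∩ C).ncard := by
  have h1 := ncard_nice_inter hc he hC hne
  rwa [Set.sdiff_singleton_eq_self (by exact hn)] at h1

lemma Bip.exists_colour (h : M.Bip) (c : V) : ∃ A, M.ColOn Set.univ A ∧ c ∈ A := by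
  obtain ⟨A, hA⟩ := h
  by_cases hc : c ∈ A
  · exact ⟨A, hA, hc⟩
  · exact ⟨Aᶜ, hA.compl, hc⟩

/-- These are the nice vertices on the bipartite side; they compensate for the contraction vertex,
which is nice on the other side but absent from `M`. -/
lemma ncard_good_le (hc : M.Cubic) (he : M.EC 2) {C : Set V} (hC : M.cut C = 3)
    (hne : C.Nonempty) (hnice : (M.contract C).Nice none) {A : Set (Option (Cᶜ : Set V))}
    (hA : (M.contract Cᶜ).ColOn Set.univ A) (hcA : none ∈ A) :
    {b | b ∉ A ∧ ∀ Y, (M.contract Cᶜ).Bad A none Y → b ∉ Y}.ncard ≤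
      ({v | M.Nice v} ∩ Cᶜ).ncard := by
  refine (Set.ncard_le_ncard ?_ (Set.toFinite _)).trans
    (Set.ncard_image_le (f := pr Cᶜ) (Set.toFinite ({v | M.Nice v} ∩ Cᶜ)))
  rintro (_ | b) ⟨h1, h2⟩
  · exact absurd hcA h1
  · refine ⟨b, ⟨Nice.of_twoNice hc hC b.2 hnice ?_, b.2⟩, pr_coe b⟩
    rw [pr_coe]
    rcases twoNice_or_bad (contract_cubic hc (by rw [cut_compl, hC]))
      (contract_EC he (by rwa [compl_compl])) hA h1 hcA with h | ⟨X, hX, hbX⟩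
    · exact h
    · exact absurd hbX (h2 X hX)

lemma niceNum_eq_card (h : ∀ v, M.Nice v) : M.niceNum = Fintype.card V := by
  rw [niceNum, ← Nat.card_eq_fintype_card, ← Set.ncard_univ]
  congr 1; ext v; simp [h v]

lemma nice_of_card_le (h : Fintype.card V ≤ M.niceNum) (v : V) : M.Nice v := by
  have : {v | M.Nice v} = Set.univ := by
    apply Set.eq_of_subset_of_ncard_le (Set.subset_univ _) _ (Set.toFinite _)
    rwa [Set.ncard_univ, Nat.card_eq_fintype_card]
  have hv : v ∈ {v | M.Nice v} := by rw [this]; trivial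
  exact hv

/-- In a non-bipartite multigraph, a non-trivial cut has a side with non-bipartite contraction. -/
lemma exists_nonbip_cut (hc : M.Cubic) (he : M.EC 2) (hb : ¬ M.Bip) {u : V}
    (hn : ¬ M.Nice u) : ∃ C : Set V, M.cut C = 3 ∧ 2 ≤ C.ncard ∧ 2 ≤ Cᶜ.ncard ∧
      ¬ (M.contract C).Bip := by
  obtain ⟨C, h1, h2, h3⟩ := exists_cut_of_not_nice hc he hb hn
  by_cases hK : (M.contract C).Bip
  · refine ⟨Cᶜ, by rw [cut_compl, h1], h3, by rwa [compl_compl], fun hH => hb (hK.of_contract hH)⟩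
  · exact ⟨C, h1, h2, h3, hK⟩

/-- There are at least four nice vertices, and if there are exactly four then all other vertices
are hidden. -/
theorem four_le_niceNum (n : ℕ) : ∀ (V : Type u) [Fintype V] (M : MG V), Fintype.card V = n →
    M.Cubic → M.EC 2 → ¬ M.Bip →
    4 ≤ M.niceNum ∧ (M.niceNum = 4 → ∀ v, ¬ M.Nice v → M.Hidden v) := by
  induction n using Nat.strong_induction_on with
  | _ n ih =>
  intro V _ M hn hc he hb
  by_cases hall : ∀ v, M.Nice v
  · rw [niceNum_eq_card hall]
    exact ⟨four_le_card hc hb, fun _ v hv => absurd (hall v) hv⟩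
  push Not at hall
  obtain ⟨u, hu⟩ := hall
  obtain ⟨C, hC, hC1, hC2, hK⟩ := exists_nonbip_cut hc he hb hu
  have hne : C.Nonempty := Set.nonempty_of_ncard_ne_zero (by omega)
  have hne' : Cᶜ.Nonempty := Set.nonempty_of_ncard_ne_zero (by omega)
  have hC' : M.cut Cᶜ = 3 := by rw [cut_compl, hC]
  have hKc := contract_cubic hc hC
  have hKe := contract_EC he hne'
  have hHc := contract_cubic hc hC'
  have hHe := contract_EC he (C := Cᶜ) (by rwa [compl_compl])
  obtain ⟨ihK1, ihK2⟩ := ih _ (by rw [← hn]; exact card_contract_lt hC2) _ (M.contract C) rfl hKc hKe hK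
  have hsplit := M.niceNum_split C
  have hle1 := niceNum_le_inter_add_one hc he hC hne
  by_cases hH : (M.contract Cᶜ).Bip
  -- If `none` is nice, at least three nice vertices remain on the side of `C` and the other side
  -- supplies at least one. If it is not, all four nice vertices of the contraction survive.
  · by_cases hnone : (M.contract C).Nice none
    · obtain ⟨A, hA, hcA⟩ := hH.exists_colour none
      have hgood := ncard_good_le hc he hC hne hnone hA hcA
      obtain ⟨ι, _, X, hX, -, hmax, hcard⟩ := exists_max_bad hHc hHe hA hcA
      have hcutX : ∀ i, 2 ≤ (M.contract Cᶜ).cut (X i) := fun i => by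
        rcases (hX i).cases hHc hA with h | h <;> omega
      have hsum : ∑ i : ι, 2 ≤ ∑ i, (M.contract Cᶜ).cut (X i) :=
        Finset.sum_le_sum fun i _ => hcutX i
      have hsum2 : ∑ i : ι, 2 = 2 * Fintype.card ι := by simp [mul_comm]
      refine ⟨by omega, fun h4 v hv => ?_⟩
      by_cases hvC : v ∈ C
      · obtain ⟨Y, B, h1, h2, h3⟩ := ihK2 (by omega) (pr C v)
          fun h => hv (Nice.of_contract hc he hC hne hvC h)
        -- A hidden set cannot contain the nice vertex `none`, so it lifts to `M` unchanged.
        have hY : none ∉ Y := fun h => not_nice_of_hidden hKc ⟨Y, B, h, h2, h3⟩ hnone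
        exact ⟨pr C ⁻¹' Y, _, h1, by rw [← quot_cut, h2], h3.of_contract hY⟩
      -- With only one surviving vertex on the bipartite side, all maximal bad sets have cuts of
      -- size 2, so they are hidden sets.
      · have hsumeq : ∑ i : ι, 2 = ∑ i, (M.contract Cᶜ).cut (X i) := by omega
        have hcut2 := (Finset.sum_eq_sum_iff_of_le fun i _ => hcutX i).1 hsumeq
        have hbad : ∃ Y, (M.contract Cᶜ).Bad A none Y ∧ pr Cᶜ v ∈ Y := by
          by_cases hvA : pr Cᶜ v ∈ A
          · exact ⟨_, bad_singleton hvA (by rw [Ne, pr_eq_none]; simpa using hvC), rfl⟩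
          · rcases twoNice_or_bad hHc hHe hA hvA hcA with h | h
            · exact absurd (Nice.of_twoNice hc hC hvC hnone h) hv
            · exact h
        obtain ⟨Y, hY, hvY⟩ := hbad
        obtain ⟨i, hi⟩ := hmax Y hY
        exact ⟨pr Cᶜ ⁻¹' X i, _, hi hvY,
          by rw [← quot_cut]; exact (hcut2 i (Finset.mem_univ i)).symm,
          (hA.mono (Set.subset_univ (X i))).of_contract (hX i).2.1⟩
    · have hle := niceNum_le_inter hc he hC hne hnone
      refine ⟨by omega, fun h4 v hv => ?_⟩
      refine Hidden.of_contract hH (ihK2 (by omega) (pr C v) fun h => ?_)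
      by_cases hvC : v ∈ C
      · exact hv (Nice.of_contract hc he hC hne hvC h)
      · rw [pr_of_notMem hvC] at h
        exact hnone h
  -- Both contractions are non-bipartite, and each supplies at least `4 - 1` nice vertices.
  · obtain ⟨ihH1, -⟩ := ih _ (by rw [← hn]; exact card_contract_lt (C := Cᶜ) (by rwa [compl_compl])) _
      (M.contract Cᶜ) rfl hHc hHe hH
    have hle2 := niceNum_le_inter_add_one hc he hC' hne'
    exact ⟨by omega, fun h4 => by omega⟩

end MG

/-! ### The graph `K₃,₃^△` -/

/-- The two vertices of `K₃,₃^△` which are not nice. -/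
def labX (s : Fin 2) : K33TriangleVertex := .inl ⟨.inl s.succ, by simp⟩
/-- The neighbours of the triangle. -/
def labB (j : Fin 3) : K33TriangleVertex := .inl ⟨.inr j, by simp⟩
/-- The vertices of the triangle. -/
def labT (j : Fin 3) : K33TriangleVertex := .inr ⟨j.succ, Fin.succ_ne_zero j⟩

lemma lab_cases (p : K33TriangleVertex) :
    (∃ s, p = labX s) ∨ (∃ j, p = labB j) ∨ ∃ j, p = labT j := by
  rcases p with ⟨i | j, h⟩ | ⟨b, h⟩
  · obtain ⟨s, rfl⟩ := Fin.exists_succ_eq.2 (show i ≠ 0 by rintro rfl; exact h rfl)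
    exact Or.inl ⟨s, rfl⟩
  · exact Or.inr (Or.inl ⟨j, rfl⟩)
  · obtain ⟨s, rfl⟩ := Fin.exists_succ_eq.2 h
    exact Or.inr (Or.inr ⟨s, rfl⟩)

lemma labX_inj {s t : Fin 2} : labX s = labX t ↔ s = t := by simp [labX]
lemma labB_inj {s t : Fin 3} : labB s = labB t ↔ s = t := by simp [labB]
lemma labT_inj {s t : Fin 3} : labT s = labT t ↔ s = t := by simp [labT]
lemma labX_ne_labB {s : Fin 2} {t : Fin 3} : labX s ≠ labB t := by simp [labX, labB]
lemma labX_ne_labT {s : Fin 2} {t : Fin 3} : labX s ≠ labT t := by simp [labX, labT]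
lemma labB_ne_labT {s t : Fin 3} : labB s ≠ labT t := by simp [labB, labT]

lemma adj_labX_labX (s t : Fin 2) : ¬ K33Triangle.Adj (labX s) (labX t) := by
  simp [labX, K33Triangle, splice]
lemma adj_labX_labB (s : Fin 2) (t : Fin 3) : K33Triangle.Adj (labX s) (labB t) := by
  simp [labX, labB, K33Triangle, splice]
lemma adj_labX_labT (s : Fin 2) (t : Fin 3) : ¬ K33Triangle.Adj (labX s) (labT t) := by
  simp [labX, labT, K33Triangle, splice]
lemma adj_labB_labB (s t : Fin 3) : ¬ K33Triangle.Adj (labB s) (labB t) := by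
  simp [labB, K33Triangle, splice]
lemma adj_labB_labT (s t : Fin 3) : K33Triangle.Adj (labB s) (labT t) ↔ s = t := by
  simp [labB, labT, K33Triangle, splice, k33k4Equiv]
lemma adj_labT_labT (s t : Fin 3) : K33Triangle.Adj (labT s) (labT t) ↔ s ≠ t := by
  simp [labT, K33Triangle, splice]

end NiceCubic

/-! ### Expansions of `K₃,₃^△` have at most six nice vertices. -/

namespace NiceCubic

open scoped Classical in
/-- The multigraph of a simple graph. -/
noncomputable def ofGraph {V : Type u} (G : SimpleGraph V) : MG V where
  m x y := if G.Adj x y then 1 else 0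
  symm x y := by simp only [G.adj_comm]
  loopless x := by simp

lemma ofGraph_ne_zero {V : Type u} {G : SimpleGraph V} {x y : V} :
    (ofGraph G).m x y ≠ 0 ↔ G.Adj x y := by simp [ofGraph]

/-- The labels of the vertices of `K₃,₃^△`. -/
def lab : Fin 2 ⊕ (Fin 3 ⊕ Fin 3) → K33TriangleVertex := Sum.elim labX (Sum.elim labB labT)

lemma lab_bijective : Function.Bijective lab := by
  constructor
  · rintro (a | a | a) (b | b | b) h <;>
      simp [lab, labX_inj, labB_inj, labT_inj, labX_ne_labB, labX_ne_labT, labB_ne_labT,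
        labX_ne_labB.symm, labX_ne_labT.symm, labB_ne_labT.symm] at h ⊢ <;> exact h
  · intro p
    rcases lab_cases p with ⟨s, rfl⟩ | ⟨s, rfl⟩ | ⟨s, rfl⟩
    · exact ⟨.inl s, rfl⟩
    · exact ⟨.inr (.inl s), rfl⟩
    · exact ⟨.inr (.inr s), rfl⟩

lemma sum_lab (g : K33TriangleVertex → ℕ) :
    ∑ p, g p = ∑ s, g (labX s) + (∑ j, g (labB j) + ∑ j, g (labT j)) := by
  rw [← lab_bijective.sum_comp, Fintype.sum_sum_type, Fintype.sum_sum_type]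
  rfl

lemma K33Triangle_cubic : (ofGraph K33Triangle).Cubic := by
  classical
  intro p
  rw [sum_lab]
  rcases lab_cases p with ⟨s, rfl⟩ | ⟨s, rfl⟩ | ⟨s, rfl⟩
  · simp [ofGraph, adj_labX_labX, adj_labX_labB, adj_labX_labT]
  · simp [ofGraph, adj_labB_labB, adj_labB_labT, (adj_labX_labB _ _).symm]
  · simp only [ofGraph, K33Triangle.adj_comm (labT s) (labX _), K33Triangle.adj_comm (labT s) (labB _),
      adj_labX_labT, adj_labT_labT, adj_labB_labT]
    revert s; decide

namespace MG

lemma ext_m {V : Type u} {M N : MG V} (h : ∀ x y, M.m x y = N.m x y) : M = N := by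
  obtain ⟨m, _, _⟩ := M
  obtain ⟨m', _, _⟩ := N
  obtain rfl : m = m' := funext fun x => funext fun y => h x y
  rfl

variable {V : Type u} [Fintype V] {M : MG V}

/-- The quotient by `f` is `K₃,₃^△`, where only the two vertices which are not nice may be expanded,
to bipartite pieces all of whose outgoing edges start in the same colour class. -/
structure IsShape (M : MG V) (f : V → K33TriangleVertex) : Prop where
  quot : ∀ p q, (M.quot f).m p q = (ofGraph K33Triangle).m p q
  labB : ∀ j, ∃ v, f ⁻¹' {labB j} = {v}
  labT : ∀ j, ∃ v, f ⁻¹' {labT j} = {v}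
  labX : ∀ s, ∃ A, M.ColOn (f ⁻¹' {labX s}) A ∧
    ∀ x, f x = labX s → ∀ y, f y ≠ labX s → M.m x y ≠ 0 → x ∈ A

lemma IsShape.quot_eq {f : V → K33TriangleVertex} (h : M.IsShape f) : M.quot f = ofGraph K33Triangle := by
  exact ext_m h.quot

lemma IsShape.cut_fibre {f : V → K33TriangleVertex} (h : M.IsShape f) (p : K33TriangleVertex) :
    M.cut (f ⁻¹' {p}) = 3 := by
  rw [← quot_cut, h.quot_eq, K33Triangle_cubic.cut_singleton]

lemma IsShape.e_eq_zero {f : V → K33TriangleVertex} (h : M.IsShape f) {Y Z : Set K33TriangleVertex}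
    (hd : Disjoint Y Z) (hYZ : ∀ p ∈ Y, ∀ q ∈ Z, ¬ K33Triangle.Adj p q) :
    M.e (f ⁻¹' Y) (f ⁻¹' Z) = 0 := by
  rw [← quot_e f hd, h.quot_eq, wsum_eq_zero]
  intro p hp q hq
  by_contra h0
  exact hYZ p hp q hq (ofGraph_ne_zero.1 h0)

lemma IsShape.card_range {f : V → K33TriangleVertex} {g : Fin 3 → K33TriangleVertex}
    (hg : Function.Injective g) (h : ∀ j, ∃ v, f ⁻¹' {g j} = {v}) :
    (f ⁻¹' (Set.range g)).ncard = 3 := by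
  have : f ⁻¹' (Set.range g) = ⋃ j, f ⁻¹' {g j} := by
    ext v; simp [eq_comm]
  rw [this, ncard_iUnion_inter]
  · rw [Finset.sum_congr rfl fun j _ => (Set.ncard_eq_one.2 (h j))]
    simp
  · intro i j hij
    refine Set.disjoint_left.2 fun x h1 h2 => hij (hg ?_)
    exact (Set.mem_singleton_iff.1 h1).symm.trans h2

/-- A factor with degree 3 at `u` overloads the three vertices over the `labB`, whose degrees in it
sum to 3. They receive at least one edge from the triangle by parity, three from the piece that
contains `u` and one from the other piece. -/
lemma IsShape.not_nice (hc : M.Cubic) {f : V → K33TriangleVertex} (h : M.IsShape f) {u : V} {s : Fin 2}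
    (hu : f u = NiceCubic.labX s) : ¬ M.Nice u := by
  classical
  rintro ⟨F, hF⟩
  set B : Set V := f ⁻¹' (Set.range NiceCubic.labB) with hB
  set T : Set V := f ⁻¹' (Set.range NiceCubic.labT) with hT
  set X : Fin 2 → Set V := fun s => f ⁻¹' {NiceCubic.labX s} with hX
  have hB3 : B.ncard = 3 := card_range (fun _ _ => labB_inj.1) h.labB
  have hT3 : T.ncard = 3 := card_range (fun _ _ => labT_inj.1) h.labT
  have hTB : Disjoint T B := Set.disjoint_left.2 fun x ⟨i, hi⟩ ⟨j, hj⟩ => labB_ne_labT (hj.trans hi.symm)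
  have hXB : ∀ s, Disjoint (X s) B :=
    fun s => Set.disjoint_left.2 fun x hi ⟨j, hj⟩ => labX_ne_labB (hi.symm.trans hj.symm)
  have hXT : ∀ s, Disjoint (X s) T :=
    fun s => Set.disjoint_left.2 fun x hi ⟨j, hj⟩ => labX_ne_labT (hi.symm.trans hj.symm)
  have hXX : ∀ s t, s ≠ t → Disjoint (X s) (X t) :=
    fun s t hst => Set.disjoint_left.2 fun x hi hj => hst (labX_inj.1 (hi.symm.trans hj))
  have huB : u ∉ B := fun h => Set.disjoint_left.1 (hXB s) hu h
  have huT : u ∉ T := fun h => Set.disjoint_left.1 (hXT s) hu h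
  have hTrest : wsum F T (T ∪ B)ᶜ = 0 := by
    have h1 : M.e (f ⁻¹' (Set.range NiceCubic.labT))
        (f ⁻¹' (Set.range NiceCubic.labT ∪ Set.range NiceCubic.labB)ᶜ) = 0 := by
      refine h.e_eq_zero ?_ ?_
      · exact Set.disjoint_left.2 fun x h1 h2 => h2 (Or.inl h1)
      · rintro _ ⟨i, rfl⟩ q hq hadj
        rcases lab_cases q with ⟨s, rfl⟩ | ⟨s, rfl⟩ | ⟨s, rfl⟩
        · exact adj_labX_labT _ _ hadj.symm
        · exact hq (Or.inr ⟨s, rfl⟩)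
        · exact hq (Or.inl ⟨s, rfl⟩)
    have h2 : wsum F T (T ∪ B)ᶜ ≤ M.e T (T ∪ B)ᶜ := wsum_mono hF.le le_rfl le_rfl
    exact Nat.le_zero.1 (h2.trans h1.le)
  have hTsum : wsum F T Set.univ = wsum F T T + wsum F T B := by
    rw [← wsum_add_compl T (T ∪ B), hTrest, wsum_union_right hTB, add_zero]
  have hTeven := even_wsum_self hF.symm (fun x => by have := hF.le x x; rw [M.loopless] at this; omega) T
  rw [Nat.even_iff] at hTeven
  rw [hF.sum_at, hT3, if_neg huT] at hTsum
  -- All edges leaving a piece start in its class `A`, which has one vertex more than the other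
  -- class; the extra degree 2 at `u` must leave the piece too.
  have hXsum : ∀ t, wsum F (X t) B ≥ 1 + if u ∈ X t then 2 else 0 := by
    intro t
    obtain ⟨A, hA₀, hexit⟩ := h.labX t
    have hA : M.ColOn (X t) A := hA₀
    have h0 : M.e (X t \ A) (X t)ᶜ = 0 := by
      rw [e, wsum_eq_zero]
      intro x hx y hy
      by_contra hne
      exact hx.2 (hexit x hx.1 y hy hne)
    have h0' : wsum F (X t \ A) (X t)ᶜ = 0 := by
      have : wsum F (X t \ A) (X t)ᶜ ≤ M.e (X t \ A) (X t)ᶜ := wsum_mono hF.le le_rfl le_rfl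
      omega
    have h1 := hc.colOn_card hA
    have h2 := M.cut_split (X t) A
    have h3 := hA.wsum_left hF.le
    have h4 := hA.wsum_right hF.le hF.symm
    have h5 : M.cut (X t) = 3 := h.cut_fibre _
    have h6 : wsum F (X t ∩ A) (X t)ᶜ ≤ wsum F (X t) B := by
      have h7 : M.e (f ⁻¹' {NiceCubic.labX t})
          (f ⁻¹' ({NiceCubic.labX t} ∪ Set.range NiceCubic.labB)ᶜ) = 0 := by
        refine h.e_eq_zero ?_ ?_
        · exact Set.disjoint_left.2 fun x h1 h2 => h2 (Or.inl h1)
        · rintro _ rfl q hq hadj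
          rcases lab_cases q with ⟨s, rfl⟩ | ⟨s, rfl⟩ | ⟨s, rfl⟩
          · exact adj_labX_labX _ _ hadj
          · exact hq (Or.inr ⟨s, rfl⟩)
          · exact adj_labX_labT _ _ hadj
      have h8 : wsum F (X t ∩ A) (X t)ᶜ ≤ wsum F (X t) (X t)ᶜ :=
        wsum_mono (fun _ _ => le_rfl) Set.inter_subset_left le_rfl
      have h9 : (X t)ᶜ = B ∪ (X t ∪ B)ᶜ := by
        ext x
        have : x ∈ X t → x ∉ B := fun h => Set.disjoint_left.1 (hXB t) h
        simp only [Set.mem_compl_iff, Set.mem_union]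
        tauto
      have h10 : wsum F (X t) (X t)ᶜ = wsum F (X t) B + wsum F (X t) (X t ∪ B)ᶜ := by
        conv_lhs => rw [h9]
        rw [wsum_union_right]
        exact Set.disjoint_left.2 fun x h1 h2 => h2 (Or.inr h1)
      have h11 : wsum F (X t) (X t ∪ B)ᶜ ≤ M.e (X t) (X t ∪ B)ᶜ := wsum_mono hF.le le_rfl le_rfl
      have h12 : M.e (X t) (X t ∪ B)ᶜ = 0 := h7
      omega
    rw [hF.sum_at] at h3 h4
    by_cases huX : u ∈ X t <;> by_cases huA : u ∈ A <;>
      simp only [Set.mem_inter_iff, Set.mem_sdiff, huX, huA, and_true, and_false,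
        if_true, if_false, not_true_eq_false, not_false_eq_true] at h3 h4 ⊢ <;> omega
  have hBsum : wsum F B T + (wsum F B (X 0) + wsum F B (X 1)) ≤ wsum F B Set.univ := by
    rw [← wsum_union_right (hXX 0 1 (by decide)), ← wsum_union_right]
    · exact wsum_mono (fun _ _ => le_rfl) le_rfl (Set.subset_univ _)
    · exact (Set.disjoint_union_right.2 ⟨(hXT 0).symm, (hXT 1).symm⟩)
  rw [hF.sum_at, hB3, if_neg huB, wsum_comm hF.symm, wsum_comm hF.symm B, wsum_comm hF.symm B] at hBsum
  have h0 := hXsum 0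
  have h1 := hXsum 1
  have hus : (u ∈ X 0) ∨ (u ∈ X 1) := by
    have : u ∈ X s := hu
    fin_cases s
    · exact Or.inl this
    · exact Or.inr this
  rcases hus with h' | h'
  · rw [if_pos h'] at h0
    omega
  · rw [if_pos h'] at h1
    omega

/-- At most six vertices are nice. -/
lemma IsShape.niceNum_le (hc : M.Cubic) {f : V → K33TriangleVertex} (h : M.IsShape f) :
    M.niceNum ≤ (f ⁻¹' (Set.range NiceCubic.labB ∪ Set.range NiceCubic.labT)).ncard ∧
      (f ⁻¹' (Set.range NiceCubic.labB ∪ Set.range NiceCubic.labT)).ncard = 6 := by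
  constructor
  · refine Set.ncard_le_ncard (fun v hv => ?_) (Set.toFinite _)
    rcases lab_cases (f v) with ⟨s, hs⟩ | ⟨s, hs⟩ | ⟨s, hs⟩
    · exact absurd hv (h.not_nice hc hs)
    · exact Or.inl ⟨s, hs.symm⟩
    · exact Or.inr ⟨s, hs.symm⟩
  · rw [Set.preimage_union, Set.ncard_union_eq, card_range (fun _ _ => labB_inj.1) h.labB,
      card_range (fun _ _ => labT_inj.1) h.labT]
    exact Set.disjoint_left.2 fun x ⟨i, hi⟩ ⟨j, hj⟩ => labB_ne_labT (hi.trans hj.symm)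

/-- With six nice vertices, these are exactly the vertices over `labB` and `labT`. In the induction
this locates a contraction vertex that is not nice. -/
lemma IsShape.not_nice_iff (hc : M.Cubic) {f : V → K33TriangleVertex} (h : M.IsShape f)
    (h6 : 6 ≤ M.niceNum) {u : V} (hu : ¬ M.Nice u) : ∃ s, f u = NiceCubic.labX s := by
  obtain ⟨h1, h2⟩ := h.niceNum_le hc
  have hsub : {v | M.Nice v} ⊆ f ⁻¹' (Set.range NiceCubic.labB ∪ Set.range NiceCubic.labT) := by
    intro v hv
    rcases lab_cases (f v) with ⟨s, hs⟩ | ⟨s, hs⟩ | ⟨s, hs⟩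
    · exact absurd hv (h.not_nice hc hs)
    · exact Or.inl ⟨s, hs.symm⟩
    · exact Or.inr ⟨s, hs.symm⟩
  have heq := Set.eq_of_subset_of_ncard_le hsub (by rw [h2]; exact h6) (Set.toFinite _)
  rcases lab_cases (f u) with ⟨s, hs⟩ | ⟨s, hs⟩ | ⟨s, hs⟩
  · exact ⟨s, hs⟩
  · have : u ∈ {v | M.Nice v} := by rw [heq]; exact Or.inl ⟨s, hs.symm⟩
    exact absurd this hu
  · have : u ∈ {v | M.Nice v} := by rw [heq]; exact Or.inr ⟨s, hs.symm⟩
    exact absurd this hu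

lemma quot_comp {P : Type v} {Q : Type w} [Fintype P] (f : V → P) (g : P → Q) :
    (M.quot f).quot g = M.quot (g ∘ f) := by
  refine ext_m fun p q => ?_
  by_cases hpq : p = q
  · subst hpq; rw [MG.loopless, MG.loopless]
  · rw [quot_m _ hpq, quot_m _ hpq, quot_e]
    · rfl
    · exact Set.disjoint_left.2 fun x h1 h2 => hpq (h1.symm.trans h2)

lemma pr_preimage_singleton_of {C : Set V} {Y : Set (Option C)} {p : Option C} (hp : p ≠ none)
    (hY : Y = {p}) : ∃ v, pr C ⁻¹' Y = {v} := by
  rcases p with _ | a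
  · exact absurd rfl hp
  · exact ⟨a, by rw [hY, pr_preimage_some]⟩

/-- Only the piece containing `none` grows. Its leaving edges still start in one colour class
because `exists_pull_colour` gives the outer ends of the cut edges the colour of `none`. -/
lemma IsShape.of_contract {C : Set V} (hH : (M.contract Cᶜ).Bip) {f : Option C → K33TriangleVertex}
    (h : (M.contract C).IsShape f) {s₀ : Fin 2} (hs : f none = NiceCubic.labX s₀) :
    M.IsShape (f ∘ pr C) := by
  refine ⟨?_, ?_, ?_, ?_⟩
  · intro p q
    rw [← h.quot, contract, quot_comp]
  · intro j
    obtain ⟨v, hv⟩ := h.labB j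
    refine pr_preimage_singleton_of (Y := f ⁻¹' {NiceCubic.labB j}) (p := v) ?_ hv
    rintro rfl
    have : none ∈ f ⁻¹' {NiceCubic.labB j} := by rw [hv]; rfl
    exact labX_ne_labB (hs.symm.trans this)
  · intro j
    obtain ⟨v, hv⟩ := h.labT j
    refine pr_preimage_singleton_of (Y := f ⁻¹' {NiceCubic.labT j}) (p := v) ?_ hv
    rintro rfl
    have : none ∈ f ⁻¹' {NiceCubic.labT j} := by rw [hv]; rfl
    exact labX_ne_labT (hs.symm.trans this)
  · intro s
    obtain ⟨A, hA, hexit⟩ := h.labX s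
    obtain ⟨A', h1, h2, h3⟩ := exists_pull_colour hH A
    refine ⟨A', hA.pull h1 h2 h3, ?_⟩
    intro x hx y hy hxy
    have hx' : f (pr C x) = NiceCubic.labX s := hx
    have hy' : f (pr C y) ≠ NiceCubic.labX s := hy
    by_cases hxC : x ∈ C
    · rw [h1 x hxC]
      refine hexit _ hx' (pr C y) hy' ?_
      by_cases hyC : y ∈ C
      · rwa [contract_m hxC hyC]
      · rw [pr_of_notMem hyC]; exact contract_ne_zero hxC hyC hxy
    · have hyC : y ∈ C := by
        by_contra hyC
        rw [pr_of_notMem hxC] at hx'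
        rw [pr_of_notMem hyC] at hy'
        exact hy' hx'
      rw [h3 x hxC y hyC hxy]
      rw [pr_of_notMem hxC] at hx'
      refine hexit _ hx' (pr C y) hy' ?_
      rw [MG.symm]
      exact contract_ne_zero hyC hxC (by rwa [M.symm])

end MG
end NiceCubic

/-! ### Without 2-edge cuts: at least six nice vertices, and the structure for exactly six. -/

namespace NiceCubic
namespace MG
variable {V : Type u} [Fintype V] {M : MG V}

lemma e_pair {x y : V} (h : x ≠ y) : M.e {x, y} {x, y} = 2 * M.m x y := by
  rw [e, wsum_insert_left (by simpa using h), wsum_insert_right (by simpa using h),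
    wsum_insert_right (by simpa using h)]
  simp only [wsum_singleton, M.loopless, M.symm y x]; omega

/-- The pair has cut size 6 minus twice the multiplicity, which must be at least 3. -/
lemma m_le_one (hc : M.Cubic) (he : M.EC 3) (h3 : 3 ≤ Fintype.card V) (x y : V) : M.m x y ≤ 1 := by
  by_cases h : x = y
  · subst h; rw [M.loopless]; omega
  · have h1 := hc.e_add_cut {x, y}
    rw [e_pair h, Set.ncard_pair h] at h1
    have h2 := he {x, y} (by simp) (by
      refine Set.nonempty_of_ncard_ne_zero ?_
      have := Set.ncard_add_ncard_compl ({x, y} : Set V)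
      rw [Set.ncard_pair h, Nat.card_eq_fintype_card] at this
      omega)
    omega

lemma complete_of_card_four (hc : M.Cubic) (he : M.EC 3) (h4 : Fintype.card V = 4) {x y : V}
    (hxy : x ≠ y) : M.m x y ≠ 0 := by
  have h1 := ncard_nbrs hc (m_le_one hc he (by omega) x)
  have h2 : {v | M.m x v ≠ 0} = {x}ᶜ := by
    refine Set.eq_of_subset_of_ncard_le ?_ ?_ (Set.toFinite _)
    · rintro v hv rfl; exact hv (M.loopless _)
    · have := Set.ncard_add_ncard_compl ({x} : Set V)
      rw [Set.ncard_singleton, Nat.card_eq_fintype_card] at this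
      omega
  have : y ∈ {v | M.m x v ≠ 0} := by rw [h2]; exact hxy.symm
  exact this

lemma Cubic.cut_insert (hc : M.Cubic) {X : Set V} {v : V} (hv : v ∉ X) :
    M.cut (insert v X) + 2 * M.e X {v} = M.cut X + 3 := by
  have h1 := hc.e_add_cut X
  have h2 := hc.e_add_cut (insert v X)
  rw [e, wsum_insert_left hv, wsum_insert_right hv, wsum_insert_right hv, wsum_singleton, M.loopless,
    wsum_comm M.symm {v} X, Set.ncard_insert_of_notMem hv] at h2
  simp only [e, cut] at *
  omega

lemma Bad.of_three (hc : M.Cubic) (he : M.EC 3) {A : Set V} (hA : M.ColOn Set.univ A) {c : V} {X : Set V}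
    (h : M.Bad A c X) : M.cut X = 3 ∧ M.e (X \ A) Xᶜ = 0 := by
  have := he X h.1 ⟨c, h.2.1⟩
  rcases h.cases hc hA with h | h
  · omega
  · exact ⟨h.1, h.2.2⟩

/-- All edges leaving a bad set now start in `A`, so no bad set contains a neighbour of `c`. This
gives at least three good vertices. -/
lemma nbrs_subset_good (hc : M.Cubic) (he : M.EC 3) {A : Set V} (hA : M.ColOn Set.univ A) {c : V}
    (hcA : c ∈ A) : {q | M.m c q ≠ 0} ⊆ {b | b ∉ A ∧ ∀ Y, M.Bad A c Y → b ∉ Y} := by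
  intro q hq
  have hqA : q ∉ A := (hA c trivial q trivial hq).1 hcA
  refine ⟨hqA, fun Y hY hqY => ?_⟩
  have h1 := (hY.of_three hc he hA).2
  rw [e, wsum_eq_zero] at h1
  exact hq (by rw [M.symm]; exact h1 q ⟨hqY, hqA⟩ c hY.2.1)

lemma contract_ne_zero' {C : Set V} {x y : V} (hx : x ∈ C) (h : M.m x y ≠ 0) :
    (M.contract C).m (pr C x) (pr C y) ≠ 0 := by
  by_cases hy : y ∈ C
  · rwa [contract_m hx hy]
  · rw [pr_of_notMem hy]; exact contract_ne_zero hx hy h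

lemma pr_inj {C : Set V} {x y : V} (hx : x ∈ C) (h : pr C x = pr C y) : x = y := by
  by_cases hy : y ∈ C
  · rw [pr_of_mem hx, pr_of_mem hy] at h
    simpa using h
  · rw [pr_of_mem hx, pr_of_notMem hy] at h
    simp at h

/-- Here `C` is a triangle and the good vertices are exactly its three outer neighbours. The
remaining vertices form two maximal bad sets, which become the two expanded vertices of `K₃,₃^△`. -/
lemma exists_shape (hc : M.Cubic) (he : M.EC 3) {C : Set V} (hC : M.cut C = 3) (hC3 : C.ncard = 3)
    (hC2 : 2 ≤ Cᶜ.ncard) {A : Set (Option (Cᶜ : Set V))}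
    (hA : (M.contract Cᶜ).ColOn Set.univ A) (hcA : none ∈ A)
    (hgood : {b | b ∉ A ∧ ∀ Y, (M.contract Cᶜ).Bad A none Y → b ∉ Y}.ncard = 3) :
    ∃ f, M.IsShape f := by
  classical
  have hne : C.Nonempty := Set.nonempty_of_ncard_ne_zero (by omega)
  have hne' : Cᶜ.Nonempty := Set.nonempty_of_ncard_ne_zero (by omega)
  have hC' : M.cut Cᶜ = 3 := by rw [cut_compl, hC]
  have hKc := contract_cubic hc hC
  have hKe := contract_EC he hne'
  have hHc := contract_cubic hc hC'
  have hHe := contract_EC he (C := Cᶜ) (by rwa [compl_compl])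
  set H := M.contract Cᶜ with hH
  have hH1 := m_le_one hHc hHe (by rw [card_option_coe]; omega)
  set S := {b | b ∉ A ∧ ∀ Y, H.Bad A none Y → b ∉ Y} with hS
  have hNS : {q | H.m none q ≠ 0} = S :=
    Set.eq_of_subset_of_ncard_le (nbrs_subset_good hHc hHe hA hcA)
      (by rw [hgood, ncard_nbrs hHc (hH1 none)]) (Set.toFinite _)
  obtain ⟨ι, _, X, hX, hXd, hmax, hcard⟩ := exists_max_bad hHc (hHe.mono (by norm_num)) hA hcA
  -- All maximal bad sets have cut size 3, so the count reads `3 + 2|ι| = 1 + 3|ι|`.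
  have hι : Fintype.card ι = 2 := by
    rw [Finset.sum_congr rfl fun i _ => ((hX i).of_three hHc hHe hA).1] at hcard
    change S.ncard + _ = _ at hcard
    simp only [Finset.sum_const, Finset.card_univ, smul_eq_mul] at hcard
    omega
  let ε : Fin 2 ≃ ι := (Fintype.equivFinOfCardEq hι).symm
  obtain ⟨τ⟩ : Nonempty (Fin 3 ≃ C) := by
    have h1 : Nat.card C = 3 := by rw [Nat.card_coe_set_eq, hC3]
    exact ⟨(Finite.equivFinOfCardEq h1).symm⟩
  have hb : ∀ i : Fin 3, ∃ w, w ∉ C ∧ M.m (τ i) w ≠ 0 := by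
    intro i
    have h1 := complete_of_card_four hKc hKe (by rw [card_option_coe]; omega)
      (x := pr C (τ i)) (y := none) (by simp)
    rw [contract_none (τ i).2, ← Nat.pos_iff_ne_zero, wsum_pos] at h1
    obtain ⟨_, rfl, w, hw, h⟩ := h1
    exact ⟨w, hw, by omega⟩
  choose b hbC hb using hb
  have hbinj : Function.Injective b := by
    intro i j hij
    by_contra hne
    have h1 := hH1 none (pr Cᶜ (b i))
    rw [hH, contract_none_left (C := Cᶜ) (hbC i), compl_compl] at h1
    have hτ : (τ i : V) ≠ τ j := fun h => hne (τ.injective (Subtype.ext h))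
    have h2 : M.e {b i} {(τ i : V), (τ j : V)} ≤ M.e {b i} C := by
      refine wsum_mono (fun _ _ => le_rfl) le_rfl ?_
      rintro x (rfl | rfl)
      · exact (τ i).2
      · exact (τ j).2
    rw [e, wsum_insert_right (by simpa using hτ), wsum_singleton, wsum_singleton, M.symm] at h2
    have h3 := hb i
    have h4 := hb j
    rw [← hij, M.symm] at h4
    omega
  have hbS : ∀ i, pr Cᶜ (b i) ∈ S := by
    intro i
    rw [← hNS]
    show H.m none _ ≠ 0
    rw [H.symm]
    exact contract_ne_zero (C := Cᶜ) (hbC i) (y := τ i) (by simp) (by rw [M.symm]; exact hb i)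
  have hpbinj : Function.Injective fun i => pr Cᶜ (b i) := fun i j h =>
    hbinj (pr_inj (C := Cᶜ) (hbC i) h)
  have hSb : S = ⋃ i, {pr Cᶜ (b i)} := by
    symm
    refine Set.eq_of_subset_of_ncard_le ?_ ?_ (Set.toFinite _)
    · rintro q hq
      obtain ⟨i, rfl⟩ := Set.mem_iUnion.1 hq
      exact hbS i
    · rw [hgood, ncard_iUnion_inter]
      · simp
      · intro i j hij
        simpa using fun h => hij (hpbinj h)
  have hXC : ∀ s v, pr Cᶜ v ∈ X (ε s) → v ∉ C := by
    intro s v hv hvC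
    rw [pr_of_notMem (by simpa using hvC)] at hv
    exact (hX _).2.1 hv
  have hlab : ∀ v, ∃! p : K33TriangleVertex, (∃ s, p = NiceCubic.labX s ∧ pr Cᶜ v ∈ X (ε s)) ∨
      (∃ j, p = NiceCubic.labB j ∧ v = b j) ∨ ∃ j, p = NiceCubic.labT j ∧ v = τ j := by
    intro v
    by_cases hv : v ∈ C
    · refine ⟨NiceCubic.labT (τ.symm ⟨v, hv⟩), Or.inr (Or.inr ⟨_, rfl, by simp⟩), ?_⟩
      rintro p (⟨s, rfl, hs⟩ | ⟨j, rfl, rfl⟩ | ⟨j, rfl, rfl⟩)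
      · exact absurd hv (hXC s v hs)
      · exact absurd hv (hbC j)
      · simp
    · by_cases hq : ∃ s, pr Cᶜ v ∈ X (ε s)
      · obtain ⟨s, hs⟩ := hq
        refine ⟨NiceCubic.labX s, Or.inl ⟨s, rfl, hs⟩, ?_⟩
        rintro p (⟨r, rfl, hr⟩ | ⟨j, rfl, rfl⟩ | ⟨j, rfl, rfl⟩)
        · congr 1
          by_contra hne
          exact Set.disjoint_left.1 (hXd (fun h => hne (ε.injective h))) hr hs
        · exact absurd hs ((hbS j).2 _ (hX _))
        · exact absurd (τ j).2 hv
      · have hqS : pr Cᶜ v ∈ S := by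
          have hno : ∀ Y, H.Bad A none Y → pr Cᶜ v ∉ Y := by
            intro Y hY hvY
            obtain ⟨i, hi⟩ := hmax Y hY
            exact hq ⟨ε.symm i, by simpa using hi hvY⟩
          refine ⟨fun hvA => ?_, hno⟩
          exact hno _ (bad_singleton hvA (by rw [Ne, pr_eq_none]; simpa using hv)) rfl
        rw [hSb, Set.mem_iUnion] at hqS
        obtain ⟨j, hj⟩ := hqS
        have hvb : v = b j := pr_inj (C := Cᶜ) hv hj
        refine ⟨NiceCubic.labB j, Or.inr (Or.inl ⟨j, rfl, hvb⟩), ?_⟩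
        rintro p (⟨r, rfl, hr⟩ | ⟨i, rfl, hi⟩ | ⟨i, rfl, rfl⟩)
        · exact absurd ⟨r, hr⟩ hq
        · rw [hbinj (hvb.symm.trans hi)]
        · exact absurd (τ i).2 hv
  choose f hf hf' using hlab
  have hfX : ∀ s, f ⁻¹' {NiceCubic.labX s} = pr Cᶜ ⁻¹' X (ε s) := by
    intro s; ext v
    refine ⟨fun h => ?_, fun h => ?_⟩
    · have h1 : f v = NiceCubic.labX s := h
      rcases hf v with ⟨r, h2, h3⟩ | ⟨j, h2, -⟩ | ⟨j, h2, -⟩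
      · rw [h1, labX_inj] at h2; rw [h2]; exact h3
      · exact absurd (h1.symm.trans h2) labX_ne_labB
      · exact absurd (h1.symm.trans h2) labX_ne_labT
    · exact (hf' v _ (Or.inl ⟨s, rfl, h⟩)).symm
  have hfB : ∀ s, f ⁻¹' {NiceCubic.labB s} = {b s} := by
    intro s; ext v
    refine ⟨fun h => ?_, fun h => ?_⟩
    · have h1 : f v = NiceCubic.labB s := h
      rcases hf v with ⟨r, h2, h3⟩ | ⟨j, h2, h3⟩ | ⟨j, h2, -⟩
      · exact absurd (h1.symm.trans h2) labX_ne_labB.symm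
      · rw [h1, labB_inj] at h2; rw [h2]; exact h3
      · exact absurd (h1.symm.trans h2) labB_ne_labT
    · exact (hf' v _ (Or.inr (Or.inl ⟨s, rfl, h⟩))).symm
  have hfT : ∀ s, f ⁻¹' {NiceCubic.labT s} = {(τ s : V)} := by
    intro s; ext v
    refine ⟨fun h => ?_, fun h => ?_⟩
    · have h1 : f v = NiceCubic.labT s := h
      rcases hf v with ⟨r, h2, h3⟩ | ⟨j, h2, h3⟩ | ⟨j, h2, h3⟩
      · exact absurd (h1.symm.trans h2) labX_ne_labT.symm
      · exact absurd (h1.symm.trans h2) labB_ne_labT.symm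
      · rw [h1, labT_inj] at h2; rw [h2]; exact h3
    · exact (hf' v _ (Or.inr (Or.inr ⟨s, rfl, h⟩))).symm
  have hexit : ∀ i, ∀ x ∈ X i, ∀ y ∉ X i, H.m x y ≠ 0 → x ∈ A := by
    intro i x hx y hy hxy
    by_contra hxA
    have h1 := ((hX i).of_three hHc hHe hA).2
    rw [e, wsum_eq_zero] at h1
    exact hxy (h1 x ⟨hx, hxA⟩ y hy)
  -- A bad set sends at most one edge to each `b j`, since adding `b j` must not create a 2-edge
  -- cut. Its three leaving edges end outside `A`, so not in another maximal bad set, whose leaving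
  -- edges start in `A`; hence they end in `S`, one at each `b j`.
  have hXb : ∀ i j, H.e (X i) {pr Cᶜ (b j)} ≠ 0 := by
    intro i
    have hle : ∀ j, H.e (X i) {pr Cᶜ (b j)} ≤ 1 := by
      intro j
      have h1 := hHc.cut_insert ((hbS j).2 _ (hX i))
      have h2 := hHe (insert (pr Cᶜ (b j)) (X i)) (by simp) ⟨none, by
        rintro (h | h)
        · exact hbC j (by simpa using pr_eq_none.1 h.symm)
        · exact (hX i).2.1 h⟩
      rw [((hX i).of_three hHc hHe hA).1] at h1
      omega
    have hSX : S ⊆ (X i)ᶜ := fun q hq hqX => hq.2 _ (hX i) hqX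
    have h0 : H.e (X i) ((X i)ᶜ \ S) = 0 := by
      rw [e, wsum_eq_zero]
      rintro x hx y ⟨hy, hyS⟩
      by_contra hxy
      have hxA := hexit i x hx y hy hxy
      have hyA : y ∉ A := (hA x trivial y trivial hxy).1 hxA
      refine hyS ⟨hyA, fun Y hY hyY => ?_⟩
      obtain ⟨k, hk⟩ := hmax Y hY
      refine hyA (hexit k y (hk hyY) x ?_ (by rwa [H.symm]))
      intro hxk
      by_cases hik : i = k
      · exact hy (hik ▸ hk hyY)
      · exact Set.disjoint_left.1 (hXd hik) hx hxk
    have h1 : H.cut (X i) = H.e (X i) S := by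
      rw [cut, ← Set.union_sdiff_cancel hSX, wsum_union_right Set.disjoint_sdiff_right]
      rw [e] at h0
      rw [h0, add_zero]
    rw [((hX i).of_three hHc hHe hA).1, hSb, e_comm, e, wsum_iUnion_left, Fin.sum_univ_three] at h1
    · have hl0 := hle 0
      have hl1 := hle 1
      have hl2 := hle 2
      rw [e_comm, e] at hl0 hl1 hl2
      intro j
      rw [e_comm, e]
      fin_cases j <;> simp only [Fin.zero_eta, Fin.mk_one, Fin.reduceFinMk] <;> omega
    · intro i j hij
      simpa using fun h => hij (hpbinj h)
  have hquotc : (M.quot f).Cubic := by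
    refine quot_cubic f fun p => ?_
    rcases lab_cases p with ⟨s, rfl⟩ | ⟨s, rfl⟩ | ⟨s, rfl⟩
    · rw [hfX, ← quot_cut]; exact ((hX _).of_three hHc hHe hA).1
    · rw [hfB, hc.cut_singleton]
    · rw [hfT, hc.cut_singleton]
  have hXB : ∀ s j, (M.quot f).m (NiceCubic.labX s) (NiceCubic.labB j) ≠ 0 := by
    intro s j
    rw [quot_m f labX_ne_labB, hfX, hfB]
    have h1 := hXb (ε s) j
    rw [hH, quot_e] at h1
    · have h2 : pr Cᶜ ⁻¹' {pr Cᶜ (b j)} = {b j} := by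
        rw [pr_of_mem (C := Cᶜ) (hbC j), pr_preimage_some]
      rwa [h2] at h1
    · rw [Set.disjoint_singleton_right]
      exact (hbS j).2 _ (hX _)
  have hTB : ∀ j, (M.quot f).m (NiceCubic.labT j) (NiceCubic.labB j) ≠ 0 := by
    intro j
    rw [quot_m f labB_ne_labT.symm, hfT, hfB, e, wsum_singleton]
    exact hb j
  have hTT : ∀ i j, i ≠ j → (M.quot f).m (NiceCubic.labT i) (NiceCubic.labT j) ≠ 0 := by
    intro i j hij
    rw [quot_m f (by rwa [Ne, labT_inj]), hfT, hfT, e, wsum_singleton,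
      ← contract_m (τ i).2 (τ j).2]
    refine complete_of_card_four hKc hKe (by rw [card_option_coe]; omega) ?_
    simpa using hij
  -- Containment is enough, as both multigraphs are cubic.
  have hle : ∀ p q, (ofGraph K33Triangle).m p q ≤ (M.quot f).m p q := by
    intro p q
    simp only [ofGraph]
    split_ifs with hadj
    · rw [Nat.one_le_iff_ne_zero]
      rcases lab_cases p with ⟨s, rfl⟩ | ⟨s, rfl⟩ | ⟨s, rfl⟩ <;>
        rcases lab_cases q with ⟨r, rfl⟩ | ⟨r, rfl⟩ | ⟨r, rfl⟩
      · exact absurd hadj (adj_labX_labX _ _)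
      · exact hXB _ _
      · exact absurd hadj (adj_labX_labT _ _)
      · rw [MG.symm]; exact hXB _ _
      · exact absurd hadj (adj_labB_labB _ _)
      · rw [(adj_labB_labT _ _).1 hadj, MG.symm]; exact hTB _
      · exact absurd hadj.symm (adj_labX_labT _ _)
      · rw [(adj_labB_labT _ _).1 hadj.symm]; exact hTB _
      · exact hTT _ _ ((adj_labT_labT _ _).1 hadj)
    · exact Nat.zero_le _
  refine ⟨f, fun p q => ?_, fun j => ⟨_, hfB j⟩, fun j => ⟨_, hfT j⟩, fun s => ?_⟩
  · exact ((Finset.sum_eq_sum_iff_of_le fun i _ => hle p i).1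
      ((K33Triangle_cubic p).trans (hquotc p).symm) q (Finset.mem_univ q)).symm
  · refine ⟨pr Cᶜ ⁻¹' A, ?_, ?_⟩
    · rw [hfX]
      exact (hA.mono (Set.subset_univ (X (ε s)))).of_contract (hX _).2.1
    · intro x hx y hy hxy
      have hx' : x ∈ f ⁻¹' {NiceCubic.labX s} := hx
      have hy' : y ∉ f ⁻¹' {NiceCubic.labX s} := hy
      rw [hfX] at hx' hy'
      exact hexit _ _ hx' _ hy' (contract_ne_zero' (C := Cᶜ) (hXC s x hx') hxy)

/-- With more than four vertices and no `2`-edge cuts, there are at least six nice vertices, with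
equality only for six vertices or for expansions of `K₃,₃^△`. -/
theorem six_le_niceNum (n : ℕ) : ∀ (V : Type u) [Fintype V] (M : MG V), Fintype.card V = n →
    M.Cubic → M.EC 3 → ¬ M.Bip → Fintype.card V ≠ 4 →
    6 ≤ M.niceNum ∧ (M.niceNum = 6 → Fintype.card V = 6 ∨ ∃ f, M.IsShape f) := by
  induction n using Nat.strong_induction_on with
  | _ n ih =>
  intro V _ M hn hc he hb h4
  have he2 : M.EC 2 := he.mono (by norm_num)
  by_cases hall : ∀ v, M.Nice v
  · rw [niceNum_eq_card hall]
    have h1 := four_le_card hc hb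
    have h2 := hc.even_card
    rw [Nat.even_iff] at h2
    exact ⟨by omega, Or.inl⟩
  have hnall := hall
  push Not at hall
  obtain ⟨u, hu⟩ := hall
  obtain ⟨C, hC, hC1, hC2, hK⟩ := exists_nonbip_cut hc he2 hb hu
  have hne : C.Nonempty := Set.nonempty_of_ncard_ne_zero (by omega)
  have hne' : Cᶜ.Nonempty := Set.nonempty_of_ncard_ne_zero (by omega)
  have hC' : M.cut Cᶜ = 3 := by rw [cut_compl, hC]
  have hKc := contract_cubic hc hC
  have hKe := contract_EC he hne'
  have hHc := contract_cubic hc hC'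
  have hHe := contract_EC he (C := Cᶜ) (by rwa [compl_compl])
  have hHe2 : (M.contract Cᶜ).EC 2 := hHe.mono (by norm_num)
  have hKe2 : (M.contract C).EC 2 := hKe.mono (by norm_num)
  have ihK := ih _ (by rw [← hn]; exact card_contract_lt hC2) _ (M.contract C) rfl hKc hKe hK
  obtain ⟨hK4, -⟩ := four_le_niceNum _ _ (M.contract C) rfl hKc hKe2 hK
  have hsplit := M.niceNum_split C
  have hcardK := card_option_coe C
  have hcardH := card_option_coe Cᶜ
  have hcardV := Set.ncard_add_ncard_compl C
  rw [Nat.card_eq_fintype_card] at hcardV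
  have hle1 := niceNum_le_inter_add_one hc he2 hC hne
  by_cases hH : (M.contract Cᶜ).Bip
  · by_cases hnone : (M.contract C).Nice none
    · obtain ⟨A, hA, hcA⟩ := hH.exists_colour none
      have hgood := ncard_good_le hc he2 hC hne hnone hA hcA
      have hnbr := Set.ncard_le_ncard (nbrs_subset_good hHc hHe hA hcA) (Set.toFinite _)
      rw [ncard_nbrs hHc (m_le_one hHc hHe (by omega) none)] at hnbr
      -- With four vertices in the non-bipartite contraction the count is at least `3 + 3`, and
      -- equality means exactly three good vertices. Otherwise it is at least `5 + 3`.
      by_cases hcK : Fintype.card (Option C) = 4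
      · refine ⟨by omega, fun h6 => Or.inr ?_⟩
        exact exists_shape hc he hC (by omega) hC2 hA hcA (by omega)
      · have := (ihK hcK).1
        exact ⟨by omega, fun h6 => by omega⟩
    · have hle := niceNum_le_inter hc he2 hC hne hnone
      -- A contraction with four vertices has only nice vertices, contrary to the choice of case.
      -- The same argument excludes six vertices when there are just six nice ones.
      have hcK : Fintype.card (Option C) ≠ 4 := fun h4 => hnone (nice_of_card_le (by omega) _)
      obtain ⟨ihK1, ihK2⟩ := ihK hcK
      refine ⟨by omega, fun h6 => Or.inr ?_⟩
      rcases ihK2 (by omega) with h | ⟨f, hf⟩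
      · exact absurd (nice_of_card_le (by omega) _) hnone
      · obtain ⟨s, hs⟩ := hf.not_nice_iff hKc ihK1 hnone
        exact ⟨_, hf.of_contract hH hs⟩
  · have ihH := ih _ (by rw [← hn]; exact card_contract_lt (C := Cᶜ) (by rwa [compl_compl])) _
      (M.contract Cᶜ) rfl hHc hHe hH
    obtain ⟨hH4, -⟩ := four_le_niceNum _ _ (M.contract Cᶜ) rfl hHc hHe2 hH
    have hle2 := niceNum_le_inter_add_one hc he2 hC' hne'
    -- If both contractions have four vertices, then `M` has six and all of them are nice, which was
    -- excluded. Otherwise at least `5 + 3` vertices are nice.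
    by_cases hcK : Fintype.card (Option C) = 4
    · by_cases hcH : Fintype.card (Option (Cᶜ : Set V)) = 4
      · exact absurd (nice_of_card_le (M := M) (by omega)) hnall
      · have := (ihH hcH).1
        exact ⟨by omega, fun h6 => by omega⟩
    · have := (ihK hcK).1
      exact ⟨by omega, fun h6 => by omega⟩

end MG
end NiceCubic

/-! ### Passage between simple graphs and multigraphs. -/

namespace NiceCubic
variable {V : Type u} [Fintype V] {G : SimpleGraph V}

lemma ofGraph_adj {V : Type u} {G : SimpleGraph V} {x y : V} (h : G.Adj x y) : (ofGraph G).m x y = 1 := by simp [ofGraph, h]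
lemma ofGraph_not_adj {V : Type u} {G : SimpleGraph V} {x y : V} (h : ¬ G.Adj x y) : (ofGraph G).m x y = 0 := by simp [ofGraph, h]
lemma ofGraph_le_one {V : Type u} {G : SimpleGraph V} (x y : V) : (ofGraph G).m x y ≤ 1 := by
  simp only [ofGraph]; split_ifs <;> simp

lemma sum_ofGraph (x : V) : ∑ y, (ofGraph G).m x y = deg G x := by
  classical
  rw [deg, Set.ncard_eq_toFinset_card', Finset.card_eq_sum_ones, ← Finset.sum_filter_add_sum_filter_not
    Finset.univ (fun y => G.Adj x y)]
  rw [Finset.sum_congr rfl fun y hy => ofGraph_adj (Finset.mem_filter.1 hy).2,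
    Finset.sum_congr rfl fun y hy => ofGraph_not_adj (Finset.mem_filter.1 hy).2]
  simp only [Finset.sum_const_zero, add_zero]
  refine Finset.sum_congr ?_ fun _ _ => rfl
  ext; simp

lemma ofGraph_cubic : (ofGraph G).Cubic ↔ IsCubic G := by
  simp only [MG.Cubic, IsCubic, sum_ofGraph]

lemma ofGraph_bip : (ofGraph G).Bip ↔ G.IsBipartite := by
  constructor
  · rintro ⟨A, hA⟩
    classical
    refine ⟨SimpleGraph.Coloring.mk (fun v => if v ∈ A then 0 else 1) fun {v w} h => ?_⟩
    have := hA v trivial w trivial (ofGraph_ne_zero.2 h)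
    by_cases hv : v ∈ A
    · simp [hv, this.1 hv]
    · have hw : w ∈ A := by by_contra hw; exact hv (this.2 hw)
      simp [hv, hw]
  · rintro ⟨c⟩
    refine ⟨{v | c v = 0}, fun v _ w _ h => ?_⟩
    have := c.valid (ofGraph_ne_zero.1 h)
    simp only [Set.mem_ofPred_eq]
    omega

/-- Degree 3 at `x` puts all edges at `x` into the factor and saturates the neighbours, so the rest
is a perfect matching outside the closed neighbourhood. -/
lemma isNice_iff (hc : IsCubic G) (x : V) : IsNice G x ↔ (ofGraph G).Nice x := by
  classical
  unfold IsNice IsNiceSubgraph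
  set B : Set V := ((⊤ : G.Subgraph).induce (insert x (G.neighborSet x))).verts with hB
  have hBmem : ∀ v, v ∈ B ↔ v = x ∨ G.Adj x v := by
    intro v; simp [hB]
  constructor
  · rintro ⟨N, hN⟩
    refine ⟨fun a b => if (∃ (ha : a ∈ Bᶜ) (hb : b ∈ Bᶜ), N.Adj ⟨a, ha⟩ ⟨b, hb⟩) ∨
      ((a = x ∨ b = x) ∧ G.Adj a b) then 1 else 0, ?_, ?_, ?_⟩
    · intro a b
      have h1 : (∃ (ha : a ∈ Bᶜ) (hb : b ∈ Bᶜ), N.Adj ⟨a, ha⟩ ⟨b, hb⟩) ↔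
          ∃ (hb : b ∈ Bᶜ) (ha : a ∈ Bᶜ), N.Adj ⟨b, hb⟩ ⟨a, ha⟩ :=
        ⟨fun ⟨h1, h2, h3⟩ => ⟨h2, h1, h3.symm⟩, fun ⟨h1, h2, h3⟩ => ⟨h2, h1, h3.symm⟩⟩
      simp only [h1, G.adj_comm a b, or_comm (a := a = x)]
    · intro a b
      show (if _ then 1 else 0) ≤ _
      split_ifs with h
      · refine Nat.one_le_iff_ne_zero.2 (ofGraph_ne_zero.2 ?_)
        rcases h with ⟨h1, h2, h3⟩ | ⟨_, h⟩
        · exact h3.adj_sub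
        · exact h
      · exact Nat.zero_le _
    · intro a
      by_cases hax : a = x
      · rw [if_pos hax, ← hc x, ← sum_ofGraph]
        refine Finset.sum_congr rfl fun b _ => ?_
        simp only [ofGraph]
        have : ¬ (∃ (ha : a ∈ Bᶜ) (hb : b ∈ Bᶜ), N.Adj ⟨a, ha⟩ ⟨b, hb⟩) := by
          rintro ⟨ha, _⟩
          exact ha ((hBmem a).2 (Or.inl hax))
        have h2 : a = x ∨ b = x := Or.inl hax
        simp only [this, h2, true_and, false_or]
        rw [hax]
      · rw [if_neg hax]
        by_cases haB : a ∈ B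
        · have hadj : G.Adj x a := ((hBmem a).1 haB).resolve_left hax
          rw [Finset.sum_eq_single x]
          · rw [if_pos (Or.inr ⟨Or.inr rfl, hadj.symm⟩)]
          · intro b _ hb
            refine if_neg ?_
            rintro (⟨ha, _⟩ | ⟨h | h, _⟩)
            · exact ha haB
            · exact hax h
            · exact hb h
          · simp
        · obtain ⟨⟨y, hy⟩, hxy, huniq⟩ := hN.1 (hN.2 ⟨a, haB⟩)
          rw [Finset.sum_eq_single y]
          · exact if_pos (Or.inl ⟨haB, hy, hxy⟩)
          · intro z _ hz
            refine if_neg ?_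
            rintro (⟨_, h2, h3⟩ | ⟨h | h, h2⟩)
            · exact hz (congrArg Subtype.val (huniq ⟨z, h2⟩ h3))
            · exact hax h
            · subst h; exact haB ((hBmem a).2 (Or.inr h2.symm))
          · simp
  · rintro ⟨F, hF⟩
    have hx : ∀ y, F x y = (ofGraph G).m x y := hF.eq_m (ofGraph_cubic.2 hc) (by simp)
    refine ⟨{ verts := Set.univ, Adj := fun a b => F a b ≠ 0, adj_sub := ?_, edge_vert := by simp,
              symm := ⟨fun a b h => by rw [hF.symm]; exact h⟩ }, ?_, fun v => trivial⟩
    · intro a b h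
      refine ofGraph_ne_zero.1 (fun h0 => h ?_)
      exact Nat.le_zero.1 ((hF.le a b).trans h0.le)
    · intro a _
      have hax : (a : V) ≠ x := fun h => a.2 ((hBmem _).2 (Or.inl h))
      have hdeg := hF.deg a
      rw [if_neg hax] at hdeg
      obtain ⟨b, hb⟩ : ∃ b, F a b ≠ 0 := by
        by_contra h
        push Not at h
        simp [h] at hdeg
      have hbB : b ∈ Bᶜ := by
        intro hbB
        have hab : G.Adj a b := by
          refine ofGraph_ne_zero.1 fun h0 => hb ?_
          have := hF.le a b
          omega
        rcases (hBmem b).1 hbB with rfl | hxb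
        · exact a.2 ((hBmem _).2 (Or.inr hab.symm))
        · have hbx : b ≠ x := hxb.ne'
          have h1 : F b x ≠ 0 := by rw [hF.symm, hx]; exact ofGraph_ne_zero.2 hxb
          have h2 := hF.eq_ite (by simp [hbx]) h1 a
          rw [if_neg hax] at h2
          exact hb (by rw [hF.symm]; exact h2)
      refine ⟨⟨b, hbB⟩, hb, fun c hc => ?_⟩
      have h2 := hF.eq_ite (by simp [hax]) hb c
      by_contra hne
      have hne' : (c : V) ≠ b := fun h => hne (Subtype.ext h)
      rw [if_neg hne'] at h2
      exact hc h2

lemma niceCount_eq (hc : IsCubic G) : niceCount G = (ofGraph G).niceNum := by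
  unfold niceCount MG.niceNum
  congr 1
  ext x
  exact isNice_iff hc x

lemma ncard_le_wsum {w : V → V → ℕ} {Z Y : Set V} (h : ∀ z ∈ Z, ∃ y ∈ Y, w z y ≠ 0) :
    Z.ncard ≤ wsum w Z Y := by
  induction Z, Z.toFinite using Set.Finite.induction_on with
  | empty => simp
  | @insert a s ha _ ih =>
    rw [wsum_insert_left ha, Set.ncard_insert_of_notMem ha]
    have h1 := ih fun z hz => h z (Or.inr hz)
    obtain ⟨y, hy, hay⟩ := h a (by simp)
    have h2 : 0 < wsum w {a} Y := wsum_pos.2 ⟨a, rfl, y, hy, Nat.pos_of_ne_zero hay⟩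
    omega

/-- The inner ends of a small cut form a small vertex separator, unless they fill all of `X`; then
`X` has at most two vertices and its cut has at least three edges. -/
lemma EC_of_isKConnected (hc : IsCubic G) {k : ℕ} (hk : k ≤ 3) (h : IsKConnected k G) :
    (ofGraph G).EC k := by
  intro X hX hX'
  by_contra hlt
  push Not at hlt
  have hcub := ofGraph_cubic.2 hc
  set Z : Set V := {x ∈ X | ∃ y ∉ X, G.Adj x y} with hZ
  have hZX : Z ⊆ X := fun x hx => hx.1
  have hZcard : Z.ncard ≤ (ofGraph G).cut X := by
    refine (ncard_le_wsum (Y := Xᶜ) (w := (ofGraph G).m) ?_).trans (wsum_mono (fun _ _ => le_rfl) hZX le_rfl)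
    rintro z ⟨_, y, hy, hzy⟩
    exact ⟨y, hy, ofGraph_ne_zero.2 hzy⟩
  have hXZ : X = Z := by
    by_contra hne
    obtain ⟨a, haX, haZ⟩ : ∃ a ∈ X, a ∉ Z := by
      by_contra hno
      push Not at hno
      exact hne (Set.Subset.antisymm hno hZX)
    obtain ⟨b, hb⟩ := hX'
    have hconn := h.2 Z (Set.toFinite _) (by omega)
    obtain ⟨p⟩ := hconn.preconnected ⟨a, haZ⟩ ⟨b, fun hbZ => hb (hZX hbZ)⟩
    obtain ⟨d, -, hd1, hd2⟩ := p.exists_boundary_dart {v | (v : V) ∈ X} haX hb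
    exact d.fst.2 ⟨hd1, _, hd2, d.adj⟩
  have h1 := hcub.e_add_cut X
  have h2 : X.ncard ≠ 0 := by
    rw [Ne, Set.ncard_eq_zero]; exact hX.ne_empty
  rw [← hXZ] at hZcard
  have h3 : X.ncard ≤ 2 := by omega
  have h4 : X.ncard = 1 ∨ X.ncard = 2 := by omega
  rcases h4 with h4 | h4
  · obtain ⟨x, rfl⟩ := Set.ncard_eq_one.1 h4
    rw [hcub.cut_singleton] at hlt
    omega
  · obtain ⟨x, y, hxy, rfl⟩ := Set.ncard_eq_two.1 h4
    rw [MG.e_pair hxy] at h1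
    have := ofGraph_le_one (G := G) x y
    omega

lemma connected_of_cut {V : Type u} [Nonempty V] {G : SimpleGraph V} (h : ∀ X : Set V, X.Nonempty → Xᶜ.Nonempty →
    ∃ x ∈ X, ∃ y ∉ X, G.Adj x y) : G.Connected := by
  refine ⟨fun a b => ?_⟩
  by_contra hab
  obtain ⟨x, hx, y, hy, hxy⟩ := h {v | G.Reachable a v} ⟨a, SimpleGraph.Reachable.refl a⟩ ⟨b, hab⟩
  exact hy (SimpleGraph.Reachable.trans hx hxy.reachable)

/-- Suppose `S` separates `P` from `Q`, each sending at least three edges into `S`. As degrees are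
3, `S` has two vertices and each of `P`, `Q` has cut exactly 3. Moving a vertex of `S` into `P` must
not produce a smaller cut, so it receives at most one edge from `P`, which leaves at most two edges
in the cut of `P`. -/
lemma isKConnected_three (hc : IsCubic G) (he : (ofGraph G).EC 3) (h4 : 4 ≤ Fintype.card V) :
    IsKConnected 3 G := by
  refine ⟨by rw [Nat.card_eq_fintype_card]; omega, fun S _ hS => ?_⟩
  have hcub := ofGraph_cubic.2 hc
  have hcomp := Set.ncard_add_ncard_compl S
  rw [Nat.card_eq_fintype_card] at hcomp
  have hne : Sᶜ.Nonempty := Set.nonempty_of_ncard_ne_zero (by omega)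
  have : Nonempty ↑Sᶜ := hne.to_subtype
  refine connected_of_cut fun X₀ hX₀ hX₀' => ?_
  by_contra hno
  push Not at hno
  set P : Set V := Subtype.val '' X₀ with hP
  set Q : Set V := Subtype.val '' X₀ᶜ with hQ
  have hPQ : (ofGraph G).e P Q = 0 := by
    rw [MG.e, wsum_eq_zero]
    rintro _ ⟨x, hx, rfl⟩ _ ⟨y, hy, rfl⟩
    exact ofGraph_not_adj (hno x hx y hy)
  have hPS : Disjoint P S := Set.disjoint_left.2 (by rintro _ ⟨x, _, rfl⟩ h; exact x.2 h)
  have hQS : Disjoint Q S := Set.disjoint_left.2 (by rintro _ ⟨x, _, rfl⟩ h; exact x.2 h)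
  have hPQd : Disjoint P Q := by
    rw [hP, hQ, Set.disjoint_image_iff Subtype.val_injective]
    exact disjoint_compl_right
  have hcov : ∀ v, v ∈ P ∨ v ∈ Q ∨ v ∈ S := by
    intro v
    by_cases hv : v ∈ S
    · exact Or.inr (Or.inr hv)
    · by_cases hv2 : (⟨v, hv⟩ : ↑Sᶜ) ∈ X₀
      · exact Or.inl ⟨_, hv2, rfl⟩
      · exact Or.inr (Or.inl ⟨_, hv2, rfl⟩)
  have hPne : P.Nonempty := hX₀.image _
  have hQne : Q.Nonempty := hX₀'.image _
  have hPc : Pᶜ = Q ∪ S := by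
    ext v
    have h1 := hcov v
    have h2 : v ∈ P → v ∉ Q := fun h => Set.disjoint_left.1 hPQd h
    have h3 : v ∈ P → v ∉ S := fun h => Set.disjoint_left.1 hPS h
    simp only [Set.mem_compl_iff, Set.mem_union]; tauto
  have hQc : Qᶜ = P ∪ S := by
    ext v
    have h1 := hcov v
    have h2 : v ∈ P → v ∉ Q := fun h => Set.disjoint_left.1 hPQd h
    have h3 : v ∈ Q → v ∉ S := fun h => Set.disjoint_left.1 hQS h
    simp only [Set.mem_compl_iff, Set.mem_union]; tauto
  have hcutP : (ofGraph G).cut P = (ofGraph G).e P S := by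
    rw [MG.cut, hPc, wsum_union_right hQS]
    rw [MG.e] at hPQ
    rw [hPQ, zero_add]
  have hcutQ : (ofGraph G).cut Q = (ofGraph G).e Q S := by
    rw [MG.cut, hQc, wsum_union_right hPS]
    rw [MG.e_comm, MG.e] at hPQ
    rw [hPQ, zero_add]
  have hP3 := he P hPne (by rw [hPc]; exact hQne.mono Set.subset_union_left)
  have hQ3 := he Q hQne (by rw [hQc]; exact hPne.mono Set.subset_union_left)
  have hdeg : ∀ s, (ofGraph G).e P {s} + (ofGraph G).e Q {s} ≤ 3 := by
    intro s
    rw [MG.e_comm, (ofGraph G).e_comm Q, MG.e, MG.e, ← wsum_union_right hPQd, ← hcub s,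
      ← wsum_singleton_univ]
    exact wsum_mono (fun _ _ => le_rfl) le_rfl (Set.subset_univ _)
  have hins : ∀ s ∈ S, ∀ P Q : Set V, Disjoint P S → Q.Nonempty → Disjoint P Q → Disjoint Q S →
      2 * (ofGraph G).e P {s} ≤ (ofGraph G).cut P := by
    intro s hs P Q hPS hQne hPQd hQS
    have h1 := hcub.cut_insert (fun h => Set.disjoint_left.1 hPS h hs)
    obtain ⟨z, hz⟩ := hQne
    have h2 := he (insert s P) (by simp) ⟨z, by
      rintro (rfl | h)
      · exact Set.disjoint_left.1 hQS hz hs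
      · exact Set.disjoint_left.1 hPQd h hz⟩
    omega
  have hcase : S.ncard = 0 ∨ S.ncard = 1 ∨ S.ncard = 2 := by omega
  rcases hcase with h | h | h
  · rw [Set.ncard_eq_zero] at h
    rw [h, MG.e, wsum_empty_right] at hcutP
    omega
  · obtain ⟨s, rfl⟩ := Set.ncard_eq_one.1 h
    have := hdeg s
    omega
  · obtain ⟨s, t, hst, rfl⟩ := Set.ncard_eq_two.1 h
    rw [MG.e, wsum_insert_right (by simpa using hst)] at hcutP hcutQ
    have h1 := hdeg s
    have h2 := hdeg t
    have h3 := hins s (by simp) P Q hPS hQne hPQd hQS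
    have h4 := hins t (by simp) P Q hPS hQne hPQd hQS
    have h5 := hins s (by simp) Q P hQS hPne hPQd.symm hPS
    have h6 := hins t (by simp) Q P hQS hPne hPQd.symm hPS
    simp only [MG.e] at *
    omega

end NiceCubic

/-! ### Bipartite pieces are linear quadrangular chains ending in a cubic bipartite graph. -/

namespace NiceCubic

/-- Add two adjacent vertices, attached to `att 0` and `att 1`. -/
def cap {U : Type u} (Γ : SimpleGraph U) (att : Fin 2 → U) : SimpleGraph (U ⊕ Fin 2) where
  Adj
    | .inl u, .inl v => Γ.Adj u v
    | .inl u, .inr i => u = att i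
    | .inr i, .inl u => u = att i
    | .inr i, .inr j => i ≠ j
  symm := ⟨by
    rintro (a | b) (a' | b') h
    · exact Γ.adj_symm h
    · exact h
    · exact h
    · exact Ne.symm h⟩
  loopless := ⟨by
    rintro (a | b) h
    · exact Γ.irrefl h
    · exact h rfl⟩

/-- `cap` respects isomorphisms. -/
def capCongr {U : Type u} {W : Type v} {Γ : SimpleGraph U} {Γ' : SimpleGraph W} (e : Γ ≃g Γ')
    {att : Fin 2 → U} {att' : Fin 2 → W} (h : ∀ i, e (att i) = att' i) : cap Γ att ≃g cap Γ' att' where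
  toEquiv := Equiv.sumCongr e.toEquiv (Equiv.refl _)
  map_rel_iff' := by
    rintro (a | i) (b | j)
    · exact e.map_adj_iff
    · show e a = att' j ↔ a = att j
      rw [← h, e.injective.eq_iff]
    · show e b = att' i ↔ b = att i
      rw [← h, e.injective.eq_iff]
    · rfl

lemma ladder_adj {n : ℕ} {i i' : Fin (n + 1)} {j j' : Fin 2} : (ladder n).Adj (i, j) (i', j') ↔
    (((i : ℕ) + 1 = i' ∨ (i' : ℕ) + 1 = i) ∧ j = j') ∨ (i = i' ∧ j ≠ j') := by
  simp only [ladder, SimpleGraph.boxProd_adj, SimpleGraph.pathGraph_adj]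
  have : ((j : ℕ) + 1 = j' ∨ (j' : ℕ) + 1 = j) ↔ j ≠ j' := by revert j j'; decide
  rw [this]; tauto

lemma rung_eq {n : ℕ} {i i' : Fin (n + 1)} {j j' : Fin 2} :
    s((i, j), (i', j')) = s(((0 : Fin (n + 1)), (0 : Fin 2)), (0, 1)) ↔ i = 0 ∧ i' = 0 ∧ j ≠ j' := by
  rw [Sym2.eq_iff]
  simp only [Prod.mk.injEq]
  have : ((j = 0 ∧ j' = 1) ∨ (j = 1 ∧ j' = 0)) ↔ j ≠ j' := by revert j j'; decide
  rw [← this]; tauto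

lemma attached_iff {n : ℕ} {i : Fin (n + 1)} {j : Fin 2} {Q R : Prop} :
    ((i, j) = ((0 : Fin (n + 1)), (0 : Fin 2)) ∧ Q ∨ (i, j) = (0, 1) ∧ R) ↔
      i = 0 ∧ (j = 0 ∧ Q ∨ j = 1 ∧ R) := by
  simp only [Prod.mk.injEq]; tauto

/-- Adding a rung to an edge splicing of a ladder. -/
lemma exists_cap_ladder {U : Type u} (H : SimpleGraph U) (c d : U) (n : ℕ) :
    ∃ φ : cap (edgeSplice (ladder n) H (0, 0) (0, 1) c d) (fun i => .inl (Fin.last n, i)) ≃g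
      edgeSplice (ladder (n + 1)) H (0, 0) (0, 1) c d,
      ∀ i, φ (.inr i) = .inl (Fin.last (n + 1), i) := by
  let g : ((Fin (n + 1) × Fin 2) ⊕ {b : U // b ≠ c ∧ b ≠ d}) ⊕ Fin 2 →
      (Fin (n + 2) × Fin 2) ⊕ {b : U // b ≠ c ∧ b ≠ d} :=
    Sum.elim (Sum.elim (fun p => .inl (p.1.castSucc, p.2)) .inr) (fun i => .inl (Fin.last (n + 1), i))
  have hg : Function.Bijective g := by
    constructor
    · rintro ((⟨i, j⟩ | b) | j) ((⟨i', j'⟩ | b') | j') h <;>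
        simp [g, Fin.ext_iff] at h ⊢
      · exact h
      · exact absurd h.1 (by omega)
      · exact h
      · exact absurd h.1 (by omega)
      · exact h
    · rintro (⟨i, j⟩ | b)
      · induction i using Fin.lastCases with
        | last => exact ⟨.inr j, rfl⟩
        | cast i => exact ⟨.inl (.inl (i, j)), rfl⟩
      · exact ⟨.inl (.inr b), rfl⟩
  refine ⟨⟨Equiv.ofBijective g hg, ?_⟩, fun i => rfl⟩
  intro a b
  show (edgeSplice (ladder (n + 1)) H (0, 0) (0, 1) c d).Adj (g a) (g b) ↔ _
  rcases a with (⟨i, j⟩ | a) | j <;> rcases b with (⟨i', j'⟩ | b) | j' <;>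
    simp only [g, Sum.elim_inl, Sum.elim_inr, cap, edgeSplice, ne_eq, ladder_adj, rung_eq,
      Sum.inl.injEq, Prod.mk.injEq, Fin.ext_iff, Fin.val_castSucc, Fin.val_last,
      Fin.val_zero, reduceCtorEq]
  all_goals try omega
  · simp
  · simp
  · simp

/-- The bipartite pieces which replace edges, with their two attachment vertices. -/
structure IsPiece {U : Type u} (Γ : SimpleGraph U) (att : Fin 2 → U) : Prop where
  colour : ∃ A : Set U, (∀ u v, Γ.Adj u v → (u ∈ A ↔ v ∉ A)) ∧ att 0 ∈ A ∧ att 1 ∉ A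
  deg_att : ∀ i, deg Γ (att i) = 2
  deg_other : ∀ u, (∀ i, u ≠ att i) → deg Γ u = 3
  conn : ∀ P : Set U, P.Nonempty → (∀ i, att i ∉ P) → ∃ u ∈ P, ∃ v ∉ P, Γ.Adj u v

lemma isBipartite_of_colour {V : Type u} {G : SimpleGraph V} {A : Set V}
    (h : ∀ u v, G.Adj u v → (u ∈ A ↔ v ∉ A)) : G.IsBipartite := by
  classical
  refine ⟨SimpleGraph.Coloring.mk (fun v => if v ∈ A then 0 else 1) fun {v w} hvw => ?_⟩
  have := h v w hvw
  by_cases hv : v ∈ A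
  · simp [hv, this.1 hv]
  · have hw : w ∈ A := by by_contra hw; exact hv (this.2 hw)
    simp [hv, hw]

lemma exists_colour_of_isBipartite {V : Type u} {G : SimpleGraph V} (h : G.IsBipartite) :
    ∃ A : Set V, ∀ u v, G.Adj u v → (u ∈ A ↔ v ∉ A) := by
  obtain ⟨c⟩ := h
  refine ⟨{v | c v = 0}, fun v w h => ?_⟩
  have := c.valid h
  simp only [Set.mem_ofPred_eq]
  omega

/-- Join the two attachment vertices. -/
def closeUp {U : Type u} (Γ : SimpleGraph U) (x y : U) (hxy : x ≠ y) : SimpleGraph U where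
  Adj u v := Γ.Adj u v ∨ (u = x ∧ v = y) ∨ (u = y ∧ v = x)
  symm := ⟨fun u v h => by rw [Γ.adj_comm]; tauto⟩
  loopless := ⟨fun u h => by
    rcases h with h | ⟨rfl, h⟩ | ⟨rfl, h⟩
    · exact Γ.irrefl h
    · exact hxy h
    · exact hxy h.symm⟩

lemma IsPiece.inH_closeUp {U : Type u} [Finite U] {Γ : SimpleGraph U} {att : Fin 2 → U}
    (h : IsPiece Γ att) (hne : att 0 ≠ att 1) (hadj : ¬ Γ.Adj (att 0) (att 1)) :
    InH (closeUp Γ (att 0) (att 1) hne) := by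
  obtain ⟨A, hA, hA0, hA1⟩ := h.colour
  refine ⟨inferInstance, ?_, ?_, isBipartite_of_colour (A := A) ?_⟩
  · intro u
    by_cases h0 : u = att 0
    · have : (closeUp Γ (att 0) (att 1) hne).neighborSet u = insert (att 1) (Γ.neighborSet (att 0)) := by
        ext v
        simp only [SimpleGraph.mem_neighborSet, Set.mem_insert_iff, closeUp]
        subst h0
        constructor
        · rintro (h | ⟨_, h⟩ | ⟨h, _⟩)
          · exact Or.inr h
          · exact Or.inl h
          · exact absurd h hne
        · tauto
      rw [deg, this, Set.ncard_insert_of_notMem (by simpa using hadj)]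
      have := h.deg_att 0
      rw [deg] at this; omega
    by_cases h1 : u = att 1
    · have : (closeUp Γ (att 0) (att 1) hne).neighborSet u = insert (att 0) (Γ.neighborSet (att 1)) := by
        ext v
        simp only [SimpleGraph.mem_neighborSet, Set.mem_insert_iff, closeUp]
        subst h1
        constructor
        · rintro (h | ⟨h, _⟩ | ⟨_, h⟩)
          · exact Or.inr h
          · exact absurd h.symm hne
          · exact Or.inl h
        · tauto
      rw [deg, this, Set.ncard_insert_of_notMem (by simpa using fun h => hadj h.symm)]
      have := h.deg_att 1
      rw [deg] at this; omega
    · rw [← h.deg_other u (by intro i; fin_cases i <;> assumption), deg, deg]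
      congr 1
      ext v
      simp [closeUp, h0, h1]
  · have : Nonempty U := ⟨att 0⟩
    refine connected_of_cut fun X hX hX' => ?_
    by_cases h0 : att 0 ∈ X <;> by_cases h1 : att 1 ∈ X
    · obtain ⟨u, hu, v, hv, huv⟩ := h.conn Xᶜ hX' (by intro i; fin_cases i <;> simpa)
      exact ⟨v, by simpa using hv, u, hu, Or.inl huv.symm⟩
    · exact ⟨_, h0, _, h1, Or.inr (Or.inl ⟨rfl, rfl⟩)⟩
    · exact ⟨_, h1, _, h0, Or.inr (Or.inr ⟨rfl, rfl⟩)⟩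
    · obtain ⟨u, hu, v, hv, huv⟩ := h.conn X hX (by intro i; fin_cases i <;> assumption)
      exact ⟨u, hu, v, hv, Or.inl huv⟩
  · rintro u v (h | ⟨rfl, rfl⟩ | ⟨rfl, rfl⟩)
    · exact hA u v h
    · simp [hA0, hA1]
    · simp [hA0, hA1]

/-- `ladder 0` is a single edge, so edge splicing with it merely deletes the edge that `closeUp` has
added. This starts the induction on chains. -/
lemma exists_ladder_zero {U : Type u} (Γ : SimpleGraph U) {att : Fin 2 → U} (hne : att 0 ≠ att 1)
    (hadj : ¬ Γ.Adj (att 0) (att 1)) :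
    ∃ φ : Γ ≃g edgeSplice (ladder 0) (closeUp Γ (att 0) (att 1) hne) (0, 0) (0, 1) (att 0) (att 1),
      ∀ i, φ (att i) = .inl (Fin.last 0, i) := by
  have hinj : Function.Injective att := by
    intro i j hij
    fin_cases i <;> fin_cases j <;> simp_all
  let g : (Fin 1 × Fin 2) ⊕ {b : U // b ≠ att 0 ∧ b ≠ att 1} → U :=
    Sum.elim (fun p => att p.2) Subtype.val
  have hatt : ∀ (b : {b : U // b ≠ att 0 ∧ b ≠ att 1}) i, (b : U) ≠ att i := by
    intro b i; fin_cases i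
    · exact b.2.1
    · exact b.2.2
  have hg : Function.Bijective g := by
    constructor
    · rintro (⟨i, j⟩ | b) (⟨i', j'⟩ | b') h
      · obtain rfl := Subsingleton.elim i i'
        have : j = j' := hinj h
        rw [this]
      · exact absurd h.symm (hatt b' j)
      · exact absurd h (hatt b j')
      · rw [Subtype.ext h]
    · intro u
      by_cases h0 : u = att 0
      · exact ⟨.inl (0, 0), h0.symm⟩
      by_cases h1 : u = att 1
      · exact ⟨.inl (0, 1), h1.symm⟩
      · exact ⟨.inr ⟨u, h0, h1⟩, rfl⟩
  have hadj' : ∀ i j, ¬ Γ.Adj (att i) (att j) := by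
    intro i j
    fin_cases i <;> fin_cases j
    · exact Γ.irrefl
    · exact hadj
    · exact fun h => hadj h.symm
    · exact Γ.irrefl
  have hclose : ∀ (b : {b : U // b ≠ att 0 ∧ b ≠ att 1}) (i : Fin 2),
      (closeUp Γ (att 0) (att 1) hne).Adj (att i) b ↔ Γ.Adj (att i) b := by
    intro b i
    simp [closeUp, hatt b 0, hatt b 1]
  let ψ : edgeSplice (ladder 0) (closeUp Γ (att 0) (att 1) hne) (0, 0) (0, 1) (att 0) (att 1) ≃g Γ :=
    { toEquiv := Equiv.ofBijective g hg
      map_rel_iff' := by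
        intro a b
        show Γ.Adj (g a) (g b) ↔ _
        rcases a with ⟨i, j⟩ | a <;> rcases b with ⟨i', j'⟩ | b
        · simp only [g, Sum.elim_inl, edgeSplice, ladder_adj, ne_eq, rung_eq]
          obtain rfl : i = 0 := Fin.ext (by omega)
          obtain rfl : i' = 0 := Fin.ext (by omega)
          simp only [hadj', false_iff]
          simp
        · simp only [g, Sum.elim_inl, Sum.elim_inr, edgeSplice, attached_iff, hclose]
          obtain rfl : i = 0 := Fin.ext (by omega)
          fin_cases j <;> simp
        · simp only [g, Sum.elim_inl, Sum.elim_inr, edgeSplice, attached_iff, hclose, Γ.adj_comm a]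
          obtain rfl : i' = 0 := Fin.ext (by omega)
          fin_cases j' <;> simp
        · simp only [g, Sum.elim_inr, edgeSplice, closeUp]
          simp [hatt a 0, hatt a 1] }
  refine ⟨ψ.symm, fun i => ?_⟩
  rw [← ψ.apply_symm_apply (att i)]
  have : att i = ψ (.inl (Fin.last 0, i)) := rfl
  rw [this]
  simp

/-- A piece with adjacent attachment vertices arises from a smaller piece by adding a rung. -/
lemma IsPiece.exists_smaller {U : Type u} [Finite U] {Γ : SimpleGraph U} {att : Fin 2 → U}
    (h : IsPiece Γ att) (hadj : Γ.Adj (att 0) (att 1)) :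
    ∃ (U' : Type u) (_ : Finite U') (Γ' : SimpleGraph U') (att' : Fin 2 → U'), IsPiece Γ' att' ∧
      Nat.card U' < Nat.card U ∧ ∃ φ : Γ ≃g cap Γ' att', ∀ i, φ (att i) = .inr i := by
  obtain ⟨A, hA, hA0, hA1⟩ := h.colour
  have hnbr : ∀ i, ∃ z, ∀ u, Γ.Adj (att i) u ↔ u = att (1 - i) ∨ u = z := by
    intro i
    obtain ⟨a, b, hab, hN⟩ := Set.ncard_eq_two.1 (h.deg_att i)
    have h1 : att (1 - i) ∈ Γ.neighborSet (att i) := by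
      fin_cases i
      · exact hadj
      · exact hadj.symm
    have hmem : ∀ u, Γ.Adj (att i) u ↔ u ∈ ({a, b} : Set U) := by
      intro u; rw [← hN]; rfl
    rw [hN] at h1
    rcases h1 with h1 | h1
    · exact ⟨b, fun u => by rw [hmem, h1]; rfl⟩
    · rw [Set.mem_singleton_iff] at h1
      exact ⟨a, fun u => by rw [hmem, h1, or_comm]; rfl⟩
  choose z hz using hnbr
  have hzadj : ∀ i, Γ.Adj (att i) (z i) := fun i => (hz i _).2 (Or.inr rfl)
  have hz1 : ∀ i, z i ≠ att (1 - i) := by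
    intro i heq
    have h2 := h.deg_att i
    have : Γ.neighborSet (att i) = {z i} := by
      ext u
      rw [SimpleGraph.mem_neighborSet, hz, ← heq]; simp
    rw [deg, this, Set.ncard_singleton] at h2
    omega
  have hzatt : ∀ i j, z i ≠ att j := by
    intro i j heq
    by_cases hij : j = i
    · subst hij
      exact Γ.irrefl (heq ▸ hzadj j)
    · have : j = 1 - i := (by decide : ∀ i j : Fin 2, j ≠ i → j = 1 - i) i j hij
      exact hz1 i (heq.trans (by rw [this]))
  -- The two attachment vertices have different colours, so they have no common neighbour.
  have hz01 : z 0 ≠ z 1 := by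
    intro heq
    have h1 := hA _ _ (hzadj 0)
    have h2 := hA _ _ (hzadj 1)
    rw [← heq] at h2
    tauto
  let att' : Fin 2 → {u : U // u ≠ att 0 ∧ u ≠ att 1} := fun i => ⟨z i, hzatt i 0, hzatt i 1⟩
  have hatt : ∀ (b : {b : U // b ≠ att 0 ∧ b ≠ att 1}) i, (b : U) ≠ att i := by
    intro b i; fin_cases i
    · exact b.2.1
    · exact b.2.2
  have hne : att 0 ≠ att 1 := hadj.ne
  have hinj : Function.Injective att := by
    intro i j hij
    fin_cases i <;> fin_cases j <;> simp_all
  have hadjz : ∀ (b : {b : U // b ≠ att 0 ∧ b ≠ att 1}) i, Γ.Adj (b : U) (att i) ↔ b = att' i := by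
    intro b i
    rw [Γ.adj_comm, hz, or_iff_right (hatt b _), Subtype.ext_iff]
  refine ⟨{u : U // u ≠ att 0 ∧ u ≠ att 1}, inferInstance, Γ.comap Subtype.val, att', ⟨?_, ?_, ?_, ?_⟩,
    ?_, ?_⟩
  -- The new attachment vertices lie one step further in, so the roles of the colours are exchanged.
  · refine ⟨{u | (u : U) ∉ A}, fun u v huv => ?_, ?_, ?_⟩
    · have := hA u v huv
      simp only [Set.mem_ofPred_eq]; tauto
    · exact (hA _ _ (hzadj 0)).1 hA0
    · have := hA _ _ (hzadj 1)
      simp only [Set.mem_ofPred_eq]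
      tauto
  · intro i
    have h1 := h.deg_other (z i) (hzatt i)
    have h2 : Γ.neighborSet (z i) =
        insert (att i) (Subtype.val '' (Γ.comap (Subtype.val : {u : U // u ≠ att 0 ∧ u ≠ att 1} → U)).neighborSet
          (att' i)) := by
      ext v
      constructor
      · intro hv
        by_cases hvi : v = att i
        · exact Or.inl hvi
        · refine Or.inr ⟨⟨v, ?_⟩, hv, rfl⟩
          have : ∀ j, v ≠ att j := by
            rintro j rfl
            have h3 : att' i = att' j := (hadjz (att' i) j).1 hv
            have h4 : z i = z j := congrArg Subtype.val h3
            have : i ≠ j := by rintro rfl; exact hvi rfl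
            fin_cases i <;> fin_cases j <;> simp_all
          exact ⟨this 0, this 1⟩
      · rintro (rfl | ⟨w, hw, rfl⟩)
        · exact (hzadj i).symm
        · exact hw
    rw [deg, h2, Set.ncard_insert_of_notMem, Set.ncard_image_of_injective _ Subtype.val_injective] at h1
    · rw [deg]; omega
    · rintro ⟨w, _, hw⟩
      exact hatt w i hw
  · intro u hu
    rw [← h.deg_other u (hatt u), deg, deg, ← Set.ncard_image_of_injective _ Subtype.val_injective]
    congr 1
    ext v
    constructor
    · rintro ⟨w, hw, rfl⟩; exact hw
    · intro hv
      refine ⟨⟨v, ?_⟩, hv, rfl⟩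
      have : ∀ j, v ≠ att j := by
        rintro j rfl
        exact hu j ((hadjz u j).1 hv)
      exact ⟨this 0, this 1⟩
  · intro P hP hatt'
    obtain ⟨_, ⟨u, hu, rfl⟩, v, hv, huv⟩ := h.conn (Subtype.val '' P) (hP.image _) (by
      rintro i ⟨w, _, hw⟩
      exact hatt w i hw)
    have : ∀ j, v ≠ att j := by
      rintro j rfl
      exact hatt' j ((hadjz u j).1 huv ▸ hu)
    exact ⟨u, hu, ⟨v, this 0, this 1⟩, fun h => hv ⟨_, h, rfl⟩, huv⟩
  · refine Finite.card_subtype_lt (x := att 0) ?_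
    simp
  · let g : {u : U // u ≠ att 0 ∧ u ≠ att 1} ⊕ Fin 2 → U := Sum.elim Subtype.val att
    have hg : Function.Bijective g := by
      constructor
      · rintro (b | i) (b' | i') heq
        · rw [Subtype.ext heq]
        · exact absurd heq (hatt b i')
        · exact absurd heq.symm (hatt b' i)
        · rw [hinj heq]
      · intro u
        by_cases h0 : u = att 0
        · exact ⟨.inr 0, h0.symm⟩
        by_cases h1 : u = att 1
        · exact ⟨.inr 1, h1.symm⟩
        · exact ⟨.inl ⟨u, h0, h1⟩, rfl⟩
    let ψ : cap (Γ.comap (Subtype.val : {u : U // u ≠ att 0 ∧ u ≠ att 1} → U)) att' ≃g Γ :=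
      { toEquiv := Equiv.ofBijective g hg
        map_rel_iff' := by
          intro a b
          show Γ.Adj (g a) (g b) ↔ _
          rcases a with a | i <;> rcases b with b | j
          · rfl
          · exact hadjz a j
          · exact (Γ.adj_comm _ _).trans (hadjz b i)
          · show Γ.Adj (att i) (att j) ↔ i ≠ j
            fin_cases i <;> fin_cases j <;> simp [hadj, hadj.symm] }
    refine ⟨ψ.symm, fun i => ?_⟩
    have : att i = ψ (.inr i) := rfl
    rw [this]
    simp

/-- Rungs are stripped off as long as the attachment vertices are adjacent; when they are not,
joining them gives a cubic bipartite graph. The position of the attachment vertices on the last rung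
is carried along so that rungs can be put back. -/
lemma IsPiece.exists_ladder (n : ℕ) : ∀ (U : Type u) [Finite U] (Γ : SimpleGraph U) (att : Fin 2 → U),
    Nat.card U = n → IsPiece Γ att → ∃ (N : ℕ) (U' : Type u) (H : SimpleGraph U') (c d : U'), InH H ∧
      H.Adj c d ∧ ∃ φ : Γ ≃g edgeSplice (ladder N) H (0, 0) (0, 1) c d,
        ∀ i, φ (att i) = .inl (Fin.last N, i) := by
  induction n using Nat.strong_induction_on with
  | _ n ih =>
  intro U _ Γ att hn h
  by_cases hadj : Γ.Adj (att 0) (att 1)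
  · obtain ⟨U', _, Γ', att', hp, hlt, φ, hφ⟩ := h.exists_smaller hadj
    obtain ⟨N, U'', H, c, d, hH, hcd, ψ, hψ⟩ := ih _ (hn ▸ hlt) U' Γ' att' rfl hp
    obtain ⟨θ, hθ⟩ := exists_cap_ladder H c d N
    refine ⟨N + 1, U'', H, c, d, hH, hcd, (φ.trans (capCongr ψ hψ)).trans θ, fun i => ?_⟩
    rw [← hθ]
    show θ (capCongr ψ hψ (φ (att i))) = _
    rw [hφ]
    rfl
  · have hne : att 0 ≠ att 1 := by
      obtain ⟨A, _, h0, h1⟩ := h.colour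
      intro heq
      exact h1 (heq ▸ h0)
    obtain ⟨φ, hφ⟩ := exists_ladder_zero Γ hne hadj
    exact ⟨0, U, _, _, _, h.inH_closeUp hne hadj, Or.inr (Or.inl ⟨rfl, rfl⟩), φ, hφ⟩

lemma is22Edge_ladder (n : ℕ) : Is22Edge (ladder (n + 1)) (0, 0) (0, 1) := by
  have h : ∀ j, deg (ladder (n + 1)) (0, j) = 2 := by
    intro j
    have : (ladder (n + 1)).neighborSet (0, j) = {(0, 1 - j), (1, j)} := by
      ext ⟨i, k⟩
      rw [SimpleGraph.mem_neighborSet, ladder_adj]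
      have h1 : k = 1 - j ↔ j ≠ k := by revert j k; decide
      simp only [Set.mem_insert_iff, Set.mem_singleton_iff, Prod.mk.injEq, h1, Fin.ext_iff, Fin.val_zero,
        Fin.val_one]
      omega
    rw [deg, this, Set.ncard_pair]
    simp
  exact ⟨by rw [ladder_adj]; simp, h 0, h 1⟩

/-- The rung added by `cap` ensures at least one quadrangle, even if the piece contains no rung of
its own. -/
lemma IsPiece.inHDiamond {U : Type u} [Finite U] {Γ : SimpleGraph U} {att : Fin 2 → U}
    (h : IsPiece Γ att) : InHDiamond (cap Γ att) := by
  obtain ⟨N, U', H, c, d, hH, hcd, φ, hφ⟩ := IsPiece.exists_ladder _ U Γ att rfl h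
  obtain ⟨θ, -⟩ := exists_cap_ladder H c d N
  exact ⟨N + 1, U', H, (0, 0), (0, 1), c, d, by omega, hH, is22Edge_ladder N, hcd,
    ⟨(capCongr φ hφ).trans θ⟩⟩

lemma is22Edge_cap {U : Type u} (Γ : SimpleGraph U) (att : Fin 2 → U) :
    Is22Edge (cap Γ att) (.inr 0) (.inr 1) := by
  have h : ∀ j : Fin 2, deg (cap Γ att) (.inr j) = 2 := by
    intro j
    have : (cap Γ att).neighborSet (.inr j) = {.inl (att j), .inr (1 - j)} := by
      ext (u | k)
      · simp [cap]
      · have h1 : k = 1 - j ↔ j ≠ k := by revert j k; decide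
        simp [cap, h1]
    rw [deg, this, Set.ncard_pair]
    simp
  exact ⟨by simp [cap], h 0, h 1⟩

end NiceCubic

/-! ### Graphs obtained from `K₄` by replacing edges have at most four nice vertices. -/

namespace NiceCubic

/-- The edges leaving a set of vertices. -/
def exits {V : Type u} (G : SimpleGraph V) (X : Set V) : Set (V × V) :=
  {p | p.1 ∈ X ∧ p.2 ∉ X ∧ G.Adj p.1 p.2}

lemma cut_ofGraph {V : Type u} [Fintype V] (G : SimpleGraph V) (X : Set V) :
    (ofGraph G).cut X = (exits G X).ncard := by
  classical
  rw [Set.ncard_eq_toFinset_card', MG.cut, wsum, ← Fintype.sum_prod_type', exits, Set.toFinset_ofPred,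
    Finset.card_filter]
  refine Finset.sum_congr rfl fun p _ => ?_
  simp only [ofGraph, Set.mem_compl_iff]
  split_ifs <;> tauto

/-- The vertex lies in a bipartite set of vertices with two leaving edges which avoids `K`. -/
def HiddenOff {V : Type u} (G : SimpleGraph V) (K : Set V) (v : V) : Prop :=
  ∃ X A : Set V, v ∈ X ∧ Disjoint X K ∧ (exits G X).ncard = 2 ∧
    ∀ u ∈ X, ∀ w ∈ X, G.Adj u w → (u ∈ A ↔ w ∉ A)

lemma HiddenOff.hidden {V : Type u} [Fintype V] {G : SimpleGraph V} {K : Set V} {v : V}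
    (h : HiddenOff G K v) : (ofGraph G).Hidden v := by
  obtain ⟨X, A, hv, -, hcut, hcol⟩ := h
  exact ⟨X, A, hv, by rw [cut_ofGraph, hcut], fun x hx y hy hxy => hcol x hx y hy (ofGraph_ne_zero.1 hxy)⟩

lemma Hidden.congr {V : Type u} {W : Type v} [Fintype V] [Fintype W] {G : SimpleGraph V}
    {R : SimpleGraph W} (φ : G ≃g R) {v : V} (h : (ofGraph R).Hidden (φ v)) : (ofGraph G).Hidden v := by
  obtain ⟨X, A, hv, hcut, hcol⟩ := h
  refine ⟨φ ⁻¹' X, φ ⁻¹' A, hv, ?_, fun x hx y hy hxy => ?_⟩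
  · rw [cut_ofGraph] at hcut ⊢
    rw [← hcut, ← Set.ncard_image_of_injective (f := Prod.map φ φ) (exits G _)
      (φ.injective.prodMap φ.injective)]
    congr 1
    ext ⟨a, b⟩
    constructor
    · rintro ⟨⟨a, b⟩, ⟨h1, h2, h3⟩, h⟩
      rw [← h]
      exact ⟨h1, h2, φ.map_adj_iff.2 h3⟩
    · rintro ⟨h1, h2, h3⟩
      refine ⟨(φ.symm a, φ.symm b), ⟨?_, ?_, φ.symm.map_adj_iff.2 h3⟩, by simp⟩
      · simpa using h1
      · simpa using h2
  · exact hcol _ hx _ hy (ofGraph_ne_zero.2 (φ.map_adj_iff.2 (ofGraph_ne_zero.1 hxy)))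

lemma ladder_colour {n : ℕ} (p q : Fin (n + 1) × Fin 2) (h : (ladder n).Adj p q) :
    Even ((p.1 : ℕ) + p.2) ↔ ¬ Even ((q.1 : ℕ) + q.2) := by
  obtain ⟨i, j⟩ := p
  obtain ⟨i', j'⟩ := q
  rw [ladder_adj] at h
  simp only [Nat.even_iff]
  rcases h with ⟨h, rfl⟩ | ⟨rfl, h⟩ <;> omega

/-- The ladder is coloured by the parity of the coordinates, and the colouring of the bipartite
graph is exchanged if necessary to agree at the identified edge. -/
lemma InHDiamond.colour {W : Type u} {D : SimpleGraph W} (h : InHDiamond D) :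
    ∃ A : Set W, ∀ u v, D.Adj u v → (u ∈ A ↔ v ∉ A) := by
  obtain ⟨n, U, H, a, b, c, d, -, ⟨-, -, -, hH⟩, ⟨hab, -, -⟩, hcd, ⟨φ⟩⟩ := h
  obtain ⟨B, hB⟩ := exists_colour_of_isBipartite hH
  let L : Set (Fin (n + 1) × Fin 2) := {p | Even ((p.1 : ℕ) + p.2)}
  have hL : ∀ p q, (ladder n).Adj p q → (p ∈ L ↔ q ∉ L) := ladder_colour
  let A : Set ((Fin (n + 1) × Fin 2) ⊕ {b : U // b ≠ c ∧ b ≠ d}) :=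
    {p | Sum.elim (fun q => q ∈ L) (fun u => ((u : U) ∈ B ↔ (c ∈ B ↔ a ∈ L))) p}
  have h1 := hL _ _ hab
  have h2 := hB _ _ hcd
  refine ⟨φ ⁻¹' A, fun u v huv => ?_⟩
  have huv' := φ.map_adj_iff.2 huv
  simp only [Set.mem_preimage]
  generalize φ u = u' at *
  generalize φ v = v' at *
  rcases u' with p | u' <;> rcases v' with q | v'
  · exact hL p q huv'.1
  · show p ∈ L ↔ ¬ ((v' : U) ∈ B ↔ (c ∈ B ↔ a ∈ L))
    rcases huv' with ⟨rfl, h⟩ | ⟨rfl, h⟩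
    · have := hB _ _ h; tauto
    · have := hB _ _ h; tauto
  · show ((u' : U) ∈ B ↔ (c ∈ B ↔ a ∈ L)) ↔ ¬ q ∈ L
    rcases huv' with ⟨rfl, h⟩ | ⟨rfl, h⟩
    · have := hB _ _ h; tauto
    · have := hB _ _ h; tauto
  · show ((u' : U) ∈ B ↔ (c ∈ B ↔ a ∈ L)) ↔ ¬ ((v' : U) ∈ B ↔ (c ∈ B ↔ a ∈ L))
    have := hB _ _ huv'
    tauto

lemma exists_other_nbr {W : Type u} {D : SimpleGraph W} {a b : W} (hab : D.Adj a b) (h : deg D a = 2) :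
    ∃ c, c ≠ a ∧ c ≠ b ∧ ∀ d, D.Adj a d ↔ d = b ∨ d = c := by
  obtain ⟨x, y, hxy, hN⟩ := Set.ncard_eq_two.1 h
  have hmem : ∀ d, D.Adj a d ↔ d ∈ ({x, y} : Set W) := by
    intro d; rw [← hN]; rfl
  have hb := (hmem b).1 hab
  rcases hb with hb | hb
  · subst hb
    exact ⟨y, ((hmem y).2 (Or.inr rfl)).ne', hxy.symm, fun d => hmem d⟩
  · rw [Set.mem_singleton_iff] at hb
    subst hb
    exact ⟨x, ((hmem x).2 (Or.inl rfl)).ne', hxy, fun d => by rw [hmem, or_comm]; rfl⟩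

lemma exits_edgeSplice_inr {V W : Type u} {G : SimpleGraph V} {D : SimpleGraph W} {p q : V} {a b : W}
    (hpq : p ≠ q) (h : Is22Edge D a b) :
    (exits (edgeSplice G D p q a b) (Set.range Sum.inr)).ncard = 2 := by
  obtain ⟨hab, ha, hb⟩ := h
  obtain ⟨c, hca, hcb, hc⟩ := exists_other_nbr hab ha
  obtain ⟨d, hdb, hda, hd⟩ := exists_other_nbr hab.symm hb
  rw [Set.ncard_eq_two]
  refine ⟨(.inr ⟨c, hca, hcb⟩, .inl p), (.inr ⟨d, hda, hdb⟩, .inl q), ?_, ?_⟩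
  · simp [hpq]
  · ext ⟨x, y⟩
    constructor
    · rintro ⟨⟨z, rfl⟩, h2, h3⟩
      rcases y with y | y
      · rcases h3 with ⟨rfl, h3⟩ | ⟨rfl, h3⟩
        · left
          rcases (hc _).1 h3 with h3 | h3
          · exact absurd h3 z.2.2
          · simp [Subtype.ext_iff, h3]
        · right
          rcases (hd _).1 h3 with h3 | h3
          · exact absurd h3 z.2.1
          · simp [Subtype.ext_iff, h3]
      · exact absurd ⟨y, rfl⟩ h2
    · rintro (h | h)
      · obtain ⟨rfl, rfl⟩ := Prod.mk.inj h
        exact ⟨⟨_, rfl⟩, by simp, Or.inl ⟨rfl, (hc _).2 (Or.inr rfl)⟩⟩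
      · obtain ⟨rfl, rfl⟩ := Prod.mk.inj h
        exact ⟨⟨_, rfl⟩, by simp, Or.inr ⟨rfl, (hd _).2 (Or.inr rfl)⟩⟩

lemma Replaced.injective {V : Type u} {R : SimpleGraph V} {k : Fin 4 → V} {S : Finset (Sym2 (Fin 4))}
    (h : Replaced R k S) : Function.Injective k := by
  induction h with
  | base G k => exact k.injective
  | step G k S D i j a b _ hij hS hD hab ih => exact Sum.inl_injective.comp ih

lemma Replaced.not_isDiag {V : Type u} {R : SimpleGraph V} {k : Fin 4 → V} {S : Finset (Sym2 (Fin 4))}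
    (h : Replaced R k S) : ∀ e ∈ S, ¬ e.IsDiag := by
  induction h with
  | base G k => simp
  | step G k S D i j a b _ hij hS hD hab ih =>
    intro e he
    rcases Finset.mem_insert.1 he with rfl | he
    · simpa using hij
    · exact ih e he

/-- Edges of `K₄` not yet replaced remain edges. Conversely, an adjacency between two of the four
positions certifies that the edge is still available for replacement. -/
lemma Replaced.adj_iff {V : Type u} {R : SimpleGraph V} {k : Fin 4 → V} {S : Finset (Sym2 (Fin 4))}
    (h : Replaced R k S) {i j : Fin 4} (hij : i ≠ j) : R.Adj (k i) (k j) ↔ s(i, j) ∉ S := by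
  induction h with
  | base G k =>
    have : G.Adj (k i) (k j) ↔ i ≠ j := k.map_adj_iff
    simp [this, hij]
  | step G k S D i' j' a b hR hij' hS hD hab ih =>
    show G.Adj (k i) (k j) ∧ s(k i, k j) ≠ s(k i', k j') ↔ _
    rw [ih, Finset.mem_insert, not_or, and_comm]
    refine and_congr_left fun _ => not_congr ?_
    rw [← Sym2.map_mk, ← Sym2.map_mk]
    exact (Sym2.map.injective hR.injective).eq_iff

/-- The inserted part is bipartite with two leaving edges. Earlier hidden sets avoid the four
positions of `K₄`, and a further edge splicing deletes and attaches edges only at these positions,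
so those sets stay hidden. -/
lemma Replaced.hiddenOff {V : Type u} {R : SimpleGraph V} {k : Fin 4 → V} {S : Finset (Sym2 (Fin 4))}
    (h : Replaced R k S) : ∀ v ∉ Set.range k, HiddenOff R (Set.range k) v := by
  induction h with
  | base G k => exact fun v hv => absurd (k.surjective v) hv
  | @step V W G k S D i j a b hR hij hS hD hab ih =>
    have hdis : ∀ t, (Sum.inl (k t) : V ⊕ {d : W // d ≠ a ∧ d ≠ b}) ∉ Set.range Sum.inr := by simp
    rintro (w | d) hv
    · have hw : w ∉ Set.range k := by
        rintro ⟨t, rfl⟩; exact hv ⟨t, rfl⟩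
      obtain ⟨X, A, hwX, hXk, hcut, hcol⟩ := ih w hw
      have hk : ∀ t, k t ∉ X := fun t ht => Set.disjoint_left.1 hXk ht ⟨t, rfl⟩
      refine ⟨Sum.inl '' X, Sum.inl '' A, ⟨w, hwX, rfl⟩, ?_, ?_, ?_⟩
      · rw [Set.disjoint_left]
        rintro _ ⟨x, hx, rfl⟩ ⟨t, ht⟩
        exact hk t (Sum.inl_injective ht ▸ hx)
      · rw [← hcut, ← Set.ncard_image_of_injective (exits G X)
          ((Sum.inl_injective (α := V) (β := {d : W // d ≠ a ∧ d ≠ b})).prodMap Sum.inl_injective)]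
        congr 1
        ext ⟨x, y⟩
        constructor
        · rintro ⟨⟨x, hx, rfl⟩, h2, h3⟩
          rcases y with y | y
          · exact ⟨(x, y), ⟨hx, fun hy => h2 ⟨y, hy, rfl⟩, h3.1⟩, rfl⟩
          · rcases h3 with ⟨rfl, _⟩ | ⟨rfl, _⟩
            · exact absurd hx (hk _)
            · exact absurd hx (hk _)
        · rintro ⟨⟨x', y'⟩, ⟨h1, h2, h3⟩, h⟩
          obtain ⟨rfl, rfl⟩ := Prod.mk.inj h
          refine ⟨⟨x', h1, rfl⟩, ?_, h3, ?_⟩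
          · rintro ⟨z, hz, hz'⟩
            exact h2 (Sum.inl_injective hz' ▸ hz)
          · intro heq
            rcases Sym2.eq_iff.1 heq with ⟨h4, _⟩ | ⟨h4, _⟩
            · exact hk i (h4 ▸ h1)
            · exact hk j (h4 ▸ h1)
      · rintro _ ⟨x, hx, rfl⟩ _ ⟨y, hy, rfl⟩ hxy
        simpa using hcol x hx y hy hxy.1
    · obtain ⟨A, hA⟩ := hD.colour
      refine ⟨Set.range Sum.inr, Sum.inr '' {z | (z : W) ∈ A}, ⟨d, rfl⟩, ?_,
        exits_edgeSplice_inr (fun h => hij (hR.injective h)) hab, ?_⟩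
      · rw [Set.disjoint_left]
        rintro _ h ⟨t, rfl⟩
        exact hdis t h
      · rintro _ ⟨x, rfl⟩ _ ⟨y, rfl⟩ hxy
        have := hA x y hxy
        simpa using this

lemma Replaced.isK4 {V : Type u} {R : SimpleGraph V} {k : Fin 4 → V} {S : Finset (Sym2 (Fin 4))}
    (h : Replaced R k S) (hS : S = ∅) : IsK4 R := by
  cases h with
  | base G k => exact ⟨k.symm⟩
  | step => simp at hS

lemma card_le_six {S : Finset (Sym2 (Fin 4))} (h : ∀ e ∈ S, ¬ e.IsDiag) : S.card ≤ 6 := by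
  have : S ⊆ Finset.univ.filter fun e : Sym2 (Fin 4) => ¬ e.IsDiag := fun e he => by simpa using h e he
  refine (Finset.card_le_card this).trans ?_
  decide

lemma MG.niceNum_le_of_replaced {V : Type u} [Fintype V] {G : SimpleGraph V} (hc : IsCubic G)
    {W : Type v} {R : SimpleGraph W} {k : Fin 4 → W} {S : Finset (Sym2 (Fin 4))}
    (h : Replaced R k S) (φ : G ≃g R) : (ofGraph G).niceNum ≤ 4 := by
  classical
  have : Fintype W := Fintype.ofEquiv V φ.toEquiv
  have h1 : {v | (ofGraph G).Nice v} ⊆ φ.symm '' Set.range k := by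
    intro v hv
    by_contra hn
    refine MG.not_nice_of_hidden (ofGraph_cubic.2 hc) (Hidden.congr φ ?_) hv
    refine (h.hiddenOff (φ v) ?_).hidden
    rintro ⟨t, ht⟩
    exact hn ⟨φ v, ⟨t, ht⟩, by simp⟩
  calc (ofGraph G).niceNum ≤ (φ.symm '' Set.range k).ncard := Set.ncard_le_ncard h1
    _ ≤ (Set.range k).ncard := Set.ncard_image_le (Set.toFinite _)
    _ ≤ 4 := by
      rw [← Set.image_univ]
      exact (Set.ncard_image_le (Set.toFinite _)).trans (by simp [Set.ncard_univ])

end NiceCubic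

/-! ### Uncrossing hidden sets. -/

namespace NiceCubic
namespace MG
variable {V : Type u} [Fintype V] {M : MG V}

lemma e_union_left {X Y : Set V} (h : Disjoint X Y) (Z : Set V) : M.e (X ∪ Y) Z = M.e X Z + M.e Y Z :=
  wsum_union_left h Z

lemma e_union_right {X Y : Set V} (h : Disjoint X Y) (Z : Set V) : M.e Z (X ∪ Y) = M.e Z X + M.e Z Y :=
  wsum_union_right h Z

lemma cut_add_cut (X Y : Set V) :
    M.cut X + M.cut Y = M.cut (X ∪ Y) + M.cut (X ∩ Y) + 2 * M.e (X \ Y) (Y \ X) := by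
  have dab : Disjoint (X \ Y) (X ∩ Y) := Set.disjoint_left.2 fun v h h' => h.2 h'.2
  have dac : Disjoint (X \ Y) (Y \ X) := Set.disjoint_left.2 fun v h h' => h.2 h'.1
  have dbc : Disjoint (X ∩ Y) (Y \ X) := Set.disjoint_left.2 fun v h h' => h'.2 h.1
  have dad : Disjoint (X \ Y) (X ∪ Y)ᶜ := Set.disjoint_left.2 fun v h h' => h' (Or.inl h.1)
  have dcd : Disjoint (Y \ X) (X ∪ Y)ᶜ := Set.disjoint_left.2 fun v h h' => h' (Or.inr h.1)
  have habc : Disjoint (X \ Y ∪ X ∩ Y) (Y \ X) := Set.disjoint_union_left.2 ⟨dac, dbc⟩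
  have hacd : Disjoint (X \ Y ∪ Y \ X) (X ∪ Y)ᶜ := Set.disjoint_union_left.2 ⟨dad, dcd⟩
  have hX : X = X \ Y ∪ X ∩ Y := by
    ext; simp only [Set.mem_union, Set.mem_sdiff, Set.mem_inter_iff]; tauto
  have hX' : Xᶜ = Y \ X ∪ (X ∪ Y)ᶜ := by ext; simp only [Set.mem_compl_iff, Set.mem_union, Set.mem_sdiff]; tauto
  have hY : Y = X ∩ Y ∪ Y \ X := by
    ext; simp only [Set.mem_union, Set.mem_sdiff, Set.mem_inter_iff]; tauto
  have hY' : Yᶜ = X \ Y ∪ (X ∪ Y)ᶜ := by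
    ext; simp only [Set.mem_compl_iff, Set.mem_union, Set.mem_sdiff]; tauto
  have hU : X ∪ Y = X \ Y ∪ X ∩ Y ∪ Y \ X := by
    ext; simp only [Set.mem_union, Set.mem_sdiff, Set.mem_inter_iff]; tauto
  have hI : (X ∩ Y)ᶜ = X \ Y ∪ Y \ X ∪ (X ∪ Y)ᶜ := by
    ext; simp only [Set.mem_compl_iff, Set.mem_union, Set.mem_sdiff, Set.mem_inter_iff]; tauto
  have cX : M.cut X = M.e (X \ Y ∪ X ∩ Y) (Y \ X ∪ (X ∪ Y)ᶜ) := by rw [← hX, ← hX']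
  have cY : M.cut Y = M.e (X ∩ Y ∪ Y \ X) (X \ Y ∪ (X ∪ Y)ᶜ) := by rw [← hY, ← hY']
  have cU : M.cut (X ∪ Y) = M.e (X \ Y ∪ X ∩ Y ∪ Y \ X) (X ∪ Y)ᶜ := by rw [← hU]
  have cI : M.cut (X ∩ Y) = M.e (X ∩ Y) (X \ Y ∪ Y \ X ∪ (X ∪ Y)ᶜ) := by rw [← hI]
  rw [cX, cY, cU, cI]
  simp only [e_union_left dab, e_union_left dbc, e_union_left habc, e_union_right dcd,
    e_union_right dad, e_union_right hacd, e_union_right dac]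
  rw [M.e_comm (Y \ X) (X \ Y)]
  ring

/-- A coloured set with an edge cut of size `2`. -/
def HidSet (M : MG V) (X : Set V) : Prop := M.cut X = 2 ∧ ∃ A, M.ColOn X A

lemma HidSet.hidden {X : Set V} (h : M.HidSet X) {v : V} (hv : v ∈ X) : M.Hidden v := by
  obtain ⟨h1, A, hA⟩ := h
  exact ⟨X, A, hv, h1, hA⟩

lemma hidden_iff {v : V} : M.Hidden v ↔ ∃ X, M.HidSet X ∧ v ∈ X := by
  constructor
  · rintro ⟨X, A, h1, h2, h3⟩
    exact ⟨X, ⟨h2, A, h3⟩, h1⟩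
  · rintro ⟨X, h, hv⟩
    exact h.hidden hv

lemma HidSet.compl_nonempty {X : Set V} (h : M.HidSet X) : Xᶜ.Nonempty := by
  by_contra hn
  rw [Set.not_nonempty_iff_eq_empty] at hn
  have := h.1
  simp [cut, hn] at this

/-- Two colourings of a set with an edge cut of size `2` agree up to exchanging the colours. -/
lemma ColOn.agree (he : M.EC 2) {Z A B : Set V} (hA : M.ColOn Z A) (hB : M.ColOn Z B)
    (hZ : M.cut Z ≤ 2) : (∀ z ∈ Z, z ∈ A ↔ z ∈ B) ∨ (∀ z ∈ Z, z ∈ A ↔ z ∉ B) := by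
  by_contra hcon
  push Not at hcon
  obtain ⟨⟨z, hz, hz'⟩, w, hw, hw'⟩ := hcon
  -- No edge joins the parts where the colourings agree and disagree, so their cuts add up to that
  -- of `Z`; two non-empty parts would need at least four edges.
  let D : Set V := {v ∈ Z | v ∈ A ↔ v ∈ B}
  let E : Set V := {v ∈ Z | ¬ (v ∈ A ↔ v ∈ B)}
  have hD : w ∈ D := ⟨hw, by tauto⟩
  have hE : z ∈ E := ⟨hz, by tauto⟩
  have hdis : Disjoint D E := Set.disjoint_left.2 fun v h h' => h'.2 h.2
  have hU : D ∪ E = Z := by ext v; simp [D, E]; tauto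
  have h1 := M.cut_add_cut D E
  rw [hU, hdis.inter_eq] at h1
  have h2 : M.e (D \ E) (E \ D) = 0 := by
    rw [e, wsum_eq_zero]
    rintro x ⟨hx, -⟩ y ⟨hy, -⟩
    by_contra h0
    have h3 := hA x hx.1 y hy.1 h0
    have h4 := hB x hx.1 y hy.1 h0
    have h5 := hx.2
    have h6 := hy.2
    tauto
  have h3 := he D ⟨w, hD⟩ ⟨z, fun h => h.2.elim (by have := hE.2; tauto)⟩
  have h4 := he E ⟨z, hE⟩ ⟨w, fun h => h.2 (by have := hD.2; tauto)⟩
  have h5 : M.cut ∅ = 0 := by simp [cut]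
  omega

/-- By `cut_add_cut`, the union and the intersection both have cuts of size 2 and no edge joins the
two differences. The colourings agree on the intersection up to an exchange, hence combine. -/
lemma HidSet.union_of_inter (he : M.EC 2) {X Y : Set V} (hX : M.HidSet X) (hY : M.HidSet Y)
    (hI : (X ∩ Y).Nonempty) (hU : (X ∪ Y)ᶜ.Nonempty) : M.HidSet (X ∪ Y) := by
  classical
  obtain ⟨hX1, A, hA⟩ := hX
  obtain ⟨hY1, B, hB⟩ := hY
  have h1 := M.cut_add_cut X Y
  have h2 := he (X ∪ Y) (hI.mono fun v h => Or.inl h.1) hU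
  have h3 := he _ hI (hU.mono (Set.compl_subset_compl.2 fun v h => Or.inl h.1))
  have h4 : M.e (X \ Y) (Y \ X) = 0 := by omega
  refine ⟨by omega, ?_⟩
  obtain ⟨B', hB', hag⟩ : ∃ B', M.ColOn Y B' ∧ ∀ z ∈ X ∩ Y, z ∈ A ↔ z ∈ B' := by
    rcases ColOn.agree he (hA.mono (X := X ∩ Y) fun v h => h.1) (hB.mono (X := X ∩ Y) fun v h => h.2)
      (by omega) with h | h
    · exact ⟨B, hB, h⟩
    · exact ⟨Bᶜ, hB.compl, h⟩
  rw [e, wsum_eq_zero] at h4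
  have hmemX : ∀ v ∈ X, v ∈ {v | (v ∈ X ∧ v ∈ A) ∨ (v ∈ Y ∧ v ∈ B')} ↔ v ∈ A := by
    intro v hv
    have := hag v
    simp only [Set.mem_ofPred_eq, hv, true_and, Set.mem_inter_iff] at *
    tauto
  have hmemY : ∀ v ∈ Y, v ∈ {v | (v ∈ X ∧ v ∈ A) ∨ (v ∈ Y ∧ v ∈ B')} ↔ v ∈ B' := by
    intro v hv
    have := hag v
    simp only [Set.mem_ofPred_eq, hv, true_and, Set.mem_inter_iff] at *
    tauto
  refine ⟨{v | (v ∈ X ∧ v ∈ A) ∨ (v ∈ Y ∧ v ∈ B')}, fun x hx y hy hxy => ?_⟩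
  by_cases hxX : x ∈ X <;> by_cases hyX : y ∈ X
  · rw [hmemX x hxX, hmemX y hyX]; exact hA x hxX y hyX hxy
  · have hyY : y ∈ Y := hy.resolve_left hyX
    have hxY : x ∈ Y := by
      by_contra hxY
      exact hxy (h4 x ⟨hxX, hxY⟩ y ⟨hyY, hyX⟩)
    rw [hmemY x hxY, hmemY y hyY]; exact hB' x hxY y hyY hxy
  · have hxY : x ∈ Y := hx.resolve_left hxX
    have hyY : y ∈ Y := by
      by_contra hyY
      exact hxy (by rw [M.symm]; exact h4 y ⟨hyX, hyY⟩ x ⟨hxY, hxX⟩)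
    rw [hmemY x hxY, hmemY y hyY]; exact hB' x hxY y hyY hxy
  · have hxY : x ∈ Y := hx.resolve_left hxX
    have hyY : y ∈ Y := hy.resolve_left hyX
    rw [hmemY x hxY, hmemY y hyY]; exact hB' x hxY y hyY hxy

/-- Of the four leaving edges, one joins `X` to `Y` and no second one can, since the union has at
least two leaving edges. One connecting edge puts no constraint on the colourings beyond a possible
exchange. -/
lemma HidSet.union_of_adj (he : M.EC 2) {X Y : Set V} (hX : M.HidSet X) (hY : M.HidSet Y)
    (hI : Disjoint X Y) {x y : V} (hx : x ∈ X) (hy : y ∈ Y) (hxy : M.m x y ≠ 0)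
    (hU : (X ∪ Y)ᶜ.Nonempty) : M.HidSet (X ∪ Y) := by
  obtain ⟨hX1, A, hA⟩ := hX
  obtain ⟨hY1, B, hB⟩ := hY
  have h1 := M.cut_add_cut X Y
  rw [hI.inter_eq, hI.sdiff_eq_left, hI.symm.sdiff_eq_left] at h1
  have h0 : M.cut ∅ = 0 := by simp [cut]
  have h2 := he _ ⟨x, Or.inl hx⟩ hU
  have h3 : 0 < M.e X Y := by rw [e, wsum_pos]; exact ⟨x, hx, y, hy, by omega⟩
  have hone : M.e X Y = 1 := by omega
  refine ⟨by omega, ?_⟩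
  obtain ⟨B', hB', hag⟩ : ∃ B', M.ColOn Y B' ∧ (x ∈ A ↔ y ∉ B') := by
    by_cases h : x ∈ A ↔ y ∉ B
    · exact ⟨B, hB, h⟩
    · exact ⟨Bᶜ, hB.compl, by simp only [Set.mem_compl_iff]; tauto⟩
  have huniq : ∀ a ∈ X, ∀ b ∈ Y, M.m a b ≠ 0 → a = x ∧ b = y := by
    intro a ha b hb hab
    by_contra hne
    have h4 : M.e X Y = M.e {x} {y} + M.e {x} (Y \ {y}) + M.e (X \ {x}) Y := by
      conv_lhs => rw [← Set.insert_sdiff_self_of_mem hx]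
      rw [e, wsum_insert_left (by simp)]
      conv_lhs => enter [1]; rw [← Set.insert_sdiff_self_of_mem hy]
      rw [wsum_insert_right (by simp)]
    have h5 : 0 < M.e {x} (Y \ {y}) + M.e (X \ {x}) Y := by
      by_cases hax : a = x
      · have : 0 < M.e {x} (Y \ {y}) := by
          rw [e, wsum_pos]
          exact ⟨x, rfl, b, ⟨hb, fun h => hne ⟨hax, h⟩⟩, by rw [← hax]; omega⟩
        omega
      · have : 0 < M.e (X \ {x}) Y := by
          rw [e, wsum_pos]
          exact ⟨a, ⟨ha, hax⟩, b, hb, by omega⟩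
        omega
    have h6 : M.e {x} {y} = M.m x y := wsum_singleton x y
    omega
  have hYX : ∀ v ∈ Y, v ∉ X := fun v h h' => Set.disjoint_left.1 hI h' h
  refine ⟨{v | (v ∈ X ∧ v ∈ A) ∨ (v ∈ Y ∧ v ∈ B')}, ?_⟩
  rintro a (ha | ha) b (hb | hb) hab
  · have h1 : a ∉ Y := fun h => hYX a h ha
    have h2 : b ∉ Y := fun h => hYX b h hb
    simpa [ha, hb, h1, h2] using hA a ha b hb hab
  · obtain ⟨rfl, rfl⟩ := huniq a ha b hb hab
    have h1 : a ∉ Y := fun h => hYX a h ha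
    simpa [ha, hb, h1, hYX b hb] using hag
  · obtain ⟨rfl, rfl⟩ := huniq b hb a ha (by rwa [M.symm])
    have h1 : b ∉ Y := fun h => hYX b h hb
    simp only [Set.mem_ofPred_eq, ha, hb, h1, hYX a ha, true_and, false_and, or_false, false_or]
    tauto
  · simpa [ha, hb, hYX a ha, hYX b hb] using hB' a ha b hb hab

/-- Otherwise `X ∪ Y` would be a larger hidden set; the vertex that is not hidden guarantees that
the union is not everything. -/
lemma HidSet.not_hidden_of_max (he : M.EC 2) {X : Set V} (hX : M.HidSet X)
    (hmax : ∀ Y, M.HidSet Y → Y.ncard ≤ X.ncard) (hn : ∃ v, ¬ M.Hidden v) {Y : Set V}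
    (hY : M.HidSet Y) : Y ⊆ X ∨ (Disjoint X Y ∧ M.e X Y = 0) := by
  have hU : (X ∪ Y)ᶜ.Nonempty := by
    obtain ⟨v, hv⟩ := hn
    exact ⟨v, fun h => hv (h.elim hX.hidden hY.hidden)⟩
  have key : M.HidSet (X ∪ Y) → Y ⊆ X := by
    intro h
    have := Set.eq_of_subset_of_ncard_le (Set.subset_union_left (s := X) (t := Y)) (hmax _ h)
      (Set.toFinite _)
    rw [this]; exact Set.subset_union_right
  by_cases hI : (X ∩ Y).Nonempty
  · exact Or.inl (key (hX.union_of_inter he hY hI hU))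
  · have hd : Disjoint X Y := Set.disjoint_iff_inter_eq_empty.2 (Set.not_nonempty_iff_eq_empty.1 hI)
    by_cases h0 : M.e X Y = 0
    · exact Or.inr ⟨hd, h0⟩
    · rw [← Ne, ← Nat.pos_iff_ne_zero, e, wsum_pos] at h0
      obtain ⟨x, hx, y, hy, hxy⟩ := h0
      exact Or.inl (key (hX.union_of_adj he hY hd hx hy (by omega) hU))

lemma Nice.not_hidden (hc : M.Cubic) {v : V} (h : M.Nice v) : ¬ M.Hidden v :=
  fun h' => not_nice_of_hidden hc h' h

lemma four_le_ncard_not_hidden (hc : M.Cubic) (he : M.EC 2) (hb : ¬ M.Bip) :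
    4 ≤ {v | ¬ M.Hidden v}.ncard :=
  (four_le_niceNum _ V M rfl hc he hb).1.trans
    (Set.ncard_le_ncard (fun _ hv => Nice.not_hidden hc hv) (Set.toFinite _))

end MG

lemma adj_of_card_four {V : Type u} {G : SimpleGraph V} (hc : IsCubic G) (h4 : Nat.card V = 4)
    {x y : V} (hxy : x ≠ y) : G.Adj x y := by
  have : Finite V := Nat.finite_of_card_ne_zero (by omega)
  have h1 : G.neighborSet x = {x}ᶜ := by
    refine Set.eq_of_subset_of_ncard_le (fun z hz => ?_) ?_ (Set.toFinite _)
    · exact fun h => G.irrefl (show G.Adj x x from (Set.mem_singleton_iff.1 h) ▸ hz)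
    · have h2 := Set.ncard_add_ncard_compl ({x} : Set V)
      have h3 := hc x
      rw [deg] at h3
      rw [Set.ncard_singleton] at h2
      omega
  have : y ∈ G.neighborSet x := by rw [h1]; exact fun h => hxy h.symm
  exact this

lemma isK4_of_card_four {V : Type u} {G : SimpleGraph V} (hc : IsCubic G) (h4 : Nat.card V = 4) :
    IsK4 G := by
  have : Finite V := Nat.finite_of_card_ne_zero (by omega)
  have e : V ≃ Fin 4 := (Finite.equivFinOfCardEq h4)
  refine ⟨⟨e, ?_⟩⟩
  intro a b
  constructor
  · intro h
    exact adj_of_card_four hc h4 fun hab => h (congrArg e hab)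
  · intro h
    exact fun hab => h.ne (e.injective hab)

/-- `edgeSplice` respects isomorphisms of the first graph. -/
def edgeSpliceCongr {V : Type u} {V' : Type v} {W : Type w} {G : SimpleGraph V} {R : SimpleGraph V'}
    (ψ : G ≃g R) (D : SimpleGraph W) (p q : V) (a b : W) :
    edgeSplice G D p q a b ≃g edgeSplice R D (ψ p) (ψ q) a b where
  toEquiv := Equiv.sumCongr ψ.toEquiv (Equiv.refl _)
  map_rel_iff' := by
    rintro (x | x) (y | y)
    · show R.Adj (ψ x) (ψ y) ∧ s(ψ x, ψ y) ≠ s(ψ p, ψ q) ↔ G.Adj x y ∧ s(x, y) ≠ s(p, q)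
      rw [ψ.map_adj_iff, ← Sym2.map_mk, ← Sym2.map_mk]
      exact and_congr_right fun _ => not_congr (Sym2.map.injective ψ.injective).eq_iff
    · show (ψ x = ψ p ∧ _) ∨ (ψ x = ψ q ∧ _) ↔ (x = p ∧ _) ∨ (x = q ∧ _)
      rw [ψ.injective.eq_iff, ψ.injective.eq_iff]; rfl
    · show (ψ y = ψ p ∧ _) ∨ (ψ y = ψ q ∧ _) ↔ (y = p ∧ _) ∨ (y = q ∧ _)
      rw [ψ.injective.eq_iff, ψ.injective.eq_iff]; rfl
    · rfl

section reduce
variable {V : Type u} [Fintype V] {G : SimpleGraph V}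

/-- By `colOn_card` the numbers of edges leaving the two classes are congruent modulo 3 and sum to
2, so each is 1. -/
lemma exists_two_exits (hc : IsCubic G) {X A : Set V} (hcut : (ofGraph G).cut X = 2)
    (hA : (ofGraph G).ColOn X A) :
    ∃ x y p q, x ∈ X ∧ x ∈ A ∧ y ∈ X ∧ y ∉ A ∧ p ∉ X ∧ q ∉ X ∧
      ∀ u ∈ X, ∀ v ∉ X, G.Adj u v ↔ (u = x ∧ v = p) ∨ (u = y ∧ v = q) := by
  have h1 := (ofGraph_cubic.2 hc).colOn_card hA
  have h2 := MG.cut_split (M := ofGraph G) X A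
  have h3 : 0 < (ofGraph G).e (X ∩ A) Xᶜ := by omega
  have h4 : 0 < (ofGraph G).e (X \ A) Xᶜ := by omega
  rw [MG.e, wsum_pos] at h3 h4
  obtain ⟨x, ⟨hx, hxA⟩, p, hp, hxp⟩ := h3
  obtain ⟨y, ⟨hy, hyA⟩, q, hq, hyq⟩ := h4
  have hxp' : G.Adj x p := ofGraph_ne_zero.1 hxp.ne'
  have hyq' : G.Adj y q := ofGraph_ne_zero.1 hyq.ne'
  refine ⟨x, y, p, q, hx, hxA, hy, hyA, hp, hq, fun u hu v hv => ?_⟩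
  rw [cut_ofGraph] at hcut
  have h5 : ({(x, p), (y, q)} : Set (V × V)) = exits G X := by
    refine Set.eq_of_subset_of_ncard_le ?_ ?_ (Set.toFinite _)
    · rintro z (rfl | rfl)
      · exact ⟨hx, hp, hxp'⟩
      · exact ⟨hy, hq, hyq'⟩
    · rw [hcut, Set.ncard_pair]
      intro h
      exact hyA ((Prod.mk.inj h).1 ▸ hxA)
  have h6 : (u, v) ∈ exits G X ↔ G.Adj u v := ⟨fun h => h.2.2, fun h => ⟨hu, hv, h⟩⟩
  rw [← h6, ← h5]
  simp

end reduce
end NiceCubic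

/-! ### Reduction at a largest hidden set, down to `K₄`. -/

namespace NiceCubic

section reduce
variable {V : Type u} [Fintype V] {G : SimpleGraph V}

lemma isPiece_of_exits (hc : IsCubic G) (he : (ofGraph G).EC 2) {X A : Set V}
    (hXc : Xᶜ.Nonempty) (hA : (ofGraph G).ColOn X A) {x y p q : V} (hx : x ∈ X) (hxA : x ∈ A)
    (hy : y ∈ X) (hyA : y ∉ A) (hp : p ∉ X) (hq : q ∉ X)
    (hadj : ∀ u ∈ X, ∀ v ∉ X, G.Adj u v ↔ (u = x ∧ v = p) ∨ (u = y ∧ v = q)) :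
    IsPiece (G.comap (Subtype.val : {v // v ∈ X} → V)) ![⟨x, hx⟩, ⟨y, hy⟩] := by
  have hxy : x ≠ y := fun h => hyA (h ▸ hxA)
  have hatt : ∀ z ∈ X, ∀ r ∉ X, (∀ v ∉ X, G.Adj z v ↔ v = r) → ∀ h : z ∈ X,
      deg (G.comap (Subtype.val : {v // v ∈ X} → V)) ⟨z, h⟩ = 2 := by
    intro z _ r hr hzr h
    have h2 : G.neighborSet z =
        insert r (Subtype.val '' (G.comap (Subtype.val : {v // v ∈ X} → V)).neighborSet ⟨z, h⟩) := by
      ext v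
      constructor
      · intro hv
        by_cases hvX : v ∈ X
        · exact Or.inr ⟨⟨v, hvX⟩, hv, rfl⟩
        · exact Or.inl ((hzr v hvX).1 hv)
      · rintro (rfl | ⟨w, hw, rfl⟩)
        · exact (hzr v hr).2 rfl
        · exact hw
    have h3 := hc z
    rw [deg, h2, Set.ncard_insert_of_notMem, Set.ncard_image_of_injective _ Subtype.val_injective] at h3
    · rw [deg]; omega
    · rintro ⟨w, _, rfl⟩
      exact hr w.2
  refine ⟨⟨{v | (v : V) ∈ A}, fun u v huv => ?_, hxA, hyA⟩, ?_, ?_, ?_⟩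
  · exact hA u u.2 v v.2 (ofGraph_ne_zero.2 huv)
  · intro i
    fin_cases i
    · refine hatt x hx p hp (fun v hv => ?_) hx
      rw [hadj x hx v hv]
      simp [hxy]
    · refine hatt y hy q hq (fun v hv => ?_) hy
      rw [hadj y hy v hv]
      simp [hxy.symm]
  · intro u hu
    have h0 : (u : V) ≠ x := fun h => hu 0 (Subtype.ext h)
    have h1 : (u : V) ≠ y := fun h => hu 1 (Subtype.ext h)
    rw [← hc u, deg, deg, ← Set.ncard_image_of_injective _ Subtype.val_injective]
    congr 1
    ext v
    constructor
    · rintro ⟨w, hw, rfl⟩; exact hw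
    · intro hv
      by_cases hvX : v ∈ X
      · exact ⟨⟨v, hvX⟩, hv, rfl⟩
      · have := (hadj u u.2 v hvX).1 hv
        simp [h0, h1] at this
  · intro P hP hP'
    have h1 := he (Subtype.val '' P) (hP.image _)
      (hXc.mono (Set.compl_subset_compl.2 (by rintro _ ⟨z, -, rfl⟩; exact z.2)))
    have h2 : 0 < (ofGraph G).cut (Subtype.val '' P) := by omega
    rw [MG.cut, wsum_pos] at h2
    obtain ⟨_, ⟨u, hu, rfl⟩, v, hv, huv⟩ := h2
    have huv' : G.Adj u v := ofGraph_ne_zero.1 huv.ne'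
    by_cases hvX : v ∈ X
    · exact ⟨u, hu, ⟨v, hvX⟩, fun h => hv ⟨_, h, rfl⟩, huv'⟩
    · exfalso
      rcases (hadj u u.2 v hvX).1 huv' with ⟨h, -⟩ | ⟨h, -⟩
      · exact hP' 0 ((Subtype.ext h : u = ⟨x, hx⟩) ▸ hu)
      · exact hP' 1 ((Subtype.ext h : u = ⟨y, hy⟩) ▸ hu)

/-- A graph is recovered from the two sides of an edge cut of size `2` by edge splicing. -/
lemma exists_edgeSplice_iso {X : Set V} {x y p q : V} (hx : x ∈ X) (hy : y ∈ X) (hp : p ∉ X) (hq : q ∉ X) (hpq : p ≠ q) (hnadj : ¬ G.Adj p q)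
    (hadj : ∀ u ∈ X, ∀ v ∉ X, G.Adj u v ↔ (u = x ∧ v = p) ∨ (u = y ∧ v = q)) :
    Nonempty (edgeSplice (closeUp (G.comap (Subtype.val : {v // v ∉ X} → V)) ⟨p, hp⟩ ⟨q, hq⟩
      (fun h => hpq (congrArg Subtype.val h)))
      (cap (G.comap (Subtype.val : {v // v ∈ X} → V)) ![⟨x, hx⟩, ⟨y, hy⟩]) ⟨p, hp⟩ ⟨q, hq⟩
      (.inr 0) (.inr 1) ≃g G) := by
  let g : {v // v ∉ X} ⊕ {b : {v // v ∈ X} ⊕ Fin 2 // b ≠ .inr 0 ∧ b ≠ .inr 1} → V :=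
    Sum.elim Subtype.val (fun b => Sum.elim Subtype.val (fun _ => x) (b : {v // v ∈ X} ⊕ Fin 2))
  have hD : ∀ b : {b : {v // v ∈ X} ⊕ Fin 2 // b ≠ .inr 0 ∧ b ≠ .inr 1},
      ∃ z : {v // v ∈ X}, b = ⟨.inl z, by simp, by simp⟩ := by
    rintro ⟨z | i, h0, h1⟩
    · exact ⟨z, rfl⟩
    · exfalso
      fin_cases i
      · exact h0 rfl
      · exact h1 rfl
  have hg : Function.Bijective g := by
    constructor
    · rintro (a | b) (a' | b') h
      · rw [Subtype.ext (a1 := a) (a2 := a') h]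
      · obtain ⟨z, rfl⟩ := hD b'
        exact absurd (show (a : V) ∈ X from (show (a : V) = z from h) ▸ z.2) a.2
      · obtain ⟨z, rfl⟩ := hD b
        exact absurd (show (a' : V) ∈ X from (show (z : V) = a' from h) ▸ z.2) a'.2
      · obtain ⟨z, rfl⟩ := hD b
        obtain ⟨z', rfl⟩ := hD b'
        obtain rfl : z = z' := Subtype.ext h
        rfl
    · intro v
      by_cases hv : v ∈ X
      · exact ⟨.inr ⟨.inl ⟨v, hv⟩, by simp, by simp⟩, rfl⟩
      · exact ⟨.inl ⟨v, hv⟩, rfl⟩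
  have hmix : ∀ (a : {v // v ∉ X}) (z : {v // v ∈ X}), G.Adj a z ↔
      (a = ⟨p, hp⟩ ∧ z = ⟨x, hx⟩) ∨ (a = ⟨q, hq⟩ ∧ z = ⟨y, hy⟩) := by
    intro a z
    rw [G.adj_comm, hadj z z.2 a a.2, Subtype.ext_iff, Subtype.ext_iff, Subtype.ext_iff, Subtype.ext_iff]
    tauto
  refine ⟨⟨Equiv.ofBijective g hg, ?_⟩⟩
  intro a b
  show G.Adj (g a) (g b) ↔ _
  rcases a with a | a <;> rcases b with b | b
  · show G.Adj a b ↔ (G.Adj a b ∨ _) ∧ _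
    rw [Ne, Sym2.eq_iff]
    constructor
    · intro h
      refine ⟨Or.inl h, ?_⟩
      rintro (⟨rfl, rfl⟩ | ⟨rfl, rfl⟩)
      · exact hnadj h
      · exact hnadj h.symm
    · rintro ⟨h | h, h'⟩
      · exact h
      · exact absurd h h'
  · obtain ⟨z, rfl⟩ := hD b
    exact hmix a z
  · obtain ⟨z, rfl⟩ := hD a
    exact (G.adj_comm _ _).trans (hmix b z)
  · obtain ⟨z, rfl⟩ := hD a
    obtain ⟨z', rfl⟩ := hD b
    rfl

open scoped Classical in
/-- The map contracting `X` into the vertex `p` outside of `X`. -/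
noncomputable def retract (X : Set V) (p : {v // v ∉ X}) (v : V) : {v // v ∉ X} :=
  if h : v ∈ X then p else ⟨v, h⟩

lemma retract_of_mem {X : Set V} {p : {v // v ∉ X}} {v : V} (h : v ∈ X) : retract X p v = p := dif_pos h
lemma retract_of_notMem {X : Set V} {p : {v // v ∉ X}} {v : V} (h : v ∉ X) :
    retract X p v = ⟨v, h⟩ := dif_neg h

lemma retract_preimage_self (X : Set V) (p : {v // v ∉ X}) : retract X p ⁻¹' {p} = insert (p : V) X := by
  ext v
  by_cases h : v ∈ X
  · simp [retract_of_mem h, h]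
  · simp [retract_of_notMem h, h, Subtype.ext_iff]

lemma retract_preimage {X : Set V} {p : {v // v ∉ X}} {Y : Set {v // v ∉ X}} (h : p ∉ Y) :
    retract X p ⁻¹' Y = Subtype.val '' Y := by
  ext v
  by_cases hv : v ∈ X
  · simp [retract_of_mem hv, h, hv]
  · simp [retract_of_notMem hv, hv]

/-- Deleting `X` and joining `p` to `q` is the same as contracting `X` into `p`. This makes the
statements on cuts of quotients available for the reduced graph. -/
lemma closeUp_eq_quot {X : Set V} {x y p q : V} (hy : y ∈ X) (hp : p ∉ X) (hq : q ∉ X)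
    (hpq : p ≠ q) (hnadj : ¬ G.Adj p q)
    (hadj : ∀ u ∈ X, ∀ v ∉ X, G.Adj u v ↔ (u = x ∧ v = p) ∨ (u = y ∧ v = q)) :
    ofGraph (closeUp (G.comap (Subtype.val : {v // v ∉ X} → V)) ⟨p, hp⟩ ⟨q, hq⟩
      (fun h => hpq (congrArg Subtype.val h))) = (ofGraph G).quot (retract X ⟨p, hp⟩) := by
  classical
  set G' := closeUp (G.comap (Subtype.val : {v // v ∉ X} → V)) ⟨p, hp⟩ ⟨q, hq⟩
      (fun h => hpq (congrArg Subtype.val h)) with hG'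
  have hp1 : ∀ v : {v // v ∉ X}, v ≠ ⟨p, hp⟩ → (ofGraph G').m ⟨p, hp⟩ v =
      ((ofGraph G).quot (retract X ⟨p, hp⟩)).m ⟨p, hp⟩ v := by
    intro v hv
    have hvp : (v : V) ≠ p := fun h => hv (Subtype.ext h)
    rw [MG.quot_m _ hv.symm, retract_preimage_self, retract_preimage (by simpa using hv.symm),
      Set.image_singleton, MG.e, wsum_insert_left hp, wsum_singleton]
    have hX : wsum (ofGraph G).m X {(v : V)} = if (v : V) = q then 1 else 0 := by
      rw [wsum_comm (ofGraph G).symm, wsum_singleton_left]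
      split_ifs with hvq
      · rw [Finset.sum_eq_single y]
        · rw [if_pos hy, (ofGraph G).symm]
          exact ofGraph_adj ((hadj y hy v v.2).2 (Or.inr ⟨rfl, hvq⟩))
        · intro b _ hb
          split_ifs with hbX
          · rw [(ofGraph G).symm]
            refine ofGraph_not_adj fun h => ?_
            have := (hadj b hbX v v.2).1 h
            tauto
          · rfl
        · simp
      · refine Finset.sum_eq_zero fun b _ => ?_
        split_ifs with hbX
        · rw [(ofGraph G).symm]
          refine ofGraph_not_adj fun h => ?_
          have := (hadj b hbX v v.2).1 h
          tauto
        · rfl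
    rw [hX]
    split_ifs with hvq
    · have h1 : G'.Adj ⟨p, hp⟩ v := Or.inr (Or.inl ⟨rfl, Subtype.ext hvq⟩)
      rw [ofGraph_adj h1, ofGraph_not_adj (by rw [hvq]; exact hnadj)]
    · have h1 : G'.Adj ⟨p, hp⟩ v ↔ G.Adj p v := by
        simp only [hG', closeUp, SimpleGraph.comap_adj, Subtype.ext_iff, hvp, hvq]
        simp
      by_cases h2 : G.Adj p v
      · rw [ofGraph_adj h2, ofGraph_adj (h1.2 h2)]
      · rw [ofGraph_not_adj h2, ofGraph_not_adj (fun h => h2 (h1.1 h))]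
  refine MG.ext_m fun u v => ?_
  by_cases huv : u = v
  · subst huv; rw [MG.loopless, MG.loopless]
  by_cases hu : u = ⟨p, hp⟩
  · subst hu; exact hp1 v (Ne.symm huv)
  by_cases hv : v = ⟨p, hp⟩
  · subst hv; rw [MG.symm, hp1 u huv, MG.symm]
  · rw [MG.quot_m _ huv, retract_preimage (by simpa using Ne.symm hu),
      retract_preimage (by simpa using Ne.symm hv), Set.image_singleton, Set.image_singleton, MG.e,
      wsum_singleton]
    have h1 : G'.Adj u v ↔ G.Adj u v := by
      simp only [hG', closeUp, SimpleGraph.comap_adj]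
      simp [hu, hv]
    by_cases h2 : G.Adj u v
    · rw [ofGraph_adj h2, ofGraph_adj (h1.2 h2)]
    · rw [ofGraph_not_adj h2, ofGraph_not_adj (fun h => h2 (h1.1 h))]

end reduce

theorem exists_replaced (n : ℕ) : ∀ (V : Type u) [Fintype V] (G : SimpleGraph V), Fintype.card V = n →
    IsCubic G → (ofGraph G).EC 2 → ¬ (ofGraph G).Bip → {v | ¬ (ofGraph G).Hidden v}.ncard ≤ 4 →
    ∃ (W : Type u) (R : SimpleGraph W) (k : Fin 4 → W) (S : Finset (Sym2 (Fin 4))),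
      Replaced R k S ∧ Nonempty (G ≃g R) := by
  classical
  induction n using Nat.strong_induction_on with
  | _ n ih =>
  intro V _ G hn hc he hb h4
  have hcub := ofGraph_cubic.2 hc
  by_cases hall : ∀ v, ¬ (ofGraph G).Hidden v
  · have h1 : {v | ¬ (ofGraph G).Hidden v} = Set.univ := by ext v; simp [hall v]
    rw [h1, Set.ncard_univ] at h4
    have h2 := MG.four_le_card hcub hb
    rw [← Nat.card_eq_fintype_card] at h2
    obtain ⟨φ⟩ := isK4_of_card_four hc (le_antisymm h4 h2)
    exact ⟨V, G, φ.symm, ∅, Replaced.base G φ.symm, ⟨SimpleGraph.Iso.refl⟩⟩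
  push Not at hall
  obtain ⟨v₀, hv₀⟩ := hall
  obtain ⟨X₀, hX₀, -⟩ := MG.hidden_iff.1 hv₀
  -- A largest hidden set is removed. Maximality makes `p` and `q` not hidden, so that they are
  -- among the four vertices of the final `K₄`.
  obtain ⟨X, hX, hmax⟩ : ∃ X, (ofGraph G).HidSet X ∧ ∀ Y, (ofGraph G).HidSet Y → Y.ncard ≤ X.ncard := by
    obtain ⟨X, hX, hmax⟩ := (Set.toFinite {X | (ofGraph G).HidSet X}).exists_maximalFor Set.ncard _ ⟨X₀, hX₀⟩
    refine ⟨X, hX, fun Y hY => ?_⟩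
    by_contra hlt
    exact hlt (hmax hY (by omega))
  have hnon : ∃ v, ¬ (ofGraph G).Hidden v := by
    have h1 := MG.four_le_ncard_not_hidden hcub he hb
    exact Set.nonempty_of_ncard_ne_zero (s := {v | ¬ (ofGraph G).Hidden v}) (by omega)
  have hsub := fun Y => hX.not_hidden_of_max he hmax hnon (Y := Y)
  have hXc := hX.compl_nonempty
  obtain ⟨hcut, A, hA⟩ := id hX
  obtain ⟨x, y, p, q, hx, hxA, hy, hyA, hp, hq, hadj⟩ := exists_two_exits hc hcut hA
  have hxy : x ≠ y := fun h => hyA (h ▸ hxA)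
  have hxp : G.Adj x p := (hadj x hx p hp).2 (Or.inl ⟨rfl, rfl⟩)
  have hyq : G.Adj y q := (hadj y hy q hq).2 (Or.inr ⟨rfl, rfl⟩)
  have heX : ∀ v ∉ X, (ofGraph G).e X {v} = {u | u ∈ X ∧ G.Adj u v}.ncard := by
    intro v hv
    rw [MG.e, wsum_comm (ofGraph G).symm, wsum_singleton_left, Set.ncard_eq_toFinset_card',
      Set.toFinset_ofPred, Finset.card_filter]
    refine Finset.sum_congr rfl fun u _ => ?_
    simp only [ofGraph, G.adj_comm v u]
    split_ifs <;> tauto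
  -- If both leaving edges ended at `p`, the third edge at `p` would be a bridge.
  have hpq : p ≠ q := by
    rintro rfl
    have h1 := hcub.cut_insert hp
    have h2 : {u | u ∈ X ∧ G.Adj u p} = {x, y} := by
      ext u
      constructor
      · rintro ⟨h3, h4⟩
        rcases (hadj u h3 p hp).1 h4 with h | h
        · exact Or.inl h.1
        · exact Or.inr h.1
      · rintro (rfl | rfl)
        · exact ⟨hx, hxp⟩
        · exact ⟨hy, hyq⟩
    rw [heX p hp, h2, Set.ncard_pair hxy] at h1
    by_cases h3 : (insert p X)ᶜ.Nonempty
    · have := he _ ⟨p, Or.inl rfl⟩ h3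
      omega
    · rw [Set.not_nonempty_iff_eq_empty] at h3
      have : (ofGraph G).cut (insert p X) = 0 := by rw [MG.cut, h3, wsum_empty_right]
      omega
  have hep : (ofGraph G).e X {p} = 1 := by
    rw [heX p hp, Set.ncard_eq_one]
    refine ⟨x, ?_⟩
    ext u
    constructor
    · rintro ⟨h3, h4⟩
      rcases (hadj u h3 p hp).1 h4 with h | h
      · exact h.1
      · exact absurd h.2 hpq
    · rintro rfl; exact ⟨hx, hxp⟩
  have heq : (ofGraph G).e X {q} = 1 := by
    rw [heX q hq, Set.ncard_eq_one]
    refine ⟨y, ?_⟩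
    ext u
    constructor
    · rintro ⟨h3, h4⟩
      rcases (hadj u h3 q hq).1 h4 with h | h
      · exact absurd h.2 hpq.symm
      · exact h.1
    · rintro rfl; exact ⟨hy, hyq⟩
  have hnot : ∀ u ∈ X, ∀ v ∉ X, G.Adj u v → ¬ (ofGraph G).Hidden v := by
    intro u hu v hv huv hh
    obtain ⟨Y, hY, hvY⟩ := MG.hidden_iff.1 hh
    rcases hsub Y hY with h | ⟨-, h⟩
    · exact hv (h hvY)
    · rw [MG.e, wsum_eq_zero] at h
      exact ofGraph_ne_zero.2 huv (h u hu v hvY)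
  have hcutp : (ofGraph G).cut (insert p X) = 3 := by
    have := hcub.cut_insert hp
    omega
  -- If `p` and `q` were adjacent, `X ∪ {p, q}` would again be a coloured set with a 2-edge cut, and
  -- `p` would be hidden.
  have hnadj : ¬ G.Adj p q := by
    intro hpq'
    have hq' : q ∉ insert p X := by
      rintro (h | h)
      · exact hpq h.symm
      · exact hq h
    have h1 := hcub.cut_insert hq'
    rw [MG.e, wsum_insert_left hp, wsum_singleton, ofGraph_adj hpq', ← MG.e, heq] at h1
    refine hnot x hx p hp hxp ⟨insert q (insert p X), ((A ∩ X) ∪ {q}), by simp, by omega, ?_⟩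
    have hin : ∀ u v, u ∈ X → v ∈ X → G.Adj u v → (u ∈ A ↔ v ∉ A) :=
      fun u v hu hv h => hA u hu v hv (ofGraph_ne_zero.2 h)
    have key : ∀ u ∈ insert q (insert p X), ∀ v ∈ X, G.Adj u v →
        (u ∈ (A ∩ X) ∪ {q} ↔ v ∉ (A ∩ X) ∪ {q}) := by
      intro u hu v hv huv
      have hvq : v ≠ q := fun h => hq (h ▸ hv)
      rcases hu with rfl | rfl | hu
      · have := (hadj v hv u hq).1 huv.symm
        have : v = y := by tauto
        subst this
        simp [hvq, hyA]
      · have := (hadj v hv u hp).1 huv.symm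
        have : v = x := by tauto
        subst this
        simp [hvq, hxA, hx, hp, hpq]
      · have huq : u ≠ q := fun h => hq (h ▸ hu)
        simpa [hu, hv, huq, hvq] using hin u v hu hv huv
    intro u hu v hv huv
    rw [ofGraph_ne_zero] at huv
    by_cases hvX : v ∈ X
    · exact key u hu v hvX huv
    by_cases huX : u ∈ X
    · have := key v hv u huX huv.symm
      exact ⟨fun h h' => this.1 h' h, fun h => by by_contra h'; exact h (this.2 h')⟩
    · rcases hu with rfl | rfl | hu <;> rcases hv with rfl | rfl | hv
      · exact absurd huv G.irrefl
      · simp [hp, hpq]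
      · exact absurd hv hvX
      · simp [hp, hpq]
      · exact absurd huv G.irrefl
      · exact absurd hv hvX
      · exact absurd hu huX
      · exact absurd hu huX
      · exact absurd hv hvX
  have hquot := closeUp_eq_quot hy hp hq hpq hnadj hadj
  set G' := closeUp (G.comap (Subtype.val : {v // v ∉ X} → V)) ⟨p, hp⟩ ⟨q, hq⟩
      (fun h => hpq (congrArg Subtype.val h)) with hG'
  have hsurj : Function.Surjective (retract X ⟨p, hp⟩) := fun v => ⟨v, retract_of_notMem v.2⟩
  have hc' : (ofGraph G').Cubic := by
    rw [hquot]
    refine MG.quot_cubic _ fun v => ?_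
    by_cases hv : v = ⟨p, hp⟩
    · subst hv
      rw [retract_preimage_self, hcutp]
    · rw [retract_preimage (by simpa using Ne.symm hv), Set.image_singleton, hcub.cut_singleton]
  have he' : (ofGraph G').EC 2 := by rw [hquot]; exact MG.quot_EC hsurj he
  have hpq'' : G'.Adj ⟨p, hp⟩ ⟨q, hq⟩ := Or.inr (Or.inl ⟨rfl, rfl⟩)
  -- A colouring of the reduced graph separates `p` from `q`, and the path through `X` needs just
  -- that, as `x` and `y` have different colours.
  have hb' : ¬ (ofGraph G').Bip := by
    rintro ⟨B, hB⟩
    apply hb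
    have h1 := hB ⟨p, hp⟩ trivial ⟨q, hq⟩ trivial (ofGraph_ne_zero.2 hpq'')
    have hin : ∀ u v, u ∈ X → v ∈ X → G.Adj u v → (u ∈ A ↔ v ∉ A) :=
      fun u v hu hv h => hA u hu v hv (ofGraph_ne_zero.2 h)
    have hout : ∀ (u v) (hu : u ∉ X) (hv : v ∉ X), G.Adj u v →
        ((⟨u, hu⟩ : {v // v ∉ X}) ∈ B ↔ (⟨v, hv⟩ : {v // v ∉ X}) ∉ B) :=
      fun u v hu hv h => hB ⟨u, hu⟩ trivial ⟨v, hv⟩ trivial (ofGraph_ne_zero.2 (Or.inl h))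
    let C : Set V := {v | if h : v ∈ X then (v ∈ A ↔ (⟨p, hp⟩ : {v // v ∉ X}) ∉ B) else
      (⟨v, h⟩ : {v // v ∉ X}) ∈ B}
    have hCin : ∀ v ∈ X, v ∈ C ↔ (v ∈ A ↔ (⟨p, hp⟩ : {v // v ∉ X}) ∉ B) := by
      intro v hv
      simp only [C, Set.mem_ofPred_eq, hv, dif_pos]
    have hCout : ∀ (v) (hv : v ∉ X), v ∈ C ↔ (⟨v, hv⟩ : {v // v ∉ X}) ∈ B := by
      intro v hv
      simp only [C, Set.mem_ofPred_eq, hv, dif_neg, not_false_eq_true]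
    have hmix : ∀ u v, u ∈ X → v ∉ X → G.Adj u v → (u ∈ C ↔ v ∉ C) := by
      intro u v hu hv huv
      rw [hCin u hu, hCout v hv]
      rcases (hadj u hu v hv).1 huv with ⟨rfl, rfl⟩ | ⟨rfl, rfl⟩ <;> tauto
    refine ⟨C, fun u _ v _ huv => ?_⟩
    rw [ofGraph_ne_zero] at huv
    by_cases hu : u ∈ X <;> by_cases hv : v ∈ X
    · have := hin u v hu hv huv
      rw [hCin u hu, hCin v hv]; tauto
    · exact hmix u v hu hv huv
    · have := hmix v u hv hu huv.symm
      tauto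
    · rw [hCout u hu, hCout v hv]; exact hout u v hu hv huv
  -- A hidden set not contained in `X` has no edge to `X`, so it avoids `p` and `q` and is not
  -- affected by the reduction.
  have hhid : ∀ v : {v // v ∉ X}, (ofGraph G).Hidden (v : V) → (ofGraph G').Hidden v := by
    intro v hv
    obtain ⟨Y, hY, hvY⟩ := MG.hidden_iff.1 hv
    rcases hsub Y hY with h | ⟨hd, h0⟩
    · exact absurd (h hvY) v.2
    rw [MG.e, wsum_eq_zero] at h0
    have hpY : p ∉ Y := fun h => ofGraph_ne_zero.2 hxp (h0 x hx p h)
    have hqY : q ∉ Y := fun h => ofGraph_ne_zero.2 hyq (h0 y hy q h)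
    obtain ⟨hY2, B, hB⟩ := hY
    refine ⟨Subtype.val ⁻¹' Y, Subtype.val ⁻¹' B, hvY, ?_, ?_⟩
    · rw [hquot, MG.quot_cut, retract_preimage (by exact hpY)]
      have : (Subtype.val : {v // v ∉ X} → V) '' (Subtype.val ⁻¹' Y) = Y := by
        ext v
        constructor
        · rintro ⟨w, hw, rfl⟩; exact hw
        · exact fun h => ⟨⟨v, fun h' => Set.disjoint_left.1 hd h' h⟩, h, rfl⟩
      rw [this, hY2]
    · intro a ha b hb hab
      rw [ofGraph_ne_zero] at hab
      refine hB a ha b hb (ofGraph_ne_zero.2 ?_)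
      rcases hab with h | ⟨rfl, -⟩ | ⟨rfl, -⟩
      · exact h
      · exact absurd ha hpY
      · exact absurd ha hqY
  -- The reduced graph has at least four vertices that are not hidden and `G` has at most four, so
  -- the inclusion is an equality.
  have himg : Subtype.val '' {v | ¬ (ofGraph G').Hidden v} = {v | ¬ (ofGraph G).Hidden v} := by
    refine Set.eq_of_subset_of_ncard_le ?_ ?_ (Set.toFinite _)
    · rintro _ ⟨v, hv, rfl⟩ h
      exact hv (hhid v h)
    · rw [Set.ncard_image_of_injective _ Subtype.val_injective]
      exact h4.trans (MG.four_le_ncard_not_hidden hc' he' hb')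
  have hcard : Fintype.card {v // v ∉ X} < n := by
    rw [← hn]
    exact Fintype.card_subtype_lt (x := x) (by simpa using hx)
  have h4' : {v | ¬ (ofGraph G').Hidden v}.ncard ≤ 4 := by
    rw [← himg, Set.ncard_image_of_injective _ Subtype.val_injective] at h4
    exact h4
  obtain ⟨W, R, k, S, hR, ⟨ψ⟩⟩ := ih _ hcard {v // v ∉ X} G' rfl (ofGraph_cubic.1 hc') he' hb' h4'
  have : Fintype W := Fintype.ofEquiv _ ψ.toEquiv
  have hpos : ∀ v : {v // v ∉ X}, ¬ (ofGraph G).Hidden (v : V) → ∃ i, k i = ψ v := by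
    intro v hv
    have h1 : (v : V) ∈ Subtype.val '' {v | ¬ (ofGraph G').Hidden v} := by rw [himg]; exact hv
    obtain ⟨v', hv', heq'⟩ := h1
    obtain rfl := Subtype.ext heq'
    by_contra hno
    exact hv' (Hidden.congr ψ (hR.hiddenOff (ψ v') hno).hidden)
  obtain ⟨i, hi⟩ := hpos ⟨p, hp⟩ (hnot x hx p hp hxp)
  obtain ⟨j, hj⟩ := hpos ⟨q, hq⟩ (hnot y hy q hq hyq)
  have hij : i ≠ j := by
    rintro rfl
    rw [hi] at hj
    exact hpq (congrArg Subtype.val (ψ.injective hj))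
  -- The added edge `pq` is present in the reduced graph, so this edge of `K₄` has not been replaced
  -- before.
  have hS : s(i, j) ∉ S := by
    rw [← hR.adj_iff hij, hi, hj, ψ.map_adj_iff]
    exact hpq''
  have hpiece := isPiece_of_exits hc he hXc hA hx hxA hy hyA hp hq hadj
  obtain ⟨θ⟩ := exists_edgeSplice_iso hx hy hp hq hpq hnadj hadj
  refine ⟨_, _, _, _, Replaced.step R k S
    (cap (G.comap (Subtype.val : {v // v ∈ X} → V)) ![⟨x, hx⟩, ⟨y, hy⟩]) i j (.inr 0) (.inr 1) hR hij hS
    hpiece.inHDiamond (is22Edge_cap _ _), ?_⟩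
  rw [hi, hj]
  exact ⟨θ.symm.trans (edgeSpliceCongr ψ _ _ _ _ _)⟩

end NiceCubic

/-! ### Undoing a contraction by splicing. -/

namespace NiceCubic

lemma eq_of_wsum_le_one {V : Type*} [Fintype V] {w : V → V → ℕ} {X Y : Set V} (h : wsum w X Y ≤ 1)
    {x x' y y' : V} (hx : x ∈ X) (hx' : x' ∈ X) (hy : y ∈ Y) (hy' : y' ∈ Y) (h1 : w x y ≠ 0)
    (h2 : w x' y' ≠ 0) : x = x' ∧ y = y' := by
  have hpos : ∀ {Z Z' : Set V} {a b : V}, a ∈ Z → b ∈ Z' → w a b ≠ 0 → 0 < wsum w Z Z' :=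
    fun ha hb hab => wsum_pos.2 ⟨_, ha, _, hb, Nat.pos_of_ne_zero hab⟩
  constructor
  · by_contra hne
    have h3 : wsum w {x, x'} Y ≤ wsum w X Y :=
      wsum_mono (fun _ _ => le_rfl) (by rintro _ (rfl | rfl) <;> assumption) le_rfl
    rw [wsum_insert_left (by simpa using hne)] at h3
    have h4 := hpos (Z := {x}) rfl hy h1
    have h5 := hpos (Z := {x'}) rfl hy' h2
    omega
  · by_contra hne
    have h3 : wsum w X {y, y'} ≤ wsum w X Y :=
      wsum_mono (fun _ _ => le_rfl) le_rfl (by rintro _ (rfl | rfl) <;> assumption)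
    rw [wsum_insert_right (by simpa using hne)] at h3
    have h4 := hpos (Z' := {y}) hx rfl h1
    have h5 := hpos (Z' := {y'}) hx' rfl h2
    omega

/-- A graph is recovered by splicing from the contraction of a set to a vertex and the contraction
of its complement. -/
theorem exists_splice_iso {V : Type u} [Fintype V] {V₁ : Type v} {G : SimpleGraph V}
    {G₁ : SimpleGraph V₁} {f : V → V₁} {x : V₁}
    (hq : ∀ p q, ((ofGraph G).quot f).m p q = (ofGraph G₁).m p q)
    (hf : ∀ p, p ≠ x → ∃ v, f ⁻¹' {p} = {v}) {X : Set V} (hX : f ⁻¹' {x} = X)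
    {H : SimpleGraph (Option X)} (hH : (ofGraph G).contract X = ofGraph H) :
    ∃ (φ : G₁.neighborSet x ≃ H.neighborSet none) (ψ : G ≃g splice G₁ H x none φ),
      ∀ v (h : f v ≠ x), ψ v = .inl ⟨f v, h⟩ := by
  classical
  have hXf : ∀ {v}, v ∈ X ↔ f v = x := by intro v; rw [← hX]; rfl
  choose σ hσ using hf
  have hfσ : ∀ a (ha : a ≠ x), f (σ a ha) = a := by
    intro a ha
    have : σ a ha ∈ f ⁻¹' {a} := by rw [hσ a ha]; rfl
    exact this
  have hσf : ∀ v (hv : f v ≠ x), σ (f v) hv = v := by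
    intro v hv
    have : v ∈ f ⁻¹' {f v} := rfl
    rw [hσ _ hv] at this
    exact this.symm
  have hσX : ∀ a ha, σ a ha ∉ X := fun a ha h => ha ((hfσ a ha).symm.trans (hXf.1 h))
  have hm : ∀ a (ha : a ≠ x), (ofGraph G).e X {σ a ha} = (ofGraph G₁).m x a := by
    intro a ha
    rw [← hq, MG.quot_m _ ha.symm, hσ a ha, hX]
  have hex : ∀ a : G₁.neighborSet x, ∃ u : X, G.Adj u (σ a a.2.ne') := by
    intro a
    have h1 : 0 < (ofGraph G).e X {σ a a.2.ne'} := by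
      rw [hm, ofGraph_adj (G := G₁) a.2]; exact one_pos
    rw [MG.e, wsum_pos] at h1
    obtain ⟨u, hu, _, rfl, h⟩ := h1
    exact ⟨⟨u, hu⟩, ofGraph_ne_zero.1 h.ne'⟩
  -- Since `G₁` and `H` are simple, the edges leaving `X` have distinct ends on either side. They
  -- therefore define the bijection between the neighbours of `x` and those of `none`.
  have huniq : ∀ a (ha : a ≠ x) (u u' : X), G.Adj u (σ a ha) → G.Adj u' (σ a ha) → u = u' := by
    intro a ha u u' h h'
    have h1 := (hm a ha).trans_le (ofGraph_le_one x a)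
    exact Subtype.ext (eq_of_wsum_le_one h1 u.2 u'.2 rfl rfl (ofGraph_ne_zero.2 h)
      (ofGraph_ne_zero.2 h')).1
  have huniq' : ∀ (u : X) (w w' : V), w ∉ X → w' ∉ X → G.Adj u w → G.Adj u w' → w = w' := by
    intro u w w' hw hw' h h'
    have h1 := ofGraph_le_one (G := H) none (MG.pr X (u : V))
    rw [← hH, MG.contract_none_left u.2] at h1
    exact (eq_of_wsum_le_one h1 rfl rfl hw hw' (ofGraph_ne_zero.2 h)
      (ofGraph_ne_zero.2 h')).2
  have hnone : ∀ u : X, H.Adj none (some u) ↔ ∃ w ∉ X, G.Adj u w := by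
    intro u
    rw [← ofGraph_ne_zero, ← hH, ← MG.pr_coe, MG.contract_none_left u.2, ← Nat.pos_iff_ne_zero, wsum_pos]
    constructor
    · rintro ⟨_, rfl, w, hw, h⟩
      exact ⟨w, hw, ofGraph_ne_zero.1 h.ne'⟩
    · rintro ⟨w, hw, h⟩
      exact ⟨_, rfl, w, hw, Nat.pos_of_ne_zero (ofGraph_ne_zero.2 h)⟩
  have hx : ∀ w ∉ X, ∀ u ∈ X, G.Adj u w → G₁.Adj x (f w) := by
    intro w hw u hu h
    rw [← ofGraph_ne_zero, ← hm _ (mt hXf.2 hw), ← Nat.pos_iff_ne_zero, wsum_pos, hσf]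
    exact ⟨u, hu, w, rfl, Nat.pos_of_ne_zero (ofGraph_ne_zero.2 h)⟩
  choose t ht using hex
  let φ₀ : G₁.neighborSet x → H.neighborSet none :=
    fun a => ⟨some (t a), (hnone _).2 ⟨_, hσX _ _, ht a⟩⟩
  have hφ₀ : Function.Bijective φ₀ := by
    constructor
    · intro a a' h
      have h1 : t a = t a' := Option.some_injective _ (congrArg Subtype.val h)
      have h2 := huniq' (t a) _ _ (hσX _ _) (hσX _ _) (ht a) (h1 ▸ ht a')
      exact Subtype.ext (by rw [← hfσ a a.2.ne', h2, hfσ])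
    · rintro ⟨_ | u, hu⟩
      · exact absurd hu H.irrefl
      · obtain ⟨w, hw, h⟩ := (hnone u).1 hu
        have ha := hx w hw u u.2 h
        refine ⟨⟨f w, ha⟩, Subtype.ext ?_⟩
        show some (t ⟨f w, ha⟩) = some u
        rw [huniq (f w) (mt hXf.2 hw) (t ⟨f w, ha⟩) u (ht ⟨f w, ha⟩) (by rwa [hσf])]
  let φ := Equiv.ofBijective φ₀ hφ₀
  have hφ : ∀ (a : {a // a ≠ x}) (u : X),
      (∃ h : G₁.Adj x a, (φ ⟨a, h⟩ : Option X) = some u) ↔ G.Adj (σ a a.2) u := by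
    intro a u
    constructor
    · rintro ⟨h, h'⟩
      have h1 : t ⟨a, h⟩ = u := Option.some_injective _ h'
      rw [← h1]
      exact (ht ⟨a, h⟩).symm
    · intro h
      have ha := hx _ (hσX a a.2) u u.2 h.symm
      rw [hfσ] at ha
      refine ⟨ha, ?_⟩
      show some (t ⟨a, ha⟩) = some u
      rw [huniq a a.2 _ u (ht ⟨a, ha⟩) h.symm]
  let g : {a // a ≠ x} ⊕ {b : Option X // b ≠ none} → V :=
    Sum.elim (fun a => σ a a.2) (fun b => ((Option.get b.1 (Option.isSome_iff_ne_none.2 b.2) : X) : V))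
  have hB : ∀ b : {b : Option X // b ≠ none}, ∃ u : X, b = ⟨some u, by simp⟩ := by
    rintro ⟨_ | u, h⟩
    · exact absurd rfl h
    · exact ⟨u, rfl⟩
  have hg : Function.Bijective g := by
    constructor
    · rintro (a | b) (a' | b') h
      · have h1 : σ a a.2 = σ a' a'.2 := h
        have h2 : (a : V₁) = a' := by rw [← hfσ a a.2, h1, hfσ]
        rw [Subtype.ext h2]
      · obtain ⟨u, rfl⟩ := hB b'
        exact absurd (show σ a a.2 ∈ X from (show σ a a.2 = u from h) ▸ u.2) (hσX _ _)
      · obtain ⟨u, rfl⟩ := hB b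
        exact absurd (show σ a' a'.2 ∈ X from (show (u : V) = σ a' a'.2 from h) ▸ u.2) (hσX _ _)
      · obtain ⟨u, rfl⟩ := hB b
        obtain ⟨u', rfl⟩ := hB b'
        obtain rfl : u = u' := Subtype.ext h
        rfl
    · intro v
      by_cases hv : v ∈ X
      · exact ⟨.inr ⟨some ⟨v, hv⟩, by simp⟩, rfl⟩
      · exact ⟨.inl ⟨f v, mt hXf.2 hv⟩, hσf v _⟩
  let ψ : splice G₁ H x none φ ≃g G :=
    { toEquiv := Equiv.ofBijective g hg
      map_rel_iff' := by
        intro a b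
        show G.Adj (g a) (g b) ↔ _
        rcases a with a | a <;> rcases b with b | b
        · show G.Adj (σ a a.2) (σ b b.2) ↔ G₁.Adj a b
          by_cases hab : (a : V₁) = b
          · obtain rfl := Subtype.ext hab
            simp
          · rw [← ofGraph_ne_zero, ← ofGraph_ne_zero, ← hq, MG.quot_m _ hab, hσ a a.2, hσ b b.2, MG.e,
              wsum_singleton]
        · obtain ⟨u, rfl⟩ := hB b
          exact (hφ a u).symm
        · obtain ⟨u, rfl⟩ := hB a
          exact (G.adj_comm _ _).trans (hφ b u).symm
        · obtain ⟨u, rfl⟩ := hB a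
          obtain ⟨u', rfl⟩ := hB b
          show G.Adj u u' ↔ H.Adj (some u) (some u')
          rw [← ofGraph_ne_zero, ← ofGraph_ne_zero, ← hH, ← MG.pr_coe, ← MG.pr_coe,
            MG.contract_m u.2 u'.2] }
  refine ⟨φ, ψ.symm, fun v h => ?_⟩
  have : v = ψ (.inl ⟨f v, h⟩) := (hσf v h).symm
  conv_lhs => rw [this]
  simp

/-- The simple graph of a multigraph. -/
def toGraph {V : Type u} (M : MG V) : SimpleGraph V where
  Adj x y := M.m x y ≠ 0
  symm := ⟨fun x y h => by rwa [M.symm]⟩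
  loopless := ⟨fun x h => h (M.loopless x)⟩

lemma ofGraph_toGraph {V : Type u} {M : MG V} (h : ∀ x y, M.m x y ≤ 1) : ofGraph (toGraph M) = M := by
  refine MG.ext_m fun x y => ?_
  have := h x y
  have h2 : (toGraph M).Adj x y ↔ M.m x y ≠ 0 := Iff.rfl
  by_cases h3 : (toGraph M).Adj x y
  · rw [ofGraph_adj h3]; rw [h2] at h3; omega
  · rw [ofGraph_not_adj h3]; rw [h2] at h3; omega

section contract
variable {V : Type u} [Fintype V] {M : MG V}

lemma three_le_ncard (hc : M.Cubic) {X : Set V} (hX : M.cut X = 3) (h1 : ¬ ∃ v, X = {v}) : 3 ≤ X.ncard := by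
  have h2 := hc.cut_parity X
  have h3 : X.ncard ≠ 1 := fun h => h1 (Set.ncard_eq_one.1 h)
  omega

lemma ofGraph_contract (hc : M.Cubic) (he : M.EC 3) {X : Set V} (hX : M.cut X = 3)
    (hne : Xᶜ.Nonempty) (h3 : 3 ≤ X.ncard) : ofGraph (toGraph (M.contract X)) = M.contract X :=
  ofGraph_toGraph (MG.m_le_one (MG.contract_cubic hc hX) (MG.contract_EC he hne)
    (by rw [MG.card_option_coe]; omega))

/-- All leaving edges start in `A`, so the contraction vertex can join the other colour class. -/
lemma inHHat_contract (hc : M.Cubic) (he : M.EC 3) {X : Set V} (hX : M.cut X = 3)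
    (hne : Xᶜ.Nonempty) (h3 : 3 ≤ X.ncard) {A : Set V} (hA : M.ColOn X A)
    (hexit : ∀ x ∈ X, ∀ y ∉ X, M.m x y ≠ 0 → x ∈ A) : InHHat (toGraph (M.contract X)) := by
  have hq := ofGraph_contract hc he hX hne h3
  have hcub : IsCubic (toGraph (M.contract X)) := by
    rw [← ofGraph_cubic, hq]; exact MG.contract_cubic hc hX
  refine ⟨inferInstance, hcub, isKConnected_three hcub ?_ ?_, ?_⟩
  · rw [hq]; exact MG.contract_EC he hne
  · rw [MG.card_option_coe]; omega
  · have key : ∀ u : X, (M.contract X).m (some u) none ≠ 0 → (u : V) ∈ A := by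
      intro u hu
      rw [← MG.pr_coe, MG.contract_none u.2, ← Nat.pos_iff_ne_zero, wsum_pos] at hu
      obtain ⟨_, rfl, w, hw, h⟩ := hu
      exact hexit u u.2 w hw h.ne'
    refine isBipartite_of_colour (A := {o | ∃ u : X, o = some u ∧ (u : V) ∈ A}) ?_
    rintro (_ | u) (_ | w) h
    · exact absurd h (toGraph (M.contract X)).irrefl
    · have := key w h.symm
      simpa using this
    · have := key u h
      simpa using this
    · have h1 : (M.contract X).m (MG.pr X (u : V)) (MG.pr X (w : V)) ≠ 0 := by
        rw [MG.pr_coe, MG.pr_coe]; exact h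
      rw [MG.contract_m u.2 w.2] at h1
      simpa using hA u u.2 w w.2 h1

end contract
end NiceCubic

/-! ### Isomorphism invariance, and splicings as expansions. -/

namespace NiceCubic

section congr
variable {V : Type u} {W : Type v} [Fintype V] [Fintype W] {G : SimpleGraph V} {R : SimpleGraph W}

lemma ofGraph_iso {V : Type u} {W : Type v} {G : SimpleGraph V} {R : SimpleGraph W} (φ : G ≃g R) (x y : V) : (ofGraph R).m (φ x) (φ y) = (ofGraph G).m x y := by
  by_cases h : G.Adj x y
  · rw [ofGraph_adj h, ofGraph_adj (φ.map_adj_iff.2 h)]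
  · rw [ofGraph_not_adj h, ofGraph_not_adj (fun h' => h (φ.map_adj_iff.1 h'))]

lemma cubic_congr (φ : G ≃g R) (h : (ofGraph G).Cubic) : (ofGraph R).Cubic := by
  intro y
  obtain ⟨x, rfl⟩ := φ.surjective y
  rw [← h x, ← φ.toEquiv.sum_comp]
  exact Finset.sum_congr rfl fun z _ => ofGraph_iso φ x z

lemma nice_congr (φ : G ≃g R) {x : V} (h : (ofGraph G).Nice x) : (ofGraph R).Nice (φ x) := by
  obtain ⟨F, hs, hle, hd⟩ := h
  refine ⟨fun a b => F (φ.symm a) (φ.symm b), fun a b => hs _ _, fun a b => ?_, fun a => ?_⟩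
  · refine (hle _ _).trans (le_of_eq ?_)
    rw [← ofGraph_iso φ]
    simp
  · refine ((φ.symm.toEquiv.sum_comp (fun b => F (φ.symm a) b)).trans (hd _)).trans ?_
    have : φ.symm a = x ↔ a = φ x := by
      constructor
      · rintro rfl; simp
      · rintro rfl; simp
    by_cases h : a = φ x
    · rw [if_pos h]; exact if_pos (this.2 h)
    · rw [if_neg h]; exact if_neg (fun h' => h (this.1 h'))

lemma niceNum_congr (φ : G ≃g R) : (ofGraph G).niceNum = (ofGraph R).niceNum := by
  refine le_antisymm ?_ ?_
  · rw [MG.niceNum, ← Set.ncard_image_of_injective _ φ.injective]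
    refine Set.ncard_le_ncard ?_ (Set.toFinite _)
    rintro _ ⟨x, hx, rfl⟩
    exact nice_congr φ hx
  · rw [MG.niceNum, ← Set.ncard_image_of_injective _ φ.symm.injective]
    refine Set.ncard_le_ncard ?_ (Set.toFinite _)
    rintro _ ⟨x, hx, rfl⟩
    exact nice_congr φ.symm hx

end congr

lemma MG.quot_equiv {V : Type u} {W : Type v} [Fintype V] {M : MG V} {N : MG W} (φ : V ≃ W)
    (h : ∀ x y, N.m (φ x) (φ y) = M.m x y) : M.quot φ = N := by
  refine MG.ext_m fun p q => ?_
  by_cases hpq : p = q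
  · subst hpq; rw [MG.loopless, MG.loopless]
  · obtain ⟨x, rfl⟩ := φ.surjective p
    obtain ⟨y, rfl⟩ := φ.surjective q
    have h1 : ∀ x, φ ⁻¹' {φ x} = {x} := by intro x; ext; simp
    rw [MG.quot_m _ hpq, h1, h1, MG.e, wsum_singleton, h]

lemma MG.colOn_singleton {V : Type u} [Fintype V] (M : MG V) (v : V) (A : Set V) : M.ColOn {v} A := by
  rintro _ rfl _ rfl h
  exact absurd (M.loopless _) h

lemma MG.isShape_id : (ofGraph K33Triangle).IsShape id := by
  refine ⟨fun p q => ?_, fun j => ⟨_, rfl⟩, fun j => ⟨_, rfl⟩, fun s => ⟨Set.univ, ?_, ?_⟩⟩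
  · have := MG.quot_equiv (M := ofGraph K33Triangle) (Equiv.refl _) (fun x y => rfl)
    exact congrArg (fun N : MG _ => N.m p q) this
  · exact (ofGraph K33Triangle).colOn_singleton _ _
  · exact fun _ _ _ _ _ => trivial

/-- One unexpanded `labX` vertex is blown up to a coloured piece, while the other piece is pulled
back. Applying this once or twice covers `InG1` and `InG2`. -/
lemma MG.IsShape.of_quot {V : Type u} {P : Type v} [Fintype V] [Fintype P] {M : MG V} {N : MG P}
    {ρ : V → P} (hρ : M.quot ρ = N) {f : P → K33TriangleVertex} (h : N.IsShape f) {x : P}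
    {s₀ : Fin 2} (hx : f ⁻¹' {NiceCubic.labX s₀} = {x}) (hone : ∀ p, p ≠ x → ∃ v, ρ ⁻¹' {p} = {v})
    {A : Set V} (hA : M.ColOn (ρ ⁻¹' {x}) A)
    (hexit : ∀ u, ρ u = x → ∀ v, ρ v ≠ x → M.m u v ≠ 0 → u ∈ A) : M.IsShape (f ∘ ρ) := by
  have hfx : f x = NiceCubic.labX s₀ := by
    have : x ∈ f ⁻¹' {NiceCubic.labX s₀} := by rw [hx]; rfl
    exact this
  have hsing : ∀ p : K33TriangleVertex, p ≠ NiceCubic.labX s₀ → (∃ v, f ⁻¹' {p} = {v}) →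
      ∃ v, f ∘ ρ ⁻¹' {p} = {v} := by
    rintro p hp ⟨v, hv⟩
    have hvx : v ≠ x := by
      rintro rfl
      have : v ∈ f ⁻¹' {p} := by rw [hv]; rfl
      exact hp ((show f v = p from this).symm.trans hfx)
    obtain ⟨w, hw⟩ := hone v hvx
    exact ⟨w, by rw [Set.preimage_comp, hv, hw]⟩
  refine ⟨fun p q => ?_, fun j => hsing _ labX_ne_labB.symm (h.labB j),
    fun j => hsing _ labX_ne_labT.symm (h.labT j), fun s => ?_⟩
  · rw [← MG.quot_comp, hρ, h.quot]
  · by_cases hs : s = s₀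
    · subst hs
      refine ⟨A, ?_, fun u hu v hv huv => ?_⟩
      · rw [Set.preimage_comp, hx]; exact hA
      · have hu' : ρ u ∈ f ⁻¹' {NiceCubic.labX s} := hu
        have hv' : ρ v ∉ f ⁻¹' {NiceCubic.labX s} := hv
        rw [hx] at hu' hv'
        exact hexit u hu' v hv' huv
    · obtain ⟨B, hB, hBexit⟩ := h.labX s
      have hne : ∀ u, f (ρ u) = NiceCubic.labX s → ρ u ≠ x := by
        intro u hu hux
        rw [hux, hfx, labX_inj] at hu
        exact hs hu.symm
      have hmono : ∀ u v, ρ u ≠ x → M.m u v ≠ 0 → N.m (ρ u) (ρ v) ≠ 0 := by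
        intro u v hu huv
        have hne' : ρ u ≠ ρ v := by
          intro heq
          obtain ⟨w, hw⟩ := hone _ hu
          have h1 : u ∈ ρ ⁻¹' {ρ u} := rfl
          have h2 : v ∈ ρ ⁻¹' {ρ u} := heq.symm
          rw [hw] at h1 h2
          rw [Set.mem_singleton_iff] at h1 h2
          rw [h1, h2] at huv
          exact huv (M.loopless _)
        rw [← hρ, quot_m _ hne', ← Nat.pos_iff_ne_zero, wsum_pos]
        exact ⟨u, rfl, v, rfl, Nat.pos_of_ne_zero huv⟩
      refine ⟨ρ ⁻¹' B, fun u hu v hv huv => ?_, fun u hu v hv huv => ?_⟩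
      · exact hB _ hu _ hv (hmono u v (hne u hu) huv)
      · exact hBexit _ hu _ hv (hmono u v (hne u hu) huv)

section splice
variable {V : Type u} {W : Type v} {G₁ : SimpleGraph V} {H : SimpleGraph W} {x : V} {y : W}
  {φ : G₁.neighborSet x ≃ H.neighborSet y}

/-- The projection of a splicing to the first graph. -/
def spliceProj (x : V) (y : W) : {a : V // a ≠ x} ⊕ {b : W // b ≠ y} → V :=
  Sum.elim Subtype.val fun _ => x

lemma spliceProj_preimage_self : spliceProj x y ⁻¹' {x} = Set.range Sum.inr := by
  ext (a | b)
  · simpa [spliceProj] using a.2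
  · simp [spliceProj]

lemma spliceProj_preimage {p : V} (hp : p ≠ x) : spliceProj x y ⁻¹' {p} = {.inl ⟨p, hp⟩} := by
  ext (a | b)
  · simp [spliceProj, Subtype.ext_iff]
  · simp [spliceProj, hp.symm]

lemma quot_splice [Fintype ({a : V // a ≠ x} ⊕ {b : W // b ≠ y})] :
    (ofGraph (splice G₁ H x y φ)).quot (spliceProj x y) = ofGraph G₁ := by
  classical
  have hx : ∀ q, q ≠ x → ((ofGraph (splice G₁ H x y φ)).quot (spliceProj x y)).m x q =
      (ofGraph G₁).m x q := by
    intro q hq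
    rw [MG.quot_m _ hq.symm, spliceProj_preimage_self, spliceProj_preimage hq, MG.e,
      wsum_comm (ofGraph _).symm, wsum_singleton_left]
    by_cases h : G₁.Adj x q
    · have hne : (φ ⟨q, h⟩ : W) ≠ y := (φ ⟨q, h⟩).2.ne'
      rw [ofGraph_adj h, Finset.sum_eq_single (.inr ⟨φ ⟨q, h⟩, hne⟩)]
      · rw [if_pos ⟨_, rfl⟩]
        exact ofGraph_adj ⟨h, rfl⟩
      · rintro (b | b) _ hb
        · simp
        · rw [if_pos ⟨_, rfl⟩]
          refine ofGraph_not_adj ?_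
          rintro ⟨_, h2⟩
          exact hb (congrArg Sum.inr (Subtype.ext h2.symm))
      · simp
    · rw [ofGraph_not_adj h]
      refine Finset.sum_eq_zero ?_
      rintro (b | b) _
      · simp
      · rw [if_pos ⟨_, rfl⟩]
        refine ofGraph_not_adj ?_
        rintro ⟨h2, -⟩
        exact h h2
  refine MG.ext_m fun p q => ?_
  by_cases hpq : p = q
  · subst hpq; rw [MG.loopless, MG.loopless]
  by_cases hp : p = x
  · subst hp; exact hx q (Ne.symm hpq)
  by_cases hq : q = x
  · subst hq; rw [MG.symm, hx p hpq, MG.symm]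
  · rw [MG.quot_m _ hpq, spliceProj_preimage hp, spliceProj_preimage hq, MG.e, wsum_singleton]
    rfl

/-- The edges leaving the inserted part start at former neighbours of `y`, which all have the colour
opposite to `y`. -/
lemma exists_colOn_splice [Fintype ({a : V // a ≠ x} ⊕ {b : W // b ≠ y})] (hH : H.IsBipartite) :
    ∃ A, (ofGraph (splice G₁ H x y φ)).ColOn (spliceProj x y ⁻¹' {x}) A ∧
      ∀ u, spliceProj x y u = x → ∀ v, spliceProj x y v ≠ x →
        (ofGraph (splice G₁ H x y φ)).m u v ≠ 0 → u ∈ A := by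
  obtain ⟨B, hB⟩ := exists_colour_of_isBipartite hH
  refine ⟨{z | Sum.elim (fun _ => True) (fun b => ((b : W) ∈ B ↔ y ∉ B)) z}, ?_, ?_⟩
  · rw [spliceProj_preimage_self]
    rintro _ ⟨a, rfl⟩ _ ⟨b, rfl⟩ hab
    rw [ofGraph_ne_zero] at hab
    have := hB a b hab
    show ((a : W) ∈ B ↔ y ∉ B) ↔ ¬ ((b : W) ∈ B ↔ y ∉ B)
    tauto
  · intro u hu v hv huv
    rcases u with a | b
    · exact absurd hu a.2
    rcases v with a | b'
    · obtain ⟨h, h'⟩ := ofGraph_ne_zero.1 huv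
      have := hB y b (h' ▸ (φ ⟨a, h⟩).2)
      show (b : W) ∈ B ↔ y ∉ B
      tauto
    · exact absurd rfl hv

end splice

lemma not_nice_labX (s : Fin 2) : ¬ (ofGraph K33Triangle).Nice (labX s) :=
  MG.isShape_id.not_nice K33Triangle_cubic rfl

lemma not_isNice_labX (s : Fin 2) : ¬ IsNice K33Triangle (labX s) := by
  rw [isNice_iff (ofGraph_cubic.1 K33Triangle_cubic)]
  exact not_nice_labX s

end NiceCubic

/-! ### The nice vertices of `K₃,₃^△` and the families `InG1`, `InG2`. -/

namespace NiceCubic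

/-- A symmetric weight on labels from its blocks. -/
def blockWeight (a : Fin 2 → Fin 3 → ℕ) (b c : Fin 3 → Fin 3 → ℕ) :
    Fin 2 ⊕ (Fin 3 ⊕ Fin 3) → Fin 2 ⊕ (Fin 3 ⊕ Fin 3) → ℕ
  | .inl s, .inr (.inl i) => a s i
  | .inr (.inl i), .inl s => a s i
  | .inr (.inl i), .inr (.inr k) => b i k
  | .inr (.inr k), .inr (.inl i) => b i k
  | .inr (.inr i), .inr (.inr k) => c i k
  | _, _ => 0

lemma nice_of_blockWeight {a : Fin 2 → Fin 3 → ℕ} {b c : Fin 3 → Fin 3 → ℕ} {l : Fin 2 ⊕ (Fin 3 ⊕ Fin 3)}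
    (ha : ∀ s i, a s i ≤ 1) (hb : ∀ i k, b i k ≤ if i = k then 1 else 0)
    (hc : ∀ i k, c i k ≤ if i = k then 0 else 1) (hcs : ∀ i k, c i k = c k i)
    (hd : ∀ p, ∑ q, blockWeight a b c p q = if p = l then 3 else 1) :
    (ofGraph K33Triangle).Nice (lab l) := by
  classical
  let e := Equiv.ofBijective lab lab_bijective
  have he : ∀ p, e.symm (lab p) = p := fun p => e.symm_apply_apply p
  refine ⟨fun p q => blockWeight a b c (e.symm p) (e.symm q), fun p q => ?_, fun p q => ?_, fun p => ?_⟩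
  · generalize e.symm p = p
    generalize e.symm q = q
    rcases p with p | p | p <;> rcases q with q | q | q <;> simp [blockWeight, hcs]
  · obtain ⟨p, rfl⟩ := lab_bijective.2 p
    obtain ⟨q, rfl⟩ := lab_bijective.2 q
    rw [he, he]
    rcases p with p | p | p <;> rcases q with q | q | q <;> simp only [blockWeight, Nat.zero_le]
    · exact (ha _ _).trans (ofGraph_adj (adj_labX_labB _ _)).ge
    · exact (ha _ _).trans (ofGraph_adj (adj_labX_labB _ _).symm).ge
    · refine (hb _ _).trans ?_
      split_ifs with h
      · exact (ofGraph_adj ((adj_labB_labT _ _).2 h)).ge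
      · exact Nat.zero_le _
    · refine (hb _ _).trans ?_
      split_ifs with h
      · exact (ofGraph_adj ((adj_labB_labT _ _).2 h).symm).ge
      · exact Nat.zero_le _
    · refine (hc _ _).trans ?_
      split_ifs with h
      · exact Nat.zero_le _
      · exact (ofGraph_adj ((adj_labT_labT _ _).2 h)).ge
  · obtain ⟨p, rfl⟩ := lab_bijective.2 p
    rw [he, e.symm.sum_comp (fun q => blockWeight a b c p q), hd]
    simp only [lab_bijective.1.eq_iff]

/-- The factor consists of both edges from the `labX` vertices to `labB j` and the three edges
between `labB` and `labT`. -/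
lemma nice_labB (j : Fin 3) : (ofGraph K33Triangle).Nice (labB j) := by
  refine nice_of_blockWeight (a := fun _ i => if i = j then 1 else 0)
    (b := fun i k => if i = k then 1 else 0) (c := fun _ _ => 0) (l := .inr (.inl j)) ?_ ?_ ?_ ?_ ?_
  · revert j; decide
  · decide
  · decide
  · decide
  · revert j; decide

/-- The factor takes all edges at `labT j` and matches the two `labX` vertices with the other two
`labB` vertices, of indices `j + 1` and `j + 2`. -/
lemma nice_labT (j : Fin 3) : (ofGraph K33Triangle).Nice (labT j) := by
  refine nice_of_blockWeight (a := fun s i => if i = j + 1 + s.castSucc then 1 else 0)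
    (b := fun i k => if i = k ∧ i = j then 1 else 0)
    (c := fun i k => if i ≠ k ∧ (i = j ∨ k = j) then 1 else 0) (l := .inr (.inr j)) ?_ ?_ ?_ ?_ ?_
  · revert j; decide
  · revert j; decide
  · revert j; decide
  · revert j; decide
  · revert j; decide

lemma exists_labX {x : K33TriangleVertex} (h : ¬ IsNice K33Triangle x) : ∃ s, x = labX s := by
  rw [isNice_iff (ofGraph_cubic.1 K33Triangle_cubic)] at h
  rcases lab_cases x with ⟨s, rfl⟩ | ⟨s, rfl⟩ | ⟨s, rfl⟩
  · exact ⟨s, rfl⟩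
  · exact absurd (nice_labB s) h
  · exact absurd (nice_labT s) h

section families
variable {V : Type u} [Fintype V] {G : SimpleGraph V}

lemma niceNum_le_six_of_shape (hc : IsCubic G) {W : Type v} [Fintype W] {R : SimpleGraph W} (φ : G ≃g R)
    {f : W → K33TriangleVertex} (h : (ofGraph R).IsShape f) : (ofGraph G).niceNum ≤ 6 := by
  rw [niceNum_congr φ]
  obtain ⟨h1, h2⟩ := h.niceNum_le (cubic_congr φ (ofGraph_cubic.2 hc))
  omega

lemma niceNum_le_six_of_iso (hc : IsCubic G) (φ : G ≃g K33Triangle) : (ofGraph G).niceNum ≤ 6 :=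
  niceNum_le_six_of_shape hc φ MG.isShape_id

lemma InG1.niceNum_le_six (hc : IsCubic G) (h : InG1 G) : (ofGraph G).niceNum ≤ 6 := by
  classical
  obtain ⟨W, H, x, y, φ, ⟨_, -, -, hH⟩, hx, ⟨ψ⟩⟩ := h
  obtain ⟨s, rfl⟩ := exists_labX hx
  have : Fintype ({a // a ≠ labX s} ⊕ {b : W // b ≠ y}) := Fintype.ofEquiv _ ψ.toEquiv
  obtain ⟨A, hA, hexit⟩ := exists_colOn_splice (G₁ := K33Triangle) (φ := φ) hH
  exact niceNum_le_six_of_shape hc ψ (MG.isShape_id.of_quot quot_splice (s₀ := s) rfl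
    (fun p hp => ⟨_, spliceProj_preimage hp⟩) hA hexit)

lemma InG2.niceNum_le_six (hc : IsCubic G) (h : InG2 G) : (ofGraph G).niceNum ≤ 6 := by
  classical
  obtain ⟨W₁, W₂, H₁, H₂, x₁, x₂, hx, y₁, y₂, φ₁, φ₂, ⟨_, -, -, hH₁⟩, ⟨_, -, -, hH₂⟩, hx₁, hx₂, ⟨ψ⟩⟩ := h
  obtain ⟨s₁, rfl⟩ := exists_labX hx₁
  obtain ⟨s₂, rfl⟩ := exists_labX hx₂
  have : Fintype ({a // a ≠ labX s₁} ⊕ {b : W₁ // b ≠ y₁}) := Fintype.ofFinite _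
  have : Fintype ({a : {a // a ≠ labX s₁} ⊕ {b : W₁ // b ≠ y₁} // a ≠ .inl ⟨labX s₂, hx⟩} ⊕
    {b : W₂ // b ≠ y₂}) := Fintype.ofEquiv _ ψ.toEquiv
  obtain ⟨A₁, hA₁, hexit₁⟩ := exists_colOn_splice (G₁ := K33Triangle) (φ := φ₁) hH₁
  obtain ⟨A₂, hA₂, hexit₂⟩ := exists_colOn_splice (G₁ := splice K33Triangle H₁ _ y₁ φ₁) (φ := φ₂) hH₂
  have hshape := MG.isShape_id.of_quot (quot_splice (φ := φ₁)) (s₀ := s₁) rfl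
    (fun p hp => ⟨_, spliceProj_preimage hp⟩) hA₁ hexit₁
  exact niceNum_le_six_of_shape hc ψ (hshape.of_quot quot_splice (s₀ := s₂)
    (spliceProj_preimage (y := y₁) hx) (fun p hp => ⟨_, spliceProj_preimage hp⟩) hA₂ hexit₂)

lemma exists_iso_of_fibres {W : Type v} {R : SimpleGraph W} {f : V → W}
    (hq : ∀ p q, ((ofGraph G).quot f).m p q = (ofGraph R).m p q) (hf : ∀ p, ∃ v, f ⁻¹' {p} = {v}) :
    Nonempty (G ≃g R) := by
  have hb : Function.Bijective f := by
    constructor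
    · intro a b hab
      obtain ⟨v, hv⟩ := hf (f b)
      have h1 : a ∈ f ⁻¹' {f b} := hab
      have h2 : b ∈ f ⁻¹' {f b} := rfl
      rw [hv] at h1 h2
      exact (Set.mem_singleton_iff.1 h1).trans (Set.mem_singleton_iff.1 h2).symm
    · intro p
      obtain ⟨v, hv⟩ := hf p
      have : v ∈ f ⁻¹' {p} := by rw [hv]; rfl
      exact ⟨v, this⟩
  have h1 : ∀ x, f ⁻¹' {f x} = {x} := fun x => by ext; simp [hb.1.eq_iff]
  refine ⟨⟨Equiv.ofBijective f hb, ?_⟩⟩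
  intro a b
  show R.Adj (f a) (f b) ↔ G.Adj a b
  by_cases hab : a = b
  · subst hab; simp
  · rw [← ofGraph_ne_zero, ← ofGraph_ne_zero, ← hq, MG.quot_m _ (hb.1.ne hab), h1, h1, MG.e, wsum_singleton]

lemma MG.IsShape.exists_fibre {f : V → K33TriangleVertex} {M : MG V} (h : M.IsShape f)
    {p : K33TriangleVertex} (hp : ∀ s, p = NiceCubic.labX s → ∃ v, f ⁻¹' {p} = {v}) :
    ∃ v, f ⁻¹' {p} = {v} := by
  rcases lab_cases p with ⟨s, rfl⟩ | ⟨s, rfl⟩ | ⟨s, rfl⟩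
  · exact hp s rfl
  · exact h.labB s
  · exact h.labT s

lemma MG.IsShape.inG1 (hc : IsCubic G) (he : (ofGraph G).EC 3) {f : V → K33TriangleVertex}
    (h : (ofGraph G).IsShape f) {s : Fin 2} (hs : ¬ ∃ v, f ⁻¹' {NiceCubic.labX s} = {v})
    (hs' : ∀ r, r ≠ s → ∃ v, f ⁻¹' {NiceCubic.labX r} = {v}) : InG1 G := by
  have hcub := ofGraph_cubic.2 hc
  have hcut := h.cut_fibre (NiceCubic.labX s)
  have h3 := three_le_ncard hcub hcut hs
  have hne : (f ⁻¹' {NiceCubic.labX s})ᶜ.Nonempty := by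
    obtain ⟨v, hv⟩ := h.labB 0
    have : v ∈ f ⁻¹' {NiceCubic.labB 0} := by rw [hv]; rfl
    exact ⟨v, fun h' => labX_ne_labB ((show f v = _ from h').symm.trans this)⟩
  obtain ⟨A, hA, hexit⟩ := h.labX s
  obtain ⟨φ, ψ, -⟩ := exists_splice_iso h.quot (x := NiceCubic.labX s) (fun p hp => h.exists_fibre (by
    rintro r rfl
    exact hs' r fun hrs => hp (congrArg _ hrs))) rfl (ofGraph_contract hcub he hcut hne h3).symm
  exact ⟨_, _, _, _, φ, inHHat_contract hcub he hcut hne h3 hA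
    (fun x hx y hy hxy => hexit x hx y hy hxy), not_isNice_labX s, ⟨ψ⟩⟩

/-- Contracting the piece `S` over `labX 1` leaves a graph in which only the piece over `labX 0` is
expanded, hence a single splicing; `G` is recovered from it by splicing at `labX 1`. -/
lemma MG.IsShape.inG2 (hc : IsCubic G) (he : (ofGraph G).EC 3) {f : V → K33TriangleVertex}
    (h : (ofGraph G).IsShape f) (h0 : ¬ ∃ v, f ⁻¹' {NiceCubic.labX 0} = {v})
    (h1 : ¬ ∃ v, f ⁻¹' {NiceCubic.labX 1} = {v}) : InG2 G := by
  classical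
  have hcub := ofGraph_cubic.2 hc
  set S : Set V := f ⁻¹' {NiceCubic.labX 1} with hS
  have hcutS : (ofGraph G).cut S = 3 := h.cut_fibre _
  have hcutC : (ofGraph G).cut Sᶜ = 3 := by rw [MG.cut_compl, hcutS]
  have hS3 := three_le_ncard hcub hcutS h1
  have h03 := three_le_ncard hcub (h.cut_fibre _) h0
  have hsub : f ⁻¹' {NiceCubic.labX 0} ⊆ Sᶜ := by
    intro v hv hv'
    have h2 : f v = NiceCubic.labX 0 := hv
    have h3 : f v = NiceCubic.labX 1 := hv'
    exact absurd (labX_inj.1 (h2.symm.trans h3)) (by decide)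
  have hC3 : 3 ≤ Sᶜ.ncard := h03.trans (Set.ncard_le_ncard hsub (Set.toFinite _))
  have hneS : Sᶜ.Nonempty := Set.nonempty_of_ncard_ne_zero (by omega)
  have hneC : Sᶜᶜ.Nonempty := by
    rw [compl_compl]; exact Set.nonempty_of_ncard_ne_zero (by omega)
  have hQ := ofGraph_contract hcub he hcutC hneC hC3
  set Q := (ofGraph G).contract Sᶜ with hQdef
  have hQc : Q.Cubic := MG.contract_cubic hcub hcutC
  have hQe : Q.EC 3 := MG.contract_EC he hneC
  let f' : Option (Sᶜ : Set V) → K33TriangleVertex := fun o => o.elim (NiceCubic.labX 1) fun v => f v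
  have hf' : f' ∘ MG.pr Sᶜ = f := by
    funext v
    by_cases hv : v ∈ Sᶜ
    · simp [f', MG.pr_of_mem hv]
    · have h2 : f v = NiceCubic.labX 1 := by by_contra h2; exact hv h2
      simp [f', MG.pr_of_notMem hv, h2]
  have hQq : ∀ p q, (Q.quot f').m p q = (ofGraph K33Triangle).m p q := by
    intro p q
    rw [hQdef, MG.contract, MG.quot_comp, hf', h.quot]
  have hfib : ∀ p, f' ⁻¹' {p} = MG.pr Sᶜ '' (f ⁻¹' {p}) := by
    intro p
    rw [← hf', Set.preimage_comp, Set.image_preimage_eq _ (MG.pr_surjective hneC)]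
  have hnone : f' ⁻¹' {NiceCubic.labX 1} = {none} := by
    ext (_ | v)
    · simp [f']
    · have h2 : f v ≠ NiceCubic.labX 1 := v.2
      simpa [f'] using h2
  set X := f' ⁻¹' {NiceCubic.labX 0} with hX
  have hXcut : Q.cut X = 3 := by
    rw [hX, ← MG.quot_cut, show Q.quot f' = ofGraph K33Triangle from MG.ext_m hQq,
      K33Triangle_cubic.cut_singleton]
  have hnoneX : none ∉ X := fun h2 => absurd (labX_inj.1 (show NiceCubic.labX 1 = NiceCubic.labX 0 from h2))
    (by decide)
  have hXne : Xᶜ.Nonempty := ⟨none, hnoneX⟩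
  have hX3 : 3 ≤ X.ncard := by
    refine three_le_ncard hQc hXcut ?_
    rintro ⟨o, ho⟩
    refine h0 ?_
    rcases o with _ | v
    · exact absurd (by rw [ho]; rfl) hnoneX
    · refine ⟨v, ?_⟩
      rw [← hf', Set.preimage_comp, ← hX, ho, MG.pr_preimage_some]
  obtain ⟨A, hA, hexit⟩ := h.labX 0
  have hXsome : ∀ v : (Sᶜ : Set V), some v ∈ X → f v = NiceCubic.labX 0 := fun v hv => hv
  have hHH₁ : InHHat (toGraph (Q.contract X)) := by
    refine inHHat_contract hQc hQe hXcut hXne hX3 (A := {o | Option.elim o False fun v => (v : V) ∈ A}) ?_ ?_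
    · rintro (_ | v) hv (_ | w) hw hvw
      · exact absurd hv hnoneX
      · exact absurd hv hnoneX
      · exact absurd hw hnoneX
      · rw [← MG.pr_coe v, ← MG.pr_coe w, hQdef, MG.contract_m v.2 w.2] at hvw
        exact hA v (hXsome v hv) w (hXsome w hw) hvw
    · rintro (_ | v) hv w hw hvw
      · exact absurd hv hnoneX
      · show (v : V) ∈ A
        have hfv := hXsome v hv
        rcases w with _ | w
        · rw [← MG.pr_coe v, hQdef, MG.contract_none v.2, ← Nat.pos_iff_ne_zero, wsum_pos] at hvw
          obtain ⟨_, rfl, w, hw', hvw'⟩ := hvw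
          refine hexit v hfv w (fun h2 => hw' ?_) hvw'.ne'
          exact hsub h2
        · rw [← MG.pr_coe v, ← MG.pr_coe w, hQdef, MG.contract_m v.2 w.2] at hvw
          exact hexit v hfv w hw hvw
  have hHH₂ : InHHat (toGraph ((ofGraph G).contract S)) := by
    obtain ⟨B, hB, hBexit⟩ := h.labX 1
    exact inHHat_contract hcub he hcutS hneS hS3 hB (fun x hx y hy hxy => hBexit x hx y hy hxy)
  have hfibre' : ∀ p, p ≠ NiceCubic.labX 0 → ∃ v, f' ⁻¹' {p} = {v} := by
    intro p hp
    by_cases hp1 : p = NiceCubic.labX 1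
    · subst hp1; exact ⟨none, hnone⟩
    · obtain ⟨v, hv⟩ := h.exists_fibre (p := p) (by
        rintro s rfl
        fin_cases s
        · exact absurd rfl hp
        · exact absurd rfl hp1)
      exact ⟨_, by rw [hfib, hv, Set.image_singleton]⟩
  obtain ⟨φ₁, ψ, hψ⟩ := exists_splice_iso (G := toGraph Q) (f := f') (x := NiceCubic.labX 0)
    (by rw [hQ]; exact hQq) hfibre' (X := X) hX.symm (H := toGraph (Q.contract X)) (by
      rw [hQ]; exact (ofGraph_contract hQc hQe hXcut hXne hX3).symm)
  have hx21 : NiceCubic.labX 1 ≠ NiceCubic.labX 0 := fun h2 => absurd (labX_inj.1 h2) (by decide)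
  have hψnone : ψ none = .inl ⟨NiceCubic.labX 1, hx21⟩ := hψ none hx21
  -- The contraction of `S`, read through `ψ`, is the first splicing, with `S` as the fibre of its
  -- vertex `labX 1`.
  have hρ : (ofGraph G).quot (ψ ∘ MG.pr Sᶜ) = ofGraph (splice K33Triangle (toGraph (Q.contract X))
      (NiceCubic.labX 0) none φ₁) := by
    rw [← MG.quot_comp]
    refine MG.quot_equiv ψ.toEquiv fun x y => ?_
    have := ofGraph_iso ψ x y
    rw [hQ] at this
    exact this
  have hpre : ∀ o, ψ ∘ MG.pr Sᶜ ⁻¹' {ψ o} = MG.pr Sᶜ ⁻¹' {o} := by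
    intro o; ext v; simp [ψ.injective.eq_iff]
  obtain ⟨φ₂, θ, -⟩ := exists_splice_iso (G := G) (f := ψ ∘ MG.pr Sᶜ)
    (x := .inl ⟨NiceCubic.labX 1, hx21⟩) (fun p q => by rw [hρ]) (by
      intro p hp
      obtain ⟨o, rfl⟩ := ψ.surjective p
      rcases o with _ | v
      · exact absurd hψnone hp
      · exact ⟨v, by rw [hpre, MG.pr_preimage_some]⟩) (X := S) (by
      rw [← hψnone, hpre, MG.pr_preimage_none, compl_compl])
    (ofGraph_contract hcub he hcutS hneS hS3).symm
  exact ⟨_, _, _, _, _, _, hx21, _, _, φ₁, φ₂, hHH₁, hHH₂, not_isNice_labX 0, not_isNice_labX 1, ⟨θ⟩⟩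

lemma MG.IsShape.mem_family (hc : IsCubic G) (he : (ofGraph G).EC 3) {f : V → K33TriangleVertex}
    (h : (ofGraph G).IsShape f) : Nonempty (G ≃g K33Triangle) ∨ InG1 G ∨ InG2 G := by
  by_cases h0 : ∃ v, f ⁻¹' {NiceCubic.labX 0} = {v} <;> by_cases h1 : ∃ v, f ⁻¹' {NiceCubic.labX 1} = {v}
  · refine Or.inl (exists_iso_of_fibres h.quot fun p => h.exists_fibre ?_)
    rintro s rfl
    fin_cases s
    · exact h0
    · exact h1
  · refine Or.inr (Or.inl (h.inG1 hc he h1 fun r hr => ?_))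
    fin_cases r
    · exact h0
    · exact absurd rfl hr
  · refine Or.inr (Or.inl (h.inG1 hc he h0 fun r hr => ?_))
    fin_cases r
    · exact absurd rfl hr
    · exact h1
  · exact Or.inr (Or.inr (h.inG2 hc he h0 h1))

end families
end NiceCubic

/-! ### Six vertices: the triangular prism. -/

namespace NiceCubic

lemma ncard_pair_le {α : Type*} (a b : α) : ({a, b} : Set α).ncard ≤ 2 :=
  (Set.ncard_insert_le _ _).trans (by rw [Set.ncard_singleton])

section prism
variable {V : Type u} [Fintype V] {G : SimpleGraph V}

/-- A cubic graph with six vertices which is not bipartite has a triangle. -/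
lemma exists_triangle (hc : IsCubic G) (hb : ¬ G.IsBipartite) (h6 : Fintype.card V = 6) :
    ∃ a b c, G.Adj a b ∧ G.Adj a c ∧ G.Adj b c := by
  by_contra hno
  push Not at hno
  obtain ⟨a⟩ : Nonempty V := Fintype.card_pos_iff.1 (by omega)
  have ha : (G.neighborSet a).ncard = 3 := hc a
  have hcompl := Set.ncard_add_ncard_compl (G.neighborSet a)
  rw [Nat.card_eq_fintype_card] at hcompl
  -- Without triangles the neighbours of `b` avoid those of `a`, and the complement has just three
  -- elements. So the graph is complete bipartite.
  have h1 : ∀ b ∈ G.neighborSet a, G.neighborSet b = (G.neighborSet a)ᶜ := by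
    intro b hab
    refine Set.eq_of_subset_of_ncard_le (fun c hbc hac => hno a b c hab hac hbc) ?_ (Set.toFinite _)
    have : (G.neighborSet b).ncard = 3 := hc b
    omega
  have h2 : ∀ e ∉ G.neighborSet a, G.neighborSet e = G.neighborSet a := by
    intro e hea
    refine (Set.eq_of_subset_of_ncard_le (fun b hab => ?_) ?_ (Set.toFinite _)).symm
    · have : e ∈ G.neighborSet b := by rw [h1 b hab]; exact hea
      exact G.adj_symm this
    · have : (G.neighborSet e).ncard = 3 := hc e
      omega
  refine hb (isBipartite_of_colour (A := G.neighborSet a) fun u v huv => ?_)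
  constructor
  · intro hu
    have : v ∈ G.neighborSet u := huv
    rwa [h1 u hu] at this
  · intro hv
    have : u ∈ G.neighborSet v := huv.symm
    rwa [h2 v hv] at this

lemma exists_third_nbr (hc : IsCubic G) {x y z : V} (hxy : G.Adj x y) (hxz : G.Adj x z) (hyz : y ≠ z) :
    ∃ w, w ≠ x ∧ w ≠ y ∧ w ≠ z ∧ G.Adj x w ∧ ∀ d, G.Adj x d → d = y ∨ d = z ∨ d = w := by
  have h1 : (G.neighborSet x).ncard = 3 := hc x
  have h2 : (G.neighborSet x \ {y, z}).ncard = 1 := by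
    rw [Set.ncard_sdiff (by rintro _ (rfl | rfl) <;> assumption), h1, Set.ncard_pair hyz]
  obtain ⟨w, hw⟩ := Set.ncard_eq_one.1 h2
  have hwm : w ∈ G.neighborSet x \ {y, z} := by rw [hw]; rfl
  refine ⟨w, hwm.1.ne', fun h => hwm.2 (Or.inl h), fun h => hwm.2 (Or.inr h), hwm.1, fun d hd => ?_⟩
  by_cases hdyz : d ∈ ({y, z} : Set V)
  · rcases hdyz with h | h
    · exact Or.inl h
    · exact Or.inr (Or.inl h)
  · have : d ∈ G.neighborSet x \ {y, z} := ⟨hd, hdyz⟩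
    rw [hw] at this
    exact Or.inr (Or.inr this)

lemma isCubic_prism : IsCubic (SimpleGraph.cycleGraph 6)ᶜ := by
  intro i
  rw [deg, Set.ncard_eq_toFinset_card']
  revert i
  decide

/-- A bijective homomorphism between cubic graphs is an isomorphism. -/
lemma exists_iso_of_bijective {W : Type v} {P : SimpleGraph W} (hP : IsCubic P) (hc : IsCubic G)
    {g : W → V} (hg : Function.Bijective g) (h : ∀ i j, P.Adj i j → G.Adj (g i) (g j)) :
    Nonempty (G ≃g P) := by
  have h1 : ∀ i, g '' P.neighborSet i = G.neighborSet (g i) := by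
    intro i
    refine Set.eq_of_subset_of_ncard_le ?_ ?_ (Set.toFinite _)
    · rintro _ ⟨j, hj, rfl⟩; exact h i j hj
    · rw [Set.ncard_image_of_injective _ hg.1]
      exact ((hc (g i)).trans (hP i).symm).le
  refine ⟨RelIso.symm ⟨Equiv.ofBijective g hg, ?_⟩⟩
  intro i j
  constructor
  · intro hij
    have : g j ∈ G.neighborSet (g i) := hij
    rw [← h1] at this
    obtain ⟨k, hk, hkj⟩ := this
    rwa [← hg.1 hkj]
  · exact h i j

/-- The triangle has a 3-edge cut. Adding a vertex with two neighbours in the triangle would give a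
cut with at most two edges. -/
lemma triangle_nbr (hc : IsCubic G) (he : (ofGraph G).EC 3) (h6 : Fintype.card V = 6) {a b c : V}
    (hab : G.Adj a b) (hac : G.Adj a c) (hbc : G.Adj b c) {w x y : V} (hw : w ∉ ({c, b, a} : Set V))
    (hx : x ∈ ({c, b, a} : Set V)) (hy : y ∈ ({c, b, a} : Set V)) (hxw : G.Adj x w) (hyw : G.Adj y w) :
    x = y := by
  have hcub := ofGraph_cubic.2 hc
  have h1 := hcub.cut_singleton a
  have h2 := hcub.cut_insert (X := {a}) (v := b) (by simpa using hab.ne')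
  have h3 := hcub.cut_insert (X := {b, a}) (v := c) (by
    rintro (h | h)
    · exact hbc.ne' h
    · exact hac.ne' h)
  rw [MG.e, wsum_singleton, ofGraph_adj hab] at h2
  rw [MG.e, wsum_insert_left (by simpa using hab.ne'), wsum_singleton, wsum_singleton,
    ofGraph_adj hac, ofGraph_adj hbc] at h3
  have h4 := hcub.cut_insert hw
  have h5 : 3 ≤ (ofGraph G).cut (insert w {c, b, a}) := by
    refine he _ ⟨w, Or.inl rfl⟩ (Set.nonempty_of_ncard_ne_zero ?_)
    have h6' := Set.ncard_add_ncard_compl (insert w ({c, b, a} : Set V))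
    have h7 : (insert w ({c, b, a} : Set V)).ncard ≤ 4 :=
      (Set.ncard_insert_le _ _).trans (Nat.succ_le_succ ((Set.ncard_insert_le _ _).trans
        (Nat.succ_le_succ (ncard_pair_le _ _))))
    rw [Nat.card_eq_fintype_card] at h6'
    omega
  exact (eq_of_wsum_le_one (w := (ofGraph G).m) (X := {c, b, a}) (Y := {w}) (by rw [MG.e] at h4; omega) hx hy
    rfl rfl (ofGraph_ne_zero.2 hxw) (ofGraph_ne_zero.2 hyw)).1

lemma exists_prism_iso (hc : IsCubic G) (he : (ofGraph G).EC 3) (hb : ¬ G.IsBipartite)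
    (h6 : Fintype.card V = 6) : Nonempty (G ≃g (SimpleGraph.cycleGraph 6)ᶜ) := by
  obtain ⟨a, b, c, hab, hac, hbc⟩ := exists_triangle hc hb h6
  obtain ⟨a', ha1, ha2, ha3, ha, ha'⟩ := exists_third_nbr hc hab hac hbc.ne
  obtain ⟨b', hb1, hb2, hb3, hb, hb'⟩ := exists_third_nbr hc hab.symm hbc hac.ne
  obtain ⟨c', hc1, hc2, hc3, hcc, hc'⟩ := exists_third_nbr hc hac.symm hbc.symm hab.ne
  have key := fun {w x y : V} => triangle_nbr hc he h6 hab hac hbc (w := w) (x := x) (y := y)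
  have haC : a' ∉ ({c, b, a} : Set V) := by simp [ha1, ha2, ha3]
  have hbC : b' ∉ ({c, b, a} : Set V) := by simp [hb1, hb2, hb3]
  have hab' : a' ≠ b' := by
    rintro rfl
    exact hab.ne (key haC (by simp) (by simp) ha hb)
  have hac' : a' ≠ c' := by
    rintro rfl
    exact hac.ne (key haC (by simp) (by simp) ha hcc)
  have hbc' : b' ≠ c' := by
    rintro rfl
    exact hbc.ne (key hbC (by simp) (by simp) hb hcc)
  -- In the complement of the 6-cycle the even and the odd numbers form triangles, and opposite
  -- numbers are adjacent.
  let g : Fin 6 → V := ![a, c', b, a', c, b']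
  have hinj : Function.Injective g := by
    have hab0 := hab.ne
    have hac0 := hac.ne
    have hbc0 := hbc.ne
    intro i j hij
    fin_cases i <;> fin_cases j <;> first
      | rfl
      | (exfalso; revert hij; first | assumption | (exact Ne.symm (by assumption)))
  have hbij : Function.Bijective g := (Fintype.bijective_iff_injective_and_card g).2 ⟨hinj, by simp [h6]⟩
  have hall : ∀ d, d = a ∨ d = c' ∨ d = b ∨ d = a' ∨ d = c ∨ d = b' := by
    intro d
    obtain ⟨i, rfl⟩ := hbij.2 d
    fin_cases i <;> simp [g]
  have hthree : ∀ x p q r : V, (∀ d, G.Adj x d → d = p ∨ d = q ∨ d = r) → G.Adj x q ∧ G.Adj x r := by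
    intro x p q r h
    have h3 : (G.neighborSet x).ncard = 3 := hc x
    constructor
    · by_contra hq
      have h1 : G.neighborSet x ⊆ {p, r} := by
        intro d hd
        rcases h d hd with rfl | rfl | rfl
        · simp
        · exact absurd hd hq
        · simp
      have h2 := (Set.ncard_le_ncard h1 (Set.toFinite _)).trans (ncard_pair_le _ _)
      omega
    · by_contra hq
      have h1 : G.neighborSet x ⊆ {p, q} := by
        intro d hd
        rcases h d hd with rfl | rfl | rfl
        · simp
        · simp
        · exact absurd hd hq
      have h2 := (Set.ncard_le_ncard h1 (Set.toFinite _)).trans (ncard_pair_le _ _)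
      omega
  obtain ⟨h1, h2⟩ := hthree a' a b' c' (by
    intro d hd
    rcases hall d with rfl | rfl | rfl | rfl | rfl | rfl
    · simp
    · simp
    · rcases hb' _ hd.symm with h | h | h
      · exact absurd h ha1
      · exact absurd h ha3
      · exact absurd h hab'
    · exact absurd hd G.irrefl
    · rcases hc' _ hd.symm with h | h | h
      · exact absurd h ha1
      · exact absurd h ha2
      · exact absurd h hac'
    · simp)
  obtain ⟨-, h3⟩ := hthree b' b a' c' (by
    intro d hd
    rcases hall d with rfl | rfl | rfl | rfl | rfl | rfl
    · rcases ha' _ hd.symm with h | h | h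
      · exact absurd h hb1
      · exact absurd h hb3
      · exact absurd h.symm hab'
    · simp
    · simp
    · simp
    · rcases hc' _ hd.symm with h | h | h
      · exact absurd h hb2
      · exact absurd h hb1
      · exact absurd h hbc'
    · exact absurd hd G.irrefl)
  refine exists_iso_of_bijective isCubic_prism hc hbij ?_
  intro i j hij
  fin_cases i <;> fin_cases j <;> first
    | (exfalso; revert hij; decide)
    | assumption
    | exact SimpleGraph.Adj.symm (by assumption)

end prism

end NiceCubic

/-! ### The theorem. -/

theorem theorem3p1 {V : Type u} [Finite V] (G : SimpleGraph V)
    (hcubic : NiceCubic.IsCubic G) (hconn : NiceCubic.IsKConnected 2 G)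
    (hnonbip : ¬ G.IsBipartite) :
    (4 ≤ NiceCubic.niceCount G ∧
      (NiceCubic.niceCount G = 4 ↔
        NiceCubic.IsK4 G ∨ ∃ i : ℕ, 1 ≤ i ∧ i ≤ 6 ∧ NiceCubic.InF i G)) ∧
    (NiceCubic.IsKConnected 3 G → ¬ NiceCubic.IsK4 G →
      6 ≤ NiceCubic.niceCount G ∧
      (NiceCubic.niceCount G = 6 ↔
        Nonempty (G ≃g (SimpleGraph.cycleGraph 6)ᶜ) ∨
        Nonempty (G ≃g NiceCubic.K33Triangle) ∨
        NiceCubic.InG1 G ∨ NiceCubic.InG2 G)) := by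
  have : Fintype V := Fintype.ofFinite V
  have hc := NiceCubic.ofGraph_cubic.2 hcubic
  have he := NiceCubic.EC_of_isKConnected hcubic (by norm_num) hconn
  have hb : ¬ (NiceCubic.ofGraph G).Bip := fun h => hnonbip (NiceCubic.ofGraph_bip.1 h)
  have hcard : (NiceCubic.ofGraph G).niceNum ≤ Fintype.card V := by
    rw [← Nat.card_eq_fintype_card, ← Set.ncard_univ]
    exact Set.ncard_le_ncard (Set.subset_univ _) (Set.toFinite _)
  rw [NiceCubic.niceCount_eq hcubic]
  constructor
  · obtain ⟨h4, h4'⟩ := NiceCubic.MG.four_le_niceNum _ V _ rfl hc he hb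
    refine ⟨h4, fun h => ?_, fun h => le_antisymm ?_ h4⟩
    · obtain ⟨W, R, k, S, hR, ⟨φ⟩⟩ := NiceCubic.exists_replaced _ V G rfl hcubic he hb (by
        rw [← h]
        refine Set.ncard_le_ncard (fun v hv => ?_) (Set.toFinite _)
        by_contra hv'
        exact hv (h4' h v hv'))
      by_cases hS : S = ∅
      · obtain ⟨ψ⟩ := hR.isK4 hS
        exact Or.inl ⟨φ.trans ψ⟩
      · exact Or.inr ⟨S.card, Finset.card_pos.2 (Finset.nonempty_iff_ne_empty.2 hS),
          NiceCubic.card_le_six hR.not_isDiag, W, R, k, S, hR, rfl, ⟨φ⟩⟩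
    · rcases h with ⟨⟨φ⟩⟩ | ⟨i, -, -, W, R, k, S, hR, -, ⟨φ⟩⟩
      · rw [Fintype.card_congr φ.toEquiv] at hcard
        simpa using hcard
      · exact NiceCubic.MG.niceNum_le_of_replaced hcubic hR φ
  · intro hconn3 hK4
    have he3 := NiceCubic.EC_of_isKConnected hcubic le_rfl hconn3
    have hne4 : Fintype.card V ≠ 4 := fun h =>
      hK4 (NiceCubic.isK4_of_card_four hcubic (by rw [Nat.card_eq_fintype_card, h]))
    obtain ⟨h6, h6'⟩ := NiceCubic.MG.six_le_niceNum _ V _ rfl hc he3 hb hne4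
    refine ⟨h6, fun h => ?_, fun h => le_antisymm ?_ h6⟩
    · rcases h6' h with h | ⟨f, hf⟩
      · exact Or.inl (NiceCubic.exists_prism_iso hcubic he3 hnonbip h)
      · exact Or.inr (hf.mem_family hcubic he3)
    · rcases h with ⟨⟨φ⟩⟩ | ⟨⟨φ⟩⟩ | h | h
      · rw [Fintype.card_congr φ.toEquiv] at hcard
        simpa using hcard
      · exact NiceCubic.niceNum_le_six_of_iso hcubic φ
      · exact h.niceNum_le_six hcubic
      · exact h.niceNum_le_six hcubic
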